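/- For $n<\omega$ let $S_n={}^{n\ge}2$ be the tree of binary sequences of length at most $n$, and let $L_n$ be the language with, for every $\eta\in S_n$, a unary predicate $P_\eta$, a binary relation $<_\eta$ and a binary function $\wedge_\eta$, and, for all $\eta,\nu\in S_n$ with $\nu$ an immediate successor of $\eta$, a unary function $G_{\eta,\nu}$. Let $T_n^\forall$ be the universal $L_n$-theory saying: the $P_\eta$ are pairwise disjoint; $<_\eta$ is a relation on $P_\eta$ making it a tree (a partial order in which the elements below any given one are linearly ordered) in which $x\wedge_\eta y$ is the meet, i.e. the greatest common lower bound, of $x,y\in P_\eta$, while $x\wedge_\eta y=x$ unless $x,y\in P_\eta$; and $G_{\eta,\nu}$ maps $P_\eta$ into $P_\nu$ and is the identity outside $P_\eta$. For a theory $T$, a cardinal $\kappa$, an ordinal $\delta$ and $n<\omega$, write $\kappa\to(\delta)_{T,n}$ if every set of $n$-tuples of size $\kappa$ (in the monster model, equivalently in any model, of $T$) contains a non-constant indiscernible sequence of length $\delta$ of its elements. Theorem. Each $T_n^\forall$ has a model completion $T_n$ (unique up to logical equivalence). The theory $T=\bigcup_{n<\omega}T_n$, in the countable language $\bigcup_{n<\omega}L_n$,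 is countable, complete, dependent (NIP) and eliminates quantifiers, and: 1. for all infinite cardinals $\mu\le\kappa$ such that $[\mu,\kappa]$ contains no (uncountable) strongly inaccessible cardinal, $\kappa\not\to(\mu)_{T,1}$; 2. in particular, if $\kappa$ is smaller than the first strongly inaccessible cardinal (any $\kappa$, if there is none), then $\kappa\not\to(\omega)_{T,n}$ for every $1\le n<\omega$. -/

import Mathlib

open scoped Cardinal Ordinal

universe w

namespace TreeOfTrees

open FirstOrder FirstOrder.Language

universe u v

/-! ### General model-theoretic notions -/

section General

variable {L : FirstOrder.Language.{u, v}}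

/-- `Tc` is a model completion of the theory `U`, in the same language: `Tc` extends `U`, every
model of `U` embeds in a model of `Tc`, and for every model `A` of `U` the theory `Tc ∪ Diag(A)` is
complete, i.e. any two models of `Tc` containing a copy of `A` satisfy the same formulas with
parameters from `A`.
As in Mathlib's notions of satisfiability and completeness of a theory, models range over
nonempty structures in `Type (max u v)`; by Löwenheim-Skolem other universes give the same notion. -/
structure IsModelCompletion (U Tc : L.Theory) : Prop where
  extends_base : ∀ φ ∈ U, Tc ⊨ᵇ φ
  embeds : ∀ A : Theory.ModelType.{u, v, max u v} U,
    ∃ M : Theory.ModelType.{u, v, max u v} Tc, Nonempty (A ↪[L] M)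
  complete_over : ∀ (A : Theory.ModelType.{u, v, max u v} U)
    (M N : Theory.ModelType.{u, v, max u v} Tc) (f : A ↪[L] M) (g : A ↪[L] N)
    (φ : L.Formula A), φ.Realize (f : A → M) ↔ φ.Realize (g : A → N)

/-- Quantifier elimination: modulo `T` every formula is equivalent to a quantifier-free formula in
the same free variables (`⊥` counts as a quantifier-free formula). -/
def EliminatesQuantifiers (T : L.Theory) : Prop :=
  ∀ (n : ℕ) (φ : L.Formula (Fin n)), ∃ ψ : L.Formula (Fin n), ψ.IsQF ∧ T ⊨ᵇ φ.iff ψ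

/-- `φ(x, y)` (`x` a `k`-tuple, `y` an `m`-tuple) has the independence property in `M`: there are
tuples `a i` (`i < ω`) and `b s` (`s ⊆ ω`) in `M` with `M ⊨ φ(a i, b s)` iff `i ∈ s`. -/
def HasIndependenceProperty {k m : ℕ} (φ : L.Formula (Fin k ⊕ Fin m)) (M : Type w)
    [L.Structure M] : Prop :=
  ∃ (a : ℕ → Fin k → M) (b : Set ℕ → Fin m → M),
    ∀ (i : ℕ) (s : Set ℕ), φ.Realize (Sum.elim (a i) (b s)) ↔ i ∈ s

/-- `T` is dependent (NIP): no formula has the independence property in a model of `T`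
in the (arbitrary) universe `w`. -/
def IsDependent (T : L.Theory) : Prop :=
  ∀ (k m : ℕ) (φ : L.Formula (Fin k ⊕ Fin m)) (M : Theory.ModelType.{u, v, w} T),
    ¬ HasIndependenceProperty φ M

variable (L) in
/-- A sequence `(a i : i ∈ I)` of `ι`-tuples of `M`, indexed by a linear order, is indiscernible
(over `∅`): any two increasing finite subsequences of the same length satisfy the same formulas. -/
def IsIndiscernible {I : Type*} [LinearOrder I] {ι : Type*} {M : Type*} [L.Structure M]
    (a : I → ι → M) : Prop :=
  ∀ (k : ℕ) (s t : Fin k → I), StrictMono s → StrictMono t →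
    ∀ φ : L.Formula (Fin k × ι),
      φ.Realize (fun p => a (s p.1) p.2) ↔ φ.Realize (fun p => a (t p.1) p.2)

/-- `κ → (δ)_{T,ι}`: every set `A` of size `κ` of `ι`-tuples contains a non-constant indiscernible
sequence of elements of `A` of length `δ`.  The monster-model convention is unfolded: the sets `A`
range over the sets of tuples of all models of `T` in the universe of `κ`; for a complete theory
these are, up to isomorphism, the elementary submodels of the monster model. -/
def Arrow (T : L.Theory) (κ : Cardinal.{w}) (δ : Ordinal.{w}) (ι : Type) : Prop :=
  ∀ (M : Theory.ModelType.{u, v, w} T) (A : Set (ι → M)), #A = κ →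
    ∃ a : Set.Iio δ → ι → M,
      (∀ i, a i ∈ A) ∧ (∃ i j, a i ≠ a j) ∧ IsIndiscernible L a

end General

/-! ### The language and the universal theory

Nodes of the binary tree are finite binary sequences (`List Bool`); the successors of `η` are
`η ++ [false]` and `η ++ [true]`. -/

/-- Function symbols over a set `S` of nodes: the binary `∧_η` for `η ∈ S`, and the unary
`G_{η, η⌢b}` whenever `η` and `η⌢b` are in `S`. -/
inductive TreeFunc (S : Set (List Bool)) : ℕ → Type
  | meet (η : List Bool) (h : η ∈ S) : TreeFunc S 2
  | conn (η : List Bool) (b : Bool) (h : η ∈ S) (h' : η ++ [b] ∈ S) : TreeFunc S 1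

/-- Relation symbols over a set `S` of nodes: the unary `P_η` and the binary `<_η` for `η ∈ S`. -/
inductive TreeRel (S : Set (List Bool)) : ℕ → Type
  | pred (η : List Bool) (h : η ∈ S) : TreeRel S 1
  | lt (η : List Bool) (h : η ∈ S) : TreeRel S 2

/-- The language `{P_η, <_η, ∧_η, G_{η,ν}}` over the set `S` of nodes. -/
def treeLang (S : Set (List Bool)) : FirstOrder.Language.{0, 0} := ⟨TreeFunc S, TreeRel S⟩

/-- The inclusion of languages for `S ⊆ S'`. -/
def treeLang.incl {S S' : Set (List Bool)} (h : S ⊆ S') : treeLang S →ᴸ treeLang S' where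
  onFunction := fun _ f => match f with
    | .meet η hη => TreeFunc.meet η (h hη)
    | .conn η b hη hη' => TreeFunc.conn η b (h hη) (h hη')
  onRelation := fun _ r => match r with
    | .pred η hη => TreeRel.pred η (h hη)
    | .lt η hη => TreeRel.lt η (h hη)

section Axioms

variable {S : Set (List Bool)} {n : ℕ}

/-- The formula `P_η(t)`. -/
def fP (η : List Bool) (h : η ∈ S) (t : (treeLang S).Term (Empty ⊕ Fin n)) :
    (treeLang S).BoundedFormula Empty n :=
  Relations.boundedFormula₁ (L := treeLang S) (TreeRel.pred η h) t

/-- The formula `t₁ <_η t₂`. -/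
def fLt (η : List Bool) (h : η ∈ S) (t₁ t₂ : (treeLang S).Term (Empty ⊕ Fin n)) :
    (treeLang S).BoundedFormula Empty n :=
  Relations.boundedFormula₂ (L := treeLang S) (TreeRel.lt η h) t₁ t₂

/-- The formula `t₁ ≤_η t₂`, i.e. `t₁ <_η t₂ ∨ t₁ = t₂`. -/
def fLe (η : List Bool) (h : η ∈ S) (t₁ t₂ : (treeLang S).Term (Empty ⊕ Fin n)) :
    (treeLang S).BoundedFormula Empty n :=
  fLt η h t₁ t₂ ⊔ t₁ =' t₂

/-- The term `t₁ ∧_η t₂`. -/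
def tMeet (η : List Bool) (h : η ∈ S) (t₁ t₂ : (treeLang S).Term (Empty ⊕ Fin n)) :
    (treeLang S).Term (Empty ⊕ Fin n) :=
  Functions.apply₂ (L := treeLang S) (TreeFunc.meet η h) t₁ t₂

/-- The term `G_{η, η⌢b}(t)`. -/
def tConn (η : List Bool) (b : Bool) (h : η ∈ S) (h' : η ++ [b] ∈ S)
    (t : (treeLang S).Term (Empty ⊕ Fin n)) : (treeLang S).Term (Empty ⊕ Fin n) :=
  Functions.apply₁ (L := treeLang S) (TreeFunc.conn η b h h') t

/-- The universal theory of trees of trees over the set `S` of nodes. -/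
inductive TreeAxiom (S : Set (List Bool)) : (treeLang S).Sentence → Prop
  /-- `P_η ∩ P_ν = ∅` for `η ≠ ν` -/
  | disjoint (η ν : List Bool) (h : η ∈ S) (h' : ν ∈ S) (hne : η ≠ ν) :
      TreeAxiom S (∀' ∼(fP η h (&0) ⊓ fP ν h' (&0)))
  /-- `<_η` is a relation on `P_η` -/
  | lt_dom (η : List Bool) (h : η ∈ S) :
      TreeAxiom S (∀' ∀' (fLt η h (&0) (&1) ⟹ (fP η h (&0) ⊓ fP η h (&1))))
  /-- `<_η` is irreflexive -/
  | irrefl (η : List Bool) (h : η ∈ S) :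
      TreeAxiom S (∀' ∼(fLt η h (&0) (&0)))
  /-- `<_η` is transitive -/
  | trans (η : List Bool) (h : η ∈ S) :
      TreeAxiom S (∀' ∀' ∀' (fLt η h (&0) (&1) ⟹ fLt η h (&1) (&2) ⟹ fLt η h (&0) (&2)))
  /-- the elements below a given one are linearly ordered by `<_η` -/
  | tree (η : List Bool) (h : η ∈ S) :
      TreeAxiom S (∀' ∀' ∀' (fLt η h (&0) (&2) ⟹ fLt η h (&1) (&2) ⟹
        (fLe η h (&0) (&1) ⊔ fLt η h (&1) (&0))))
  /-- on `P_η`, `x ∧_η y` is in `P_η` and is a lower bound of `x` and `y` -/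
  | meet_le (η : List Bool) (h : η ∈ S) :
      TreeAxiom S (∀' ∀' (fP η h (&0) ⟹ fP η h (&1) ⟹
        (fP η h (tMeet η h (&0) (&1)) ⊓
          (fLe η h (tMeet η h (&0) (&1)) (&0) ⊓ fLe η h (tMeet η h (&0) (&1)) (&1)))))
  /-- on `P_η`, every lower bound of `x` and `y` is below `x ∧_η y` -/
  | le_meet (η : List Bool) (h : η ∈ S) :
      TreeAxiom S (∀' ∀' ∀' (fP η h (&0) ⟹ fP η h (&1) ⟹ fLe η h (&2) (&0) ⟹ fLe η h (&2) (&1) ⟹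
        fLe η h (&2) (tMeet η h (&0) (&1))))
  /-- `x ∧_η y = x` unless both `x` and `y` are in `P_η` -/
  | meet_out (η : List Bool) (h : η ∈ S) :
      TreeAxiom S (∀' ∀' (∼(fP η h (&0) ⊓ fP η h (&1)) ⟹ (tMeet η h (&0) (&1) =' &0)))
  /-- `G_{η,ν}` maps `P_η` to `P_ν` -/
  | conn_mem (η : List Bool) (b : Bool) (h : η ∈ S) (h' : η ++ [b] ∈ S) :
      TreeAxiom S (∀' (fP η h (&0) ⟹ fP (η ++ [b]) h' (tConn η b h h' (&0))))
  /-- `G_{η,ν}` is the identity outside `P_η` -/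
  | conn_out (η : List Bool) (b : Bool) (h : η ∈ S) (h' : η ++ [b] ∈ S) :
      TreeAxiom S (∀' (∼(fP η h (&0)) ⟹ (tConn η b h h' (&0) =' &0)))

end Axioms

/-- The universal theory over the set `S` of nodes, as a set of sentences. -/
def univTheory (S : Set (List Bool)) : (treeLang S).Theory := {φ | TreeAxiom S φ}

/-- The finite binary tree `S_n`: binary sequences of length at most `n`. -/
def nodes (n : ℕ) : Set (List Bool) := {η | η.length ≤ n}

/-- The union, in the language `L = ⋃ L_n` over all nodes, of theories `Tn n` in the languages
`L_n` over `nodes n`. -/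
def unionTheory (Tn : ∀ n, (treeLang (nodes n)).Theory) : (treeLang Set.univ).Theory :=
  ⋃ n, (treeLang.incl (Set.subset_univ (nodes n))).onTheory (Tn n)

end TreeOfTrees

/-! Model completions, elimination and NIP. A model of the universal theory is a forest of meet
trees, one for each node, and the maps `G` lead to strictly longer nodes. Finite sets are therefore
tame over `nodes n`. Adding `x` to a finite closed set forces into the tree of `x` at most one
further point, the largest meet of `x` with the old elements; everything else that is forced is an
image under `G` and lies at a longer node. As lengths are bounded by `n`, one element costs a number
of points that depends on `n` only (`exists_tower_extension`). Moreover the position of one new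
point over a closed set is given by its node, one neighbour and its two images (`HasCode`), so a
tower of bounded length can be extended in polynomially many ways. If every such position is
realized (`Rich`), back and forth shows that isomorphisms of towers preserve all formulas
(`Rich.realize_iff`). As there are finitely many codes, quantifiers can be eliminated
(`Rich.exists_isQF`). The structure `GenModel` is rich: its trees consist of finitely supported
functions on initial segments of the rationals, and `G` depends on the length only, each pair of
targets occurring at a dense set of lengths. Models of the universal theory embed locally in
`GenModel`, hence embed in an ultrapower of it, and so its theory in `treeLang (nodes n)` is a model
completion. Model completions are unique (`IsModelCompletion.models`), so the union theory
axiomatizes the theory of `GenModel` in the full language. NIP follows by counting: subsets of `R`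
points would need `2 ^ R` types, but there are only polynomially many codes. Negative partition
relations. Since models of the universal theory embed in models of `T`, it suffices to place `κ`
points in the tree at `[]` of some tree system in which every nonconstant sequence of length `μ` is
visibly not indiscernible (`Spoiled`, `Bad`). This goes by induction on `κ`. For `κ < μ` no sequence
is injective. For `κ = ℵ₀` the map `G` at depth `ℓ` glues the numbers up to `ℓ + 1`, and some depth
glues two terms of the sequence but not a third. If `κ` is singular, one map `G` sends a point to
the index of its piece in a small partition, the other to its place inside the piece. If `κ ≤ 2 ^ c`
with `c < κ`, the points are branches of a binary tree of well-ordered height; an indiscernible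
sequence of branches is a comb, its consecutive meets have increasing lengths, and `G` carries these
lengths to the smaller cardinal. Only inaccessible cardinals stop the induction. -/

open FirstOrder FirstOrder.Language

namespace TreeOfTrees

/-! ### The axioms read in a structure -/

section Semantics

variable {S : Set (List Bool)} {M : Type*} [(treeLang S).Structure M]

/-- The interpretation of `P_η`. -/
def sP (η : List Bool) (h : η ∈ S) (x : M) : Prop :=
  Structure.RelMap (L := treeLang S) (TreeRel.pred η h) ![x]

/-- The interpretation of `<_η`. -/
def sLt (η : List Bool) (h : η ∈ S) (x y : M) : Prop :=
  Structure.RelMap (L := treeLang S) (TreeRel.lt η h) ![x, y]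

/-- The interpretation of `∧_η`. -/
def sMeet (η : List Bool) (h : η ∈ S) (x y : M) : M :=
  Structure.funMap (L := treeLang S) (TreeFunc.meet η h) ![x, y]

/-- The interpretation of `G_{η, η⌢b}`. -/
def sConn (η : List Bool) (b : Bool) (h : η ∈ S) (h' : η ++ [b] ∈ S) (x : M) : M :=
  Structure.funMap (L := treeLang S) (TreeFunc.conn η b h h') ![x]

theorem funMap_meet (η : List Bool) (h : η ∈ S) (v : Fin 2 → M) :
    Structure.funMap (L := treeLang S) (TreeFunc.meet η h) v = sMeet η h (v 0) (v 1) :=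
  congrArg (Structure.funMap (L := treeLang S) (TreeFunc.meet η h)) (List.ofFn_injective rfl)

theorem funMap_conn (η : List Bool) (b : Bool) (h : η ∈ S) (h' : η ++ [b] ∈ S) (v : Fin 1 → M) :
    Structure.funMap (L := treeLang S) (TreeFunc.conn η b h h') v = sConn η b h h' (v 0) :=
  congrArg (Structure.funMap (L := treeLang S) (TreeFunc.conn η b h h')) (List.ofFn_injective rfl)

theorem relMap_pred (η : List Bool) (h : η ∈ S) (v : Fin 1 → M) :
    Structure.RelMap (L := treeLang S) (TreeRel.pred η h) v = sP η h (v 0) :=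
  congrArg (Structure.RelMap (L := treeLang S) (TreeRel.pred η h)) (List.ofFn_injective rfl)

theorem relMap_lt (η : List Bool) (h : η ∈ S) (v : Fin 2 → M) :
    Structure.RelMap (L := treeLang S) (TreeRel.lt η h) v = sLt η h (v 0) (v 1) :=
  congrArg (Structure.RelMap (L := treeLang S) (TreeRel.lt η h)) (List.ofFn_injective rfl)

variable {n : ℕ} {v : Empty → M} {xs : Fin n → M}

theorem realize_fP {η : List Bool} {h : η ∈ S} {t : (treeLang S).Term (Empty ⊕ Fin n)} :
    (fP η h t).Realize v xs ↔ sP η h (t.realize (Sum.elim v xs)) :=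
  BoundedFormula.realize_rel₁

theorem realize_fLt {η : List Bool} {h : η ∈ S} {t₁ t₂ : (treeLang S).Term (Empty ⊕ Fin n)} :
    (fLt η h t₁ t₂).Realize v xs ↔
      sLt η h (t₁.realize (Sum.elim v xs)) (t₂.realize (Sum.elim v xs)) :=
  BoundedFormula.realize_rel₂

theorem realize_tMeet {η : List Bool} {h : η ∈ S} {t₁ t₂ : (treeLang S).Term (Empty ⊕ Fin n)}
    {u : Empty ⊕ Fin n → M} :
    (tMeet η h t₁ t₂).realize u = sMeet η h (t₁.realize u) (t₂.realize u) :=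
  Term.realize_functions_apply₂

theorem realize_tConn {η : List Bool} {b : Bool} {h : η ∈ S} {h' : η ++ [b] ∈ S}
    {t : (treeLang S).Term (Empty ⊕ Fin n)} {u : Empty ⊕ Fin n → M} :
    (tConn η b h h' t).realize u = sConn η b h h' (t.realize u) :=
  Term.realize_functions_apply₁

theorem realize_formula₁_pred {α : Type*} {η : List Bool} (h : η ∈ S) (t : (treeLang S).Term α)
    (u : α → M) : (Relations.formula₁ (L := treeLang S) (TreeRel.pred η h) t).Realize u ↔
      sP η h (t.realize u) :=
  Formula.realize_rel₁

theorem realize_formula₂_lt {α : Type*} {η : List Bool} (h : η ∈ S)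
    (t₁ t₂ : (treeLang S).Term α) (u : α → M) :
    (Relations.formula₂ (L := treeLang S) (TreeRel.lt η h) t₁ t₂).Realize u ↔
      sLt η h (t₁.realize u) (t₂.realize u) :=
  Formula.realize_rel₂

variable (S M) in
/-- The interpretations of the symbols of `treeLang S` in `M` satisfy the axioms of
`univTheory S`. -/
structure IsTreeModel : Prop where
  disjoint : ∀ (η ν : List Bool) (h : η ∈ S) (h' : ν ∈ S), η ≠ ν → ∀ x : M,
    ¬ (sP η h x ∧ sP ν h' x)
  lt_dom : ∀ (η : List Bool) (h : η ∈ S) (x y : M), sLt η h x y → sP η h x ∧ sP η h y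
  irrefl : ∀ (η : List Bool) (h : η ∈ S) (x : M), ¬ sLt η h x x
  trans : ∀ (η : List Bool) (h : η ∈ S) (x y z : M), sLt η h x y → sLt η h y z → sLt η h x z
  tree : ∀ (η : List Bool) (h : η ∈ S) (x y z : M), sLt η h x z → sLt η h y z →
    (sLt η h x y ∨ x = y) ∨ sLt η h y x
  meet_le : ∀ (η : List Bool) (h : η ∈ S) (x y : M), sP η h x → sP η h y →
    sP η h (sMeet η h x y) ∧ (sLt η h (sMeet η h x y) x ∨ sMeet η h x y = x) ∧
      (sLt η h (sMeet η h x y) y ∨ sMeet η h x y = y)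
  le_meet : ∀ (η : List Bool) (h : η ∈ S) (x y z : M), sP η h x → sP η h y →
    (sLt η h z x ∨ z = x) → (sLt η h z y ∨ z = y) →
    (sLt η h z (sMeet η h x y) ∨ z = sMeet η h x y)
  meet_out : ∀ (η : List Bool) (h : η ∈ S) (x y : M), ¬ (sP η h x ∧ sP η h y) → sMeet η h x y = x
  conn_mem : ∀ (η : List Bool) (b : Bool) (h : η ∈ S) (h' : η ++ [b] ∈ S) (x : M),
    sP η h x → sP (η ++ [b]) h' (sConn η b h h' x)
  conn_out : ∀ (η : List Bool) (b : Bool) (h : η ∈ S) (h' : η ++ [b] ∈ S) (x : M),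
    ¬ sP η h x → sConn η b h h' x = x

variable (S M) in
theorem model_univTheory_iff : M ⊨ univTheory S ↔ IsTreeModel S M := by
  have hP : ∀ φ : (treeLang S).Sentence, M ⊨ φ ↔
      BoundedFormula.Realize φ (default : Empty → M) default := fun φ => Iff.rfl
  constructor
  · intro hM
    have key : ∀ φ, TreeAxiom S φ → M ⊨ φ := fun φ hφ => hM.realize_of_mem φ hφ
    constructor
    · intro η ν h h' hne
      simpa [hP, fLe, realize_fP, realize_fLt, realize_tMeet, realize_tConn, Fin.snoc] using
        key _ (.disjoint η ν h h' hne)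
    · intro η h
      simpa [hP, fLe, realize_fP, realize_fLt, realize_tMeet, realize_tConn, Fin.snoc] using
        key _ (.lt_dom η h)
    · intro η h
      simpa [hP, fLe, realize_fP, realize_fLt, realize_tMeet, realize_tConn, Fin.snoc] using
        key _ (.irrefl η h)
    · intro η h
      simpa [hP, fLe, realize_fP, realize_fLt, realize_tMeet, realize_tConn, Fin.snoc] using
        key _ (.trans η h)
    · intro η h
      simpa [hP, fLe, realize_fP, realize_fLt, realize_tMeet, realize_tConn, Fin.snoc] using
        key _ (.tree η h)
    · intro η h
      simpa [hP, fLe, realize_fP, realize_fLt, realize_tMeet, realize_tConn, Fin.snoc] using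
        key _ (.meet_le η h)
    · intro η h
      simpa [hP, fLe, realize_fP, realize_fLt, realize_tMeet, realize_tConn, Fin.snoc] using
        key _ (.le_meet η h)
    · intro η h
      simpa [hP, fLe, realize_fP, realize_fLt, realize_tMeet, realize_tConn, Fin.snoc] using
        key _ (.meet_out η h)
    · intro η b h h'
      simpa [hP, fLe, realize_fP, realize_fLt, realize_tMeet, realize_tConn, Fin.snoc] using
        key _ (.conn_mem η b h h')
    · intro η b h h'
      simpa [hP, fLe, realize_fP, realize_fLt, realize_tMeet, realize_tConn, Fin.snoc] using
        key _ (.conn_out η b h h')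
  · intro hM
    refine Theory.model_iff _ |>.2 fun φ hφ => ?_
    cases hφ with
    | disjoint η ν h h' hne =>
      simpa [hP, fLe, realize_fP, realize_fLt, realize_tMeet, realize_tConn, Fin.snoc] using
        hM.disjoint η ν h h' hne
    | lt_dom η h =>
      simpa [hP, fLe, realize_fP, realize_fLt, realize_tMeet, realize_tConn, Fin.snoc] using
        hM.lt_dom η h
    | irrefl η h =>
      simpa [hP, fLe, realize_fP, realize_fLt, realize_tMeet, realize_tConn, Fin.snoc] using
        hM.irrefl η h
    | trans η h =>
      simpa [hP, fLe, realize_fP, realize_fLt, realize_tMeet, realize_tConn, Fin.snoc] using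
        hM.trans η h
    | tree η h =>
      simpa [hP, fLe, realize_fP, realize_fLt, realize_tMeet, realize_tConn, Fin.snoc] using
        hM.tree η h
    | meet_le η h =>
      simpa [hP, fLe, realize_fP, realize_fLt, realize_tMeet, realize_tConn, Fin.snoc] using
        hM.meet_le η h
    | le_meet η h =>
      simpa [hP, fLe, realize_fP, realize_fLt, realize_tMeet, realize_tConn, Fin.snoc] using
        hM.le_meet η h
    | meet_out η h =>
      simpa [hP, fLe, realize_fP, realize_fLt, realize_tMeet, realize_tConn, Fin.snoc] using
        hM.meet_out η h
    | conn_mem η b h h' =>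
      simpa [hP, fLe, realize_fP, realize_fLt, realize_tMeet, realize_tConn, Fin.snoc] using
        hM.conn_mem η b h h'
    | conn_out η b h h' =>
      simpa [hP, fLe, realize_fP, realize_fLt, realize_tMeet, realize_tConn, Fin.snoc] using
        hM.conn_out η b h h'

end Semantics

/-- A model of `univTheory S`, presented as a single forest: `node x` is the `η` with `x ∈ P_η`, the
order is the union of the tree orders, and `meet`, `conn` are the unions of the `∧_η` and of the
`G_{η, η⌢b}`. -/
class Forest (S : outParam (Set (List Bool))) (M : Type*) [(treeLang S).Structure M] extends
    PartialOrder M where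
  node : M → Option (List Bool)
  meet : M → M → M
  conn : Bool → M → M
  node_mem {x : M} {η : List Bool} : node x = some η → η ∈ S
  node_eq_of_le {x y : M} : x ≤ y → node x = node y
  eq_of_le {x y : M} : x ≤ y → node x = none → x = y
  le_or_le {x y z : M} : x ≤ z → y ≤ z → x ≤ y ∨ y ≤ x
  meet_le_left {x y : M} : meet x y ≤ x
  meet_le_right {x y : M} {η : List Bool} : node x = some η → node y = some η → meet x y ≤ y
  le_meet {x y z : M} : z ≤ x → z ≤ y → z ≤ meet x y
  meet_out {x y : M} : (∀ η, node x = some η → node y ≠ some η) → meet x y = x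
  node_conn {x : M} {η : List Bool} {b : Bool} : node x = some η → η ++ [b] ∈ S →
    node (conn b x) = some (η ++ [b])
  conn_out {x : M} {b : Bool} : (∀ η, node x = some η → η ++ [b] ∉ S) → conn b x = x
  sP_iff {η : List Bool} (h : η ∈ S) {x : M} : sP η h x ↔ node x = some η
  sLt_iff {η : List Bool} (h : η ∈ S) {x y : M} : sLt η h x y ↔ x < y ∧ node x = some η
  sMeet_eq {η : List Bool} (h : η ∈ S) {x y : M} : node x = some η → node y = some η →
    sMeet η h x y = meet x y
  sMeet_eq_left {η : List Bool} (h : η ∈ S) {x y : M} : ¬ (node x = some η ∧ node y = some η) →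
    sMeet η h x y = x
  sConn_eq {η : List Bool} {b : Bool} (h : η ∈ S) (h' : η ++ [b] ∈ S) {x : M} :
    node x = some η → sConn η b h h' x = conn b x
  sConn_eq_self {η : List Bool} {b : Bool} (h : η ∈ S) (h' : η ++ [b] ∈ S) {x : M} :
    node x ≠ some η → sConn η b h h' x = x

/-! ### Gluing the trees of a model into one forest -/

section OfModel

variable {S : Set (List Bool)} {M : Type*} [(treeLang S).Structure M]

open Classical in
/-- The forest of a model of `univTheory S`. -/
noncomputable abbrev IsTreeModel.forest (hM : IsTreeModel S M) : Forest S M :=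
  let node : M → Option (List Bool) := fun x =>
    if h : ∃ η, ∃ h : η ∈ S, sP η h x then some h.choose else none
  have hnode : ∀ {x η}, node x = some η ↔ ∃ h : η ∈ S, sP η h x := by
    intro x η
    simp only [node]
    split_ifs with h
    · constructor
      · rintro ⟨⟩
        exact h.choose_spec
      · rintro ⟨h1, h2⟩
        obtain ⟨h3, h4⟩ := h.choose_spec
        by_contra hne
        exact hM.disjoint _ _ h1 h3 (fun e => hne (by rw [e])) x ⟨h2, h4⟩
    · simp only [false_iff]
      exact fun h' => h ⟨η, h'⟩
  have hnode' : ∀ {x η} (h : η ∈ S), sP η h x ↔ node x = some η := fun h =>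
    ⟨fun h' => hnode.2 ⟨h, h'⟩, fun h' => (hnode.1 h').2⟩
  have hlt : ∀ {η} (h : η ∈ S) {x y}, sLt η h x y → node x = some η ∧ node y = some η :=
    fun h x y hxy => ⟨(hnode' h).1 (hM.lt_dom _ h x y hxy).1,
      (hnode' h).1 (hM.lt_dom _ h x y hxy).2⟩
  let le : M → M → Prop := fun x y => x = y ∨ ∃ η, ∃ h : η ∈ S, sLt η h x y
  have hle : ∀ {η} (h : η ∈ S) {x y}, node x = some η → (le x y ↔ sLt η h x y ∨ x = y) := by
    intro η h x y hx
    constructor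
    · rintro (rfl | ⟨ν, h', hxy⟩)
      · exact Or.inr rfl
      · have := (hlt h' hxy).1
        rw [hx] at this
        cases this
        exact Or.inl hxy
    · rintro (hxy | rfl)
      · exact Or.inr ⟨η, h, hxy⟩
      · exact Or.inl rfl
  have hle_node : ∀ {x y}, le x y → node x = node y := by
    rintro x y (rfl | ⟨ν, h', hxy⟩)
    · rfl
    · rw [(hlt h' hxy).1, (hlt h' hxy).2]
  let meet : M → M → M := fun x y =>
    if h : ∃ η, ∃ _ : η ∈ S, node x = some η ∧ node y = some η then
      sMeet h.choose h.choose_spec.1 x y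
    else x
  have hmeet : ∀ {η} (h : η ∈ S) {x y}, node x = some η → node y = some η →
      sMeet η h x y = meet x y := by
    intro η h x y hx hy
    have hex : ∃ η, ∃ _ : η ∈ S, node x = some η ∧ node y = some η := ⟨η, h, hx, hy⟩
    have : hex.choose = η := by
      obtain ⟨_, h1, -⟩ := hex.choose_spec
      exact Option.some.inj (h1.symm.trans hx)
    simp only [meet, dif_pos hex]
    congr 1
    exact this.symm
  have hmeet_out : ∀ {x y}, (∀ η, node x = some η → node y ≠ some η) → meet x y = x := by
    intro x y h
    simp only [meet]
    rw [dif_neg]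
    rintro ⟨η, -, h1, h2⟩
    exact h η h1 h2
  let conn : Bool → M → M := fun b x =>
    if h : ∃ η, ∃ (_ : η ∈ S) (_ : η ++ [b] ∈ S), node x = some η then
      sConn h.choose b h.choose_spec.1 h.choose_spec.2.1 x
    else x
  have hconn : ∀ {η b} (h : η ∈ S) (h' : η ++ [b] ∈ S) {x}, node x = some η →
      sConn η b h h' x = conn b x := by
    intro η b h h' x hx
    have hex : ∃ η, ∃ (_ : η ∈ S) (_ : η ++ [b] ∈ S), node x = some η := ⟨η, h, h', hx⟩
    have : hex.choose = η := by
      obtain ⟨_, _, h1⟩ := hex.choose_spec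
      exact Option.some.inj (h1.symm.trans hx)
    simp only [conn, dif_pos hex]
    congr 1
    exact this.symm
  { le := le
    le_refl := fun x => Or.inl rfl
    le_trans := by
      rintro x y z (rfl | ⟨η, h, hxy⟩) hyz
      · exact hyz
      · rcases (hle h (hlt h hxy).2).1 hyz with hyz | rfl
        · exact Or.inr ⟨η, h, hM.trans η h _ _ _ hxy hyz⟩
        · exact Or.inr ⟨η, h, hxy⟩
    le_antisymm := by
      rintro x y (rfl | ⟨η, h, hxy⟩) hyx
      · rfl
      · rcases (hle h (hlt h hxy).2).1 hyx with hyx | rfl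
        · exact absurd (hM.trans η h _ _ _ hxy hyx) (hM.irrefl η h _)
        · rfl
    node := node
    meet := meet
    conn := conn
    node_mem := fun h => (hnode.1 h).1
    node_eq_of_le := hle_node
    eq_of_le := by
      rintro x y (rfl | ⟨η, h, hxy⟩) hx
      · rfl
      · rw [(hlt h hxy).1] at hx
        cases hx
    le_or_le := by
      rintro x y z (rfl | ⟨η, h, hxz⟩) hyz
      · exact Or.inr hyz
      · have hy : node y = some η := by rw [hle_node hyz, (hlt h hxz).2]
        rcases (hle h hy).1 hyz with hyz | rfl
        · rw [hle h hy, hle h (hlt h hxz).1]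
          rcases hM.tree η h x y z hxz hyz with h1 | h1
          · exact Or.inl h1
          · exact Or.inr (Or.inl h1)
        · exact Or.inl (Or.inr ⟨η, h, hxz⟩)
    meet_le_left := by
      intro x y
      by_cases hex : ∀ η, node x = some η → node y ≠ some η
      · exact Or.inl (hmeet_out hex)
      · push Not at hex
        obtain ⟨η, hx, hy⟩ := hex
        obtain ⟨h, hx'⟩ := hnode.1 hx
        rw [← hmeet h hx hy]
        obtain ⟨h1, h2, -⟩ := hM.meet_le η h x y hx' ((hnode' h).2 hy)
        exact (hle h ((hnode' h).1 h1)).2 h2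
    meet_le_right := by
      intro x y η hx hy
      obtain ⟨h, hx'⟩ := hnode.1 hx
      rw [← hmeet h hx hy]
      obtain ⟨h1, -, h2⟩ := hM.meet_le η h x y hx' ((hnode' h).2 hy)
      exact (hle h ((hnode' h).1 h1)).2 h2
    le_meet := by
      intro x y z hzx hzy
      by_cases hex : ∀ η, node x = some η → node y ≠ some η
      · rw [hmeet_out hex]
        exact hzx
      · push Not at hex
        obtain ⟨η, hx, hy⟩ := hex
        obtain ⟨h, hx'⟩ := hnode.1 hx
        have hz : node z = some η := by rw [hle_node hzx, hx]
        rw [← hmeet h hx hy]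
        exact (hle h hz).2 (hM.le_meet η h x y z hx' ((hnode' h).2 hy) ((hle h hz).1 hzx)
          ((hle h hz).1 hzy))
    meet_out := hmeet_out
    node_conn := by
      intro x η b hx h'
      obtain ⟨h, hx'⟩ := hnode.1 hx
      rw [← hconn h h' hx]
      exact (hnode' h').1 (hM.conn_mem η b h h' x hx')
    conn_out := by
      intro x b h
      simp only [conn]
      rw [dif_neg]
      rintro ⟨η, -, h2, h1⟩
      exact h η h1 h2
    sP_iff := fun h => hnode' h
    sLt_iff := by
      intro η h x y
      constructor
      · intro hxy
        have hx := (hlt h hxy).1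
        have hy := (hlt h hxy).2
        refine ⟨⟨(hle h hx).2 (Or.inl hxy), fun hyx => ?_⟩, hx⟩
        rcases (hle h hy).1 hyx with hyx | rfl
        · exact hM.irrefl η h _ (hM.trans η h _ _ _ hxy hyx)
        · exact hM.irrefl η h _ hxy
      · rintro ⟨⟨h1, h2⟩, hx⟩
        rcases (hle h hx).1 h1 with h1 | rfl
        · exact h1
        · exact absurd (Or.inl rfl) h2
    sMeet_eq := hmeet
    sMeet_eq_left := by
      intro η h x y hn
      refine hM.meet_out η h x y ?_
      rwa [hnode', hnode']
    sConn_eq := hconn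
    sConn_eq_self := by
      intro η b h h' x hn
      refine hM.conn_out η b h h' x ?_
      rwa [hnode'] }

end OfModel

/-! ### Finite closed sets built point by point -/

section Towers

variable {S : Set (List Bool)} {M : Type*} [(treeLang S).Structure M] [Forest S M]

namespace Forest

theorem meet_eq_left {x y : M} (h : x ≤ y) : meet x y = x :=
  le_antisymm meet_le_left (le_meet le_rfl h)

theorem meet_eq_right {x y : M} (h : y ≤ x) : meet x y = y := by
  cases hy : node y with
  | none => rw [eq_of_le h hy]; exact meet_eq_left le_rfl
  | some η =>
    exact le_antisymm (meet_le_right ((node_eq_of_le h).symm.trans hy) hy) (le_meet h le_rfl)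

theorem meet_comm {x y : M} {η : List Bool} (hx : node x = some η) (hy : node y = some η) :
    meet x y = meet y x :=
  le_antisymm (le_meet (meet_le_right hx hy) meet_le_left)
    (le_meet (meet_le_right hy hx) meet_le_left)

theorem node_meet (x y : M) : node (meet x y) = node x :=
  node_eq_of_le meet_le_left

theorem conn_ne {x : M} {η : List Bool} {b : Bool} (hx : node x = some η) (h : η ++ [b] ∈ S) :
    conn b x ≠ x := by
  intro he
  have := node_conn hx h
  rw [he, hx] at this
  simpa using congrArg List.length (Option.some.inj this)

theorem not_applicable {x : M} {b : Bool} (h : conn b x = x) :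
    ∀ η, node x = some η → η ++ [b] ∉ S :=
  fun _ hη h' => conn_ne hη h' h

/-- A map `G` that applies to `x` changes its node, so it fixes `x` exactly when it does not apply,
and that is decided by the node. -/
theorem conn_eq_self_iff_of_node_eq {M' : Type*} [(treeLang S).Structure M'] [Forest S M']
    {x : M} {x' : M'} {b : Bool} (h : node x = node x') : conn b x = x ↔ conn b x' = x' :=
  ⟨fun he => conn_out (by rw [← h]; exact not_applicable he),
    fun he => conn_out (by rw [h]; exact not_applicable he)⟩

/-- Closure under the operations. -/
def Closed (A : Set M) : Prop :=
  (∀ x ∈ A, ∀ y ∈ A, meet x y ∈ A) ∧ ∀ x ∈ A, ∀ b, conn b x ∈ A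

/-- One point can be added to a closed set if its meets and its images are there. -/
theorem Closed.adjoin {A : Set M} (hA : Closed A) {x : M}
    (hm : ∀ y ∈ A, ∀ η, node x = some η → node y = some η → meet x y ∈ A ∨ meet x y = x)
    (hc : ∀ b, conn b x ∈ A ∨ conn b x = x) : Closed (insert x A) := by
  have hm' : ∀ y ∈ A, meet x y ∈ insert x A := by
    intro y hy
    by_cases h : ∃ η, node x = some η ∧ node y = some η
    · obtain ⟨η, h1, h2⟩ := h
      rcases hm y hy η h1 h2 with h | h
      · exact Or.inr h
      · exact Or.inl h
    · rw [meet_out fun η h1 h2 => h ⟨η, h1, h2⟩]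
      exact Or.inl rfl
  constructor
  · rintro y (rfl | hy) z (rfl | hz)
    · rw [meet_eq_left le_rfl]
      exact Or.inl rfl
    · exact hm' z hz
    · by_cases h : ∃ η, node z = some η ∧ node y = some η
      · obtain ⟨η, h1, h2⟩ := h
        rw [meet_comm h2 h1]
        exact hm' y hy
      · rw [meet_out fun η h1 h2 => h ⟨η, h2, h1⟩]
        exact Or.inr hy
    · exact Or.inr (hA.1 y hy z hz)
  · rintro y (rfl | hy) b
    · rcases hc b with h | h
      · exact Or.inr h
      · exact Or.inl h
    · exact Or.inr (hA.2 y hy b)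

theorem closed_empty : Closed (∅ : Set M) :=
  ⟨fun _ h => absurd h id, fun _ h => absurd h id⟩

/-- The first `N` values of `a` as a set. -/
abbrev seg {M : Type*} (a : ℕ → M) (N : ℕ) : Set M := a '' Set.Iio N

theorem mem_seg {M : Type*} {a : ℕ → M} {N i : ℕ} (h : i < N) : a i ∈ seg a N :=
  ⟨i, h, rfl⟩

theorem seg_succ {M : Type*} (a : ℕ → M) (N : ℕ) : seg a (N + 1) = insert (a N) (seg a N) := by
  rw [seg, ← Set.image_insert_eq]
  congr 1
  ext i
  simp only [Set.mem_Iio, Set.mem_insert_iff]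
  omega

theorem seg_congr {M : Type*} {a a' : ℕ → M} {N : ℕ} (h : ∀ i < N, a' i = a i) :
    seg a' N = seg a N :=
  Set.image_congr h

/-- All initial segments of `a`, up to length `N`, are closed. -/
def Tower (a : ℕ → M) (N : ℕ) : Prop :=
  ∀ k ≤ N, Closed (seg a k)

theorem tower_zero (a : ℕ → M) : Tower a 0 := by
  intro k hk
  obtain rfl : k = 0 := by omega
  simpa [seg] using closed_empty

theorem Tower.congr {a a' : ℕ → M} {N : ℕ} (h : Tower a N) (he : ∀ i < N, a' i = a i) :
    Tower a' N := by
  intro k hk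
  rw [seg_congr fun i hi => he i (by omega)]
  exact h k hk

theorem Tower.succ {a : ℕ → M} {N : ℕ} (h : Tower a N) (h' : Closed (insert (a N) (seg a N))) :
    Tower a (N + 1) := by
  intro k hk
  rcases Nat.lt_or_ge k (N + 1) with h1 | h1
  · exact h k (by omega)
  · obtain rfl : k = N + 1 := by omega
    rwa [seg_succ]

/-- `a'`, of length `N'`, is a tower inside `C` which extends the tower `a` of length `N` by at
most `D` elements, the new elements being in `P_ν` for `ν` of length at least `ℓ`. -/
structure Extends (D ℓ : ℕ) (C : Set M) (a : ℕ → M) (N : ℕ) (a' : ℕ → M) (N' : ℕ) : Prop where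
  le : N ≤ N'
  le_add : N' ≤ N + D
  agree : ∀ i < N, a' i = a i
  tower : Tower a' N'
  new : ∀ i < N', a' i ∈ seg a N ∨ ∃ ν, node (a' i) = some ν ∧ ℓ ≤ ν.length
  sub : seg a' N' ⊆ C

theorem Extends.seg_sub {D ℓ N N' : ℕ} {C : Set M} {a a' : ℕ → M} (h : Extends D ℓ C a N a' N') :
    seg a N ⊆ seg a' N' := by
  rintro _ ⟨i, hi, rfl⟩
  exact ⟨i, lt_of_lt_of_le hi h.le, h.agree i hi⟩

theorem Extends.refl {N : ℕ} {C : Set M} {a : ℕ → M} (D ℓ : ℕ) (ha : Tower a N)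
    (hC : seg a N ⊆ C) : Extends D ℓ C a N a N :=
  ⟨le_rfl, by omega, fun _ _ => rfl, ha, fun _ hi => Or.inl (mem_seg hi), hC⟩

theorem Extends.trans {D D' ℓ ℓ' N N' N'' : ℕ} {C : Set M} {a a' a'' : ℕ → M}
    (h : Extends D ℓ C a N a' N') (h' : Extends D' ℓ' C a' N' a'' N'') (hℓ : ℓ ≤ ℓ') :
    Extends (D + D') ℓ C a N a'' N'' where
  le := h.le.trans h'.le
  le_add := by have := h.le_add; have := h'.le_add; omega
  agree := fun i hi => (h'.agree i (lt_of_lt_of_le hi h.le)).trans (h.agree i hi)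
  tower := h'.tower
  new := by
    intro i hi
    rcases h'.new i hi with ⟨j, hj, he⟩ | ⟨ν, h1, h2⟩
    · rw [← he]
      exact h.new j hj
    · exact Or.inr ⟨ν, h1, hℓ.trans h2⟩
  sub := h'.sub

theorem Extends.mono {D D' ℓ ℓ' N N' : ℕ} {C : Set M} {a a' : ℕ → M}
    (h : Extends D ℓ C a N a' N') (hD : D ≤ D') (hℓ : ℓ' ≤ ℓ) : Extends D' ℓ' C a N a' N' where
  le := h.le
  le_add := by have := h.le_add; omega
  agree := h.agree
  tower := h.tower
  new := fun i hi => (h.new i hi).imp id fun ⟨ν, h1, h2⟩ => ⟨ν, h1, hℓ.trans h2⟩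
  sub := h.sub

/-- `D` steps suffice to add any element of any `P_η` with `η` of length at least `ℓ`. -/
def Reachable (M : Type*) [(treeLang S).Structure M] [Forest S M] (D ℓ : ℕ) : Prop :=
  ∀ (C : Set M), Closed C → ∀ (a : ℕ → M) (N : ℕ), Tower a N → seg a N ⊆ C →
    ∀ x ∈ C, ∀ η, node x = some η → ℓ ≤ η.length →
      ∃ a' N', Extends D η.length C a N a' N' ∧ x ∈ seg a' N'

theorem exists_extends_conn {D : ℕ} {C : Set M} (hC : Closed C) {a : ℕ → M} {N : ℕ}
    (ha : Tower a N) (haC : seg a N ⊆ C) {x : M} (hx : x ∈ C) {η : List Bool}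
    (hη : node x = some η) (hD : Reachable M D (η.length + 1)) (b : Bool) :
    ∃ a' N', Extends D (η.length + 1) C a N a' N' ∧ (conn b x ∈ seg a' N' ∨ conn b x = x) := by
  by_cases hb : η ++ [b] ∈ S
  · obtain ⟨a', N', h1, h2⟩ := hD C hC a N ha haC (conn b x) (hC.2 x hx b) _ (node_conn hη hb)
      (by simp)
    exact ⟨a', N', by simpa using h1, Or.inl h2⟩
  · refine ⟨a, N, Extends.refl _ _ ha haC, Or.inr (conn_out ?_)⟩
    intro ν hν
    rw [hη] at hν
    cases hν
    exact hb

/-- Adding an element `x` whose meets are already there. -/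
theorem exists_extends_of_meet {D : ℕ} {C : Set M} (hC : Closed C) {a : ℕ → M} {N : ℕ}
    (ha : Tower a N) (haC : seg a N ⊆ C) {x : M} (hx : x ∈ C) {η : List Bool}
    (hη : node x = some η) (hD : Reachable M D (η.length + 1))
    (hm : ∀ y ∈ seg a N, node y = some η → meet x y ∈ seg a N ∨ meet x y = x) :
    ∃ a' N', Extends (2 * D + 1) η.length C a N a' N' ∧ x ∈ seg a' N' ∧
      ∀ y ∈ seg a' N', node y = some η → y ∈ seg a N ∨ y = x := by
  obtain ⟨a₁, N₁, h₁, hc₁⟩ := exists_extends_conn hC ha haC hx hη hD false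
  obtain ⟨a₂, N₂, h₂, hc₂⟩ := exists_extends_conn hC h₁.tower h₁.sub hx hη hD true
  have h₁₂ := h₁.trans h₂ le_rfl
  have hcx : ∀ b, conn b x ∈ seg a₂ N₂ ∨ conn b x = x := by
    rintro (_ | _)
    · exact hc₁.imp (fun h => h₂.seg_sub h) id
    · exact hc₂
  -- The images just added live at nodes longer than `η`; the tree at `η` has not grown, so the
  -- hypothesis on meets survives.
  have hold : ∀ y ∈ seg a₂ N₂, node y = some η → y ∈ seg a N := by
    rintro _ ⟨i, hi, rfl⟩ hy
    rcases h₁₂.new i hi with h | ⟨ν, h3, h4⟩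
    · exact h
    · rw [hy] at h3
      cases h3
      omega
  have hagree : ∀ i < N₂, Function.update a₂ N₂ x i = a₂ i := fun i hi =>
    Function.update_of_ne (by omega) _ _
  have hseg : seg (Function.update a₂ N₂ x) (N₂ + 1) = insert x (seg a₂ N₂) := by
    rw [seg_succ, seg_congr hagree, Function.update_self]
  refine ⟨Function.update a₂ N₂ x, N₂ + 1, ⟨?_, ?_, ?_, ?_, ?_, ?_⟩, ?_, ?_⟩
  · have := h₁₂.le; omega
  · have := h₁₂.le_add; omega
  · exact fun i hi => (hagree i (by have := h₁₂.le; omega)).trans (h₁₂.agree i hi)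
  · refine (h₂.tower.congr hagree).succ ?_
    rw [seg_congr hagree, Function.update_self]
    refine (h₂.tower N₂ le_rfl).adjoin ?_ hcx
    intro y hy ν hν hyν
    rw [hη] at hν
    cases hν
    exact (hm y (hold y hy hyν) hyν).imp (fun h => h₁₂.seg_sub h) id
  · intro i hi
    rcases Nat.lt_or_ge i N₂ with h | h
    · rw [hagree i h]
      exact (h₁₂.new i h).imp id fun ⟨ν, h1, h2⟩ => ⟨ν, h1, by omega⟩
    · obtain rfl : i = N₂ := by omega
      rw [Function.update_self]
      exact Or.inr ⟨η, hη, le_rfl⟩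
  · rw [hseg]
    exact Set.insert_subset hx h₂.sub
  · rw [hseg]
    exact Or.inl rfl
  · rw [hseg]
    rintro y (rfl | hy) hyη
    · exact Or.inr rfl
    · exact Or.inl (hold y hy hyη)

/-- The elements below `y₀` form a chain, so either `e` is below `y`, or `e` is above the meet of
`y₀` with `y` and then has this same meet with `y`. -/
theorem meet_mem_of_le {A : Set M} (hA : Closed A) {e y₀ : M} (hy₀ : y₀ ∈ A) (he : e ≤ y₀)
    {η : List Bool} (hη : node e = some η) {y : M} (hy : y ∈ A) (hyη : node y = some η) :
    meet e y ∈ A ∨ meet e y = e := by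
  by_cases hey : e ≤ y
  · exact Or.inr (meet_eq_left hey)
  · left
    have hy₀η : node y₀ = some η := (node_eq_of_le he).symm.trans hη
    have : meet e y = meet y₀ y := by
      refine le_antisymm (le_meet (meet_le_left.trans he) (meet_le_right hη hyη)) ?_
      rcases le_or_le he (meet_le_left : meet y₀ y ≤ y₀) with h | h
      · exact absurd (h.trans (meet_le_right hy₀η hyη)) hey
      · exact le_meet h (meet_le_right hy₀η hyη)
    rw [this]
    exact hA.1 _ hy₀ _ hy

/-- Let `e` be the largest meet of `x` with an old element of its tree. First `e` is added, below an
old element; after that all meets of `x` are present and `x` is added. Each of the two costs `2 * D`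
for its images and `1` for itself. -/
theorem reachable_step {D ℓ : ℕ} (hD : Reachable M D (ℓ + 1)) :
    Reachable M (2 * (2 * D + 1)) ℓ := by
  intro C hC a N ha haC x hx η hη hℓ
  have hD' : Reachable M D (η.length + 1) :=
    fun C hC a N ha haC x hx ν hν hℓ' => hD C hC a N ha haC x hx ν hν (by omega)
  by_cases hex : ∃ y ∈ seg a N, node y = some η
  · have hfin : {z | ∃ y ∈ seg a N, node y = some η ∧ z = meet x y}.Finite := by
      refine (((Set.finite_Iio N).image a).image (meet x)).subset ?_
      rintro z ⟨y, hy, -, rfl⟩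
      exact ⟨y, hy, rfl⟩
    obtain ⟨y₁, hy₁, hy₁'⟩ := hex
    obtain ⟨e, ⟨y₀, hy₀, hy₀η, rfl⟩, hmax⟩ := hfin.exists_maximal ⟨meet x y₁, y₁, hy₁, hy₁', rfl⟩
    set e := meet x y₀ with he
    have heη : node e = some η := (node_meet x y₀).trans hη
    have hex : e ≤ x := meet_le_left
    have hey₀ : e ≤ y₀ := meet_le_right hη hy₀η
    have hmax' : ∀ y ∈ seg a N, node y = some η → meet x y ≤ e := by
      intro y hy hyη
      rcases le_or_le (meet_le_left : meet x y ≤ x) hex with h | h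
      · exact h
      · exact hmax ⟨y, hy, hyη, rfl⟩ h
    have hme : ∀ y ∈ seg a N, node y = some η → meet e y ∈ seg a N ∨ meet e y = e :=
      fun y hy hyη => meet_mem_of_le (ha N le_rfl) hy₀ hey₀ heη hy hyη
    obtain ⟨a₁, N₁, h₁, he₁, hold⟩ := exists_extends_of_meet hC ha haC
      (hC.1 x hx y₀ (haC hy₀)) heη hD' hme
    obtain ⟨a₂, N₂, h₂, hx₂, -⟩ := exists_extends_of_meet hC h₁.tower h₁.sub hx hη hD' (by
      intro y hy hyη
      left
      rcases hold y hy hyη with hy' | rfl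
      · have : meet x y = meet e y :=
          le_antisymm (le_meet (hmax' y hy' hyη) (meet_le_right hη hyη))
            (le_meet (meet_le_left.trans hex) (meet_le_right heη hyη))
        rw [this]
        rcases hme y hy' hyη with h | h
        · exact h₁.seg_sub h
        · rw [h]
          exact he₁
      · rw [meet_eq_right hex]
        exact he₁)
    exact ⟨a₂, N₂, (h₁.trans h₂ le_rfl).mono (by omega) le_rfl, hx₂⟩
  · obtain ⟨a₁, N₁, h₁, hx₁, -⟩ := exists_extends_of_meet hC ha haC hx hη hD' (by
      intro y hy hyη
      exact absurd ⟨y, hy, hyη⟩ hex)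
    exact ⟨a₁, N₁, h₁.mono (by omega) le_rfl, hx₁⟩

/-- The number of steps needed to add an element to a tower, over nodes of length at most `n`. -/
theorem exists_reachable (n : ℕ) : ∃ D : ℕ, ∀ (S : Set (List Bool)), S ⊆ nodes n →
    ∀ (M : Type w) [(treeLang S).Structure M] [Forest S M], Reachable M D 0 := by
  have : ∀ r : ℕ, ∃ D : ℕ, ∀ (S : Set (List Bool)), S ⊆ nodes n →
      ∀ (M : Type w) [(treeLang S).Structure M] [Forest S M], Reachable M D (n + 1 - r) := by
    intro r
    induction r with
    | zero =>
      -- There is no node of length `n + 1`, so nothing has to be added; the induction then descends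
      -- to length `0`.
      refine ⟨0, fun S hS M _ _ C _ a N _ _ x _ η hη hℓ => ?_⟩
      have : η.length ≤ n := hS (node_mem hη)
      omega
    | succ r ih =>
      obtain ⟨D, hD⟩ := ih
      refine ⟨2 * (2 * D + 1), fun S hS M _ _ => ?_⟩
      apply reachable_step
      intro C hC a N ha haC x hx η hη hℓ
      exact hD S hS M C hC a N ha haC x hx η hη (by omega)
  obtain ⟨D, hD⟩ := this (n + 1)
  exact ⟨D, fun S hS M _ _ => by simpa using hD S hS M⟩

/-- Every tower over nodes of length at most `n` extends, by a number of steps that depends on `n`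
only, to one containing a given element. -/
theorem exists_tower_extension (n : ℕ) : ∃ D : ℕ, ∀ (S : Set (List Bool)), S ⊆ nodes n →
    ∀ (M : Type w) [(treeLang S).Structure M] [Forest S M] (C : Set M), Closed C →
    ∀ (a : ℕ → M) (N : ℕ), Tower a N → seg a N ⊆ C → ∀ x ∈ C,
      ∃ a' : ℕ → M, (∀ i < N, a' i = a i) ∧ Tower a' (N + D) ∧ seg a' (N + D) ⊆ C ∧
        x ∈ seg a' (N + D) := by
  obtain ⟨D, hD⟩ := exists_reachable.{w} n
  refine ⟨D + 1, fun S hS M _ _ C hC a N ha haC x hx => ?_⟩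
  have : ∃ a' N', N ≤ N' ∧ N' ≤ N + (D + 1) ∧ (∀ i < N, a' i = a i) ∧ Tower a' N' ∧
      seg a' N' ⊆ C ∧ x ∈ seg a' N' := by
    cases hη : node x with
    | some η =>
      obtain ⟨a', N', h, hx'⟩ := hD S hS M C hC a N ha haC x hx η hη (Nat.zero_le _)
      exact ⟨a', N', h.le, by have := h.le_add; omega, h.agree, h.tower, h.sub, hx'⟩
    | none =>
      have hagree : ∀ i < N, Function.update a N x i = a i := fun i hi =>
        Function.update_of_ne (by omega) _ _
      have hseg : seg (Function.update a N x) (N + 1) = insert x (seg a N) := by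
        rw [seg_succ, seg_congr hagree, Function.update_self]
      refine ⟨Function.update a N x, N + 1, by omega, by omega, hagree, ?_, ?_, ?_⟩
      · refine (ha.congr hagree).succ ?_
        rw [seg_congr hagree, Function.update_self]
        refine (ha N le_rfl).adjoin ?_ fun b => Or.inr (conn_out ?_)
        · intro y _ η h
          rw [hη] at h
          cases h
        · intro η h
          rw [hη] at h
          cases h
      · rw [hseg]
        exact Set.insert_subset hx haC
      · rw [hseg]
        exact Or.inl rfl
  obtain ⟨a', N', h1, h2, h3, h4, h5, j, hj, rfl⟩ := this
  set x := a' j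
  -- Repeating `x` pads the tower to length exactly `N + D`. Fixed lengths are what later makes the
  -- set of codes finite, and repetitions are why codes of kind `0` exist.
  let a'' : ℕ → M := fun i => if i < N' then a' i else x
  have hlt : ∀ i < N', a'' i = a' i := fun i hi => if_pos hi
  have hseg : ∀ k, N' ≤ k → seg a'' k = seg a' N' := by
    intro k hk
    apply Set.Subset.antisymm
    · rintro _ ⟨i, hi, rfl⟩
      by_cases hi' : i < N'
      · rw [hlt i hi']
        exact mem_seg hi'
      · simp only [a'', if_neg hi']
        exact mem_seg hj
    · rintro _ ⟨i, hi, rfl⟩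
      exact ⟨i, lt_of_lt_of_le hi hk, hlt i hi⟩
  refine ⟨a'', fun i hi => (hlt i (by omega)).trans (h3 i hi), ?_, ?_, ?_⟩
  · intro k hk
    rcases le_total k N' with h | h
    · exact (h4.congr hlt) k h
    · rw [hseg k h]
      exact h4 N' le_rfl
  · rw [hseg _ h2]
    exact h5
  · rw [hseg _ h2]
    exact mem_seg hj

theorem exists_tower_extension_list (n : ℕ) : ∃ D : ℕ, ∀ (S : Set (List Bool)), S ⊆ nodes n →
    ∀ (M : Type w) [(treeLang S).Structure M] [Forest S M] (C : Set M), Closed C →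
    ∀ (a : ℕ → M) (N : ℕ), Tower a N → seg a N ⊆ C → ∀ (m : ℕ) (x : Fin m → M), (∀ i, x i ∈ C) →
      ∃ a' : ℕ → M, (∀ i < N, a' i = a i) ∧ Tower a' (N + m * D) ∧ seg a' (N + m * D) ⊆ C ∧
        ∀ i, x i ∈ seg a' (N + m * D) := by
  obtain ⟨D, hD⟩ := exists_tower_extension.{w} n
  refine ⟨D, fun S hS M _ _ C hC a N ha haC m => ?_⟩
  induction m with
  | zero => exact fun x _ => ⟨a, fun _ _ => rfl, by simpa using ha, by simpa using haC,
      fun i => i.elim0⟩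
  | succ m ih =>
    intro x hx
    obtain ⟨a₁, h1, h2, h3, h4⟩ := ih (fun i => x i.castSucc) (fun i => hx _)
    obtain ⟨a₂, h5, h6, h7, h8⟩ := hD S hS M C hC a₁ _ h2 h3 (x (Fin.last m)) (hx _)
    have he : N + m * D + D = N + (m + 1) * D := by ring
    rw [he] at h6 h7 h8
    refine ⟨a₂, fun i hi => (h5 i (by omega)).trans (h1 i hi), h6, h7, ?_⟩
    intro i
    refine Fin.lastCases h8 (fun i => ?_) i
    obtain ⟨j, hj, hji⟩ := h4 i
    have hj' : j < N + m * D := hj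
    exact ⟨j, by rw [Set.mem_Iio]; omega, (h5 j hj').trans hji⟩

end Forest
end Towers

open Forest

/-! ### Isomorphisms of towers and codes of one-point extensions -/

section Isos

variable {S : Set (List Bool)} {M' : Type*} [(treeLang S).Structure M']
  [Forest S M'] {M : Type*} [(treeLang S).Structure M] [Forest S M]

/-- The first `N` values of `a` and of `a'` are closed under the operations, and `a i ↦ a' i` is an
isomorphism between them. -/
structure Iso (N : ℕ) (a : ℕ → M) (a' : ℕ → M') : Prop where
  node : ∀ i < N, node (a i) = node (a' i)
  le : ∀ i < N, ∀ j < N, a i ≤ a j ↔ a' i ≤ a' j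
  meet : ∀ i < N, ∀ j < N, ∃ k < N, meet (a i) (a j) = a k ∧ meet (a' i) (a' j) = a' k
  conn : ∀ i < N, ∀ b, ∃ k < N, conn b (a i) = a k ∧ conn b (a' i) = a' k

namespace Iso

variable {N : ℕ} {a : ℕ → M} {a' : ℕ → M'}

theorem symm (h : Iso N a a') : Iso N a' a where
  node i hi := (h.node i hi).symm
  le i hi j hj := (h.le i hi j hj).symm
  meet i hi j hj := by
    obtain ⟨k, hk, h1, h2⟩ := h.meet i hi j hj
    exact ⟨k, hk, h2, h1⟩
  conn i hi b := by
    obtain ⟨k, hk, h1, h2⟩ := h.conn i hi b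
    exact ⟨k, hk, h2, h1⟩

theorem eq_iff (h : Iso N a a') {i j : ℕ} (hi : i < N) (hj : j < N) : a i = a j ↔ a' i = a' j := by
  rw [le_antisymm_iff, le_antisymm_iff, h.le i hi j hj, h.le j hj i hi]

theorem lt_iff (h : Iso N a a') {i j : ℕ} (hi : i < N) (hj : j < N) : a i < a j ↔ a' i < a' j := by
  rw [lt_iff_le_not_ge, lt_iff_le_not_ge, h.le i hi j hj, h.le j hj i hi]

theorem zero (a : ℕ → M) (a' : ℕ → M') : Iso 0 a a' :=
  ⟨fun _ h => absurd h (Nat.not_lt_zero _), fun _ h => absurd h (Nat.not_lt_zero _),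
    fun _ h => absurd h (Nat.not_lt_zero _), fun _ h => absurd h (Nat.not_lt_zero _)⟩

theorem congr {b : ℕ → M} {b' : ℕ → M'} (h : Iso N a a') (hb : ∀ i < N, b i = a i)
    (hb' : ∀ i < N, b' i = a' i) : Iso N b b' where
  node i hi := by rw [hb i hi, hb' i hi, h.node i hi]
  le i hi j hj := by rw [hb i hi, hb' i hi, hb j hj, hb' j hj, h.le i hi j hj]
  meet i hi j hj := by
    obtain ⟨k, hk, h1, h2⟩ := h.meet i hi j hj
    exact ⟨k, hk, by rw [hb i hi, hb j hj, hb k hk, h1], by rw [hb' i hi, hb' j hj, hb' k hk, h2]⟩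
  conn i hi b := by
    obtain ⟨k, hk, h1, h2⟩ := h.conn i hi b
    exact ⟨k, hk, by rw [hb i hi, hb k hk, h1], by rw [hb' i hi, hb' k hk, h2]⟩

theorem closed_left (h : Iso N a a') : Closed (seg a N) := by
  constructor
  · rintro _ ⟨i, hi, rfl⟩ _ ⟨j, hj, rfl⟩
    obtain ⟨k, hk, h1, -⟩ := h.meet i hi j hj
    rw [h1]
    exact mem_seg hk
  · rintro _ ⟨i, hi, rfl⟩ b
    obtain ⟨k, hk, h1, -⟩ := h.conn i hi b
    rw [h1]
    exact mem_seg hk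

theorem closed_right (h : Iso N a a') : Closed (seg a' N) :=
  h.symm.closed_left

theorem realize_term (h : Iso N a a') {α : Type*} (t : (treeLang S).Term α) (v : α → ℕ)
    (hv : ∀ i, v i < N) :
    ∃ k < N, t.realize (fun i => a (v i)) = a k ∧ t.realize (fun i => a' (v i)) = a' k := by
  induction t with
  | var i => exact ⟨v i, hv i, rfl, rfl⟩
  | func f ts ih =>
    cases f with
    | meet η hη =>
      obtain ⟨i, hi, hi1, hi2⟩ := ih 0
      obtain ⟨j, hj, hj1, hj2⟩ := ih 1
      have e1 : (Term.func (L := treeLang S) (TreeFunc.meet η hη) ts).realize (fun i => a (v i)) =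
          sMeet η hη (a i) (a j) :=
        (funMap_meet η hη _).trans (by rw [hi1, hj1])
      have e2 : (Term.func (L := treeLang S) (TreeFunc.meet η hη) ts).realize (fun i => a' (v i)) =
          sMeet η hη (a' i) (a' j) :=
        (funMap_meet η hη _).trans (by rw [hi2, hj2])
      rw [e1, e2]
      by_cases hij : Forest.node (a i) = some η ∧ Forest.node (a j) = some η
      · obtain ⟨k, hk, h1, h2⟩ := h.meet i hi j hj
        rw [Forest.sMeet_eq hη hij.1 hij.2, Forest.sMeet_eq hη (by rw [← h.node i hi, hij.1])
          (by rw [← h.node j hj, hij.2])]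
        exact ⟨k, hk, h1, h2⟩
      · rw [Forest.sMeet_eq_left hη hij, Forest.sMeet_eq_left hη
          (by rwa [← h.node i hi, ← h.node j hj])]
        exact ⟨i, hi, rfl, rfl⟩
    | conn η b hη hη' =>
      obtain ⟨i, hi, hi1, hi2⟩ := ih 0
      have e1 : (Term.func (L := treeLang S) (TreeFunc.conn η b hη hη') ts).realize
          (fun i => a (v i)) = sConn η b hη hη' (a i) :=
        (funMap_conn η b hη hη' _).trans (by rw [hi1])
      have e2 : (Term.func (L := treeLang S) (TreeFunc.conn η b hη hη') ts).realize
          (fun i => a' (v i)) = sConn η b hη hη' (a' i) :=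
        (funMap_conn η b hη hη' _).trans (by rw [hi2])
      rw [e1, e2]
      by_cases hij : Forest.node (a i) = some η
      · obtain ⟨k, hk, h1, h2⟩ := h.conn i hi b
        rw [Forest.sConn_eq hη hη' hij, Forest.sConn_eq hη hη' (by rw [← h.node i hi, hij])]
        exact ⟨k, hk, h1, h2⟩
      · rw [Forest.sConn_eq_self hη hη' hij, Forest.sConn_eq_self hη hη'
          (by rwa [← h.node i hi])]
        exact ⟨i, hi, rfl, rfl⟩

theorem relMap_iff (h : Iso N a a') {l : ℕ} (R : (treeLang S).Relations l) (v : Fin l → ℕ)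
    (hv : ∀ i, v i < N) :
    Structure.RelMap R (fun i => a (v i)) ↔ Structure.RelMap R (fun i => a' (v i)) := by
  cases R with
  | pred η hη =>
    refine (iff_of_eq (relMap_pred η hη _)).trans (Iff.trans ?_
      (iff_of_eq (relMap_pred η hη _)).symm)
    rw [Forest.sP_iff, Forest.sP_iff, h.node _ (hv 0)]
  | lt η hη =>
    refine (iff_of_eq (relMap_lt η hη _)).trans (Iff.trans ?_ (iff_of_eq (relMap_lt η hη _)).symm)
    rw [Forest.sLt_iff, Forest.sLt_iff, h.node _ (hv 0), h.lt_iff (hv 0) (hv 1)]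

theorem realize_isAtomic (h : Iso N a a') {α : Type*} {n : ℕ}
    {φ : (treeLang S).BoundedFormula α n} (hφ : φ.IsAtomic) (v : α → ℕ) (xs : Fin n → ℕ)
    (hv : ∀ i, v i < N) (hxs : ∀ i, xs i < N) :
    φ.Realize (fun i => a (v i)) (fun i => a (xs i)) ↔
      φ.Realize (fun i => a' (v i)) (fun i => a' (xs i)) := by
  have e1 : Sum.elim (fun i => a (v i)) (fun i => a (xs i)) = fun i => a (Sum.elim v xs i) := by
    funext i
    cases i <;> rfl
  have e2 : Sum.elim (fun i => a' (v i)) (fun i => a' (xs i)) = fun i => a' (Sum.elim v xs i) := by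
    funext i
    cases i <;> rfl
  have hvx : ∀ i, Sum.elim v xs i < N := by
    rintro (i | i)
    · exact hv i
    · exact hxs i
  cases hφ with
  | equal t₁ t₂ =>
    obtain ⟨i, hi, hi1, hi2⟩ := h.realize_term t₁ _ hvx
    obtain ⟨j, hj, hj1, hj2⟩ := h.realize_term t₂ _ hvx
    rw [BoundedFormula.realize_bdEqual, BoundedFormula.realize_bdEqual, e1, e2, hi1, hi2, hj1, hj2,
      h.eq_iff hi hj]
  | rel R ts =>
    choose k hk h1 h2 using fun i => h.realize_term (ts i) _ hvx
    rw [BoundedFormula.realize_rel, BoundedFormula.realize_rel, e1, e2]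
    simp only [h1, h2]
    exact h.relMap_iff R k hk

theorem realize_isQF (h : Iso N a a') {α : Type*} {n : ℕ}
    {φ : (treeLang S).BoundedFormula α n} (hφ : φ.IsQF) (v : α → ℕ) (xs : Fin n → ℕ)
    (hv : ∀ i, v i < N) (hxs : ∀ i, xs i < N) :
    φ.Realize (fun i => a (v i)) (fun i => a (xs i)) ↔
      φ.Realize (fun i => a' (v i)) (fun i => a' (xs i)) := by
  induction hφ with
  | falsum => rfl
  | of_isAtomic hφ => exact h.realize_isAtomic hφ v xs hv hxs
  | imp _ _ h1 h2 => rw [BoundedFormula.realize_imp, BoundedFormula.realize_imp, h1, h2]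

/-- Extension of an isomorphism by one point. -/
theorem succ (h : Iso N a a') (hc : Closed (seg a (N + 1))) (hc' : Closed (seg a' (N + 1)))
    (hnode : Forest.node (a N) = Forest.node (a' N))
    (hle : ∀ j < N, a j ≤ a N ↔ a' j ≤ a' N) (hge : ∀ j < N, a N ≤ a j ↔ a' N ≤ a' j)
    (hconn : ∀ b, ∃ k < N + 1, Forest.conn b (a N) = a k ∧ Forest.conn b (a' N) = a' k) :
    Iso (N + 1) a a' := by
  have hnode' : ∀ i < N + 1, Forest.node (a i) = Forest.node (a' i) := by
    intro i hi
    rcases Nat.lt_succ_iff_lt_or_eq.1 hi with hi | rfl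
    · exact h.node i hi
    · exact hnode
  have hle' : ∀ i < N + 1, ∀ j < N + 1, a i ≤ a j ↔ a' i ≤ a' j := by
    intro i hi j hj
    rcases Nat.lt_succ_iff_lt_or_eq.1 hi with hi | rfl <;>
      rcases Nat.lt_succ_iff_lt_or_eq.1 hj with hj | rfl
    · exact h.le i hi j hj
    · exact hle i hi
    · exact hge j hj
    · simp
  refine ⟨hnode', hle', ?_, ?_⟩
  · intro i hi j hj
    by_cases hij : ∃ η, Forest.node (a i) = some η ∧ Forest.node (a j) = some η
    · obtain ⟨η, h1, h2⟩ := hij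
      have h1' := (hnode' i hi).symm.trans h1
      have h2' := (hnode' j hj).symm.trans h2
      obtain ⟨k, hk, hk'⟩ := hc.1 _ (mem_seg hi) _ (mem_seg hj)
      obtain ⟨l, hl, hl'⟩ := hc'.1 _ (mem_seg hi) _ (mem_seg hj)
      have hk : k < N + 1 := hk
      have hl : l < N + 1 := hl
      refine ⟨k, hk, hk'.symm, ?_⟩
      -- The meet is determined by the order among the listed elements: `l` indexes the meet on the
      -- right, and comparing it with `k` through `hle'` identifies the two.
      apply le_antisymm
      · rw [← hl', ← hle' l hl k hk, hk']
        apply le_meet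
        · rw [hle' l hl i hi, hl']
          exact meet_le_left
        · rw [hle' l hl j hj, hl']
          exact meet_le_right h1' h2'
      · apply le_meet
        · rw [← hle' k hk i hi, hk']
          exact meet_le_left
        · rw [← hle' k hk j hj, hk']
          exact meet_le_right h1 h2
    · refine ⟨i, hi, meet_out fun η h1 h2 => hij ⟨η, h1, h2⟩, meet_out fun η h1 h2 =>
        hij ⟨η, (hnode' i hi).trans h1, (hnode' j hj).trans h2⟩⟩
  · intro i hi b
    rcases Nat.lt_succ_iff_lt_or_eq.1 hi with hi | rfl
    · obtain ⟨k, hk, h1⟩ := h.conn i hi b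
      exact ⟨k, by omega, h1⟩
    · exact hconn b

end Iso

/-- The position of `a N` over `a 0, …, a (N - 1)` is given by the `node`, the indices `g b` of the
images `G_b (a N)`, and, according to the kind `t`: an index `p` with `a N = a p` (kind `0`); the
index `p` of the least element above `a N` (kind `1`); if there is none, the index `p` of the
greatest element below `a N` (kind `2`); kind `3` means that there is none either. -/
def HasCode (a : ℕ → M) (N : ℕ) (ν : Option (List Bool)) (g : Bool → ℕ) (p : ℕ) (t : Fin 4) :
    Prop :=
  node (a N) = ν ∧
  ((t = 0 ∧ p < N ∧ a N = a p) ∨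
    (t ≠ 0 ∧ (∀ b, conn b (a N) = a N ∨ (g b < N ∧ conn b (a N) = a (g b))) ∧
      ((t = 1 ∧ p < N ∧ a N < a p ∧ ∀ j < N, a N ≤ a j → a p ≤ a j) ∨
      (t = 2 ∧ p < N ∧ a p < a N ∧ (∀ j < N, ¬ a N ≤ a j) ∧ ∀ j < N, a j ≤ a N → a j ≤ a p) ∨
      (t = 3 ∧ ∀ j < N, ¬ a N ≤ a j ∧ ¬ a j ≤ a N))))

theorem HasCode.congr {a a' : ℕ → M} {N : ℕ} {ν : Option (List Bool)} {g : Bool → ℕ} {p : ℕ}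
    {t : Fin 4} (h : HasCode a N ν g p t) (ha : ∀ i < N + 1, a' i = a i) :
    HasCode a' N ν g p t := by
  have hN : a' N = a N := ha N (by omega)
  have hi : ∀ i < N, a' i = a i := fun i hi => ha i (by omega)
  obtain ⟨h1, h2⟩ := h
  refine ⟨by rw [hN, h1], ?_⟩
  rcases h2 with ⟨h2, h3, h4⟩ | ⟨h2, h3, h4⟩
  · exact Or.inl ⟨h2, h3, by rw [hN, hi p h3, h4]⟩
  · refine Or.inr ⟨h2, fun b => ?_, ?_⟩
    · rcases h3 b with h3 | ⟨h3, h5⟩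
      · exact Or.inl (by rw [hN, h3])
      · exact Or.inr ⟨h3, by rw [hN, hi _ h3, h5]⟩
    · rcases h4 with ⟨h4, h5, h6, h7⟩ | ⟨h4, h5, h6, h7, h8⟩ | ⟨h4, h5⟩
      · refine Or.inl ⟨h4, h5, by rwa [hN, hi _ h5], fun j hj => ?_⟩
        rw [hN, hi _ h5, hi _ hj]
        exact h7 j hj
      · refine Or.inr (Or.inl ⟨h4, h5, by rwa [hN, hi _ h5], fun j hj => ?_, fun j hj => ?_⟩)
        · rw [hN, hi _ hj]
          exact h7 j hj
        · rw [hN, hi _ h5, hi _ hj]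
          exact h8 j hj
      · refine Or.inr (Or.inr ⟨h4, fun j hj => ?_⟩)
        rw [hN, hi _ hj]
        exact h5 j hj

/-- A minimal old element above `a N` is the least one, since its meet with any other one is again
old and above `a N`. The old elements below `a N` form a finite chain, so they have a greatest
element if there are any. -/
theorem exists_hasCode {a : ℕ → M} {N : ℕ} (hc : Closed (seg a N)) (hc' : Closed (seg a (N + 1))) :
    ∃ g p t, (∀ b, g b ≤ N) ∧ p ≤ N ∧ HasCode a N (node (a N)) g p t := by
  by_cases hdup : ∃ p < N, a N = a p
  · obtain ⟨p, hp, he⟩ := hdup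
    exact ⟨fun _ => 0, p, 0, fun _ => Nat.zero_le _, hp.le, rfl, Or.inl ⟨rfl, hp, he⟩⟩
  push Not at hdup
  have hg : ∀ b, ∃ g, g ≤ N ∧ (conn b (a N) = a N ∨ (g < N ∧ conn b (a N) = a g)) := by
    intro b
    obtain ⟨j, hj, he⟩ := hc'.2 _ (mem_seg (Nat.lt_succ_self N)) b
    rcases Nat.lt_succ_iff_lt_or_eq.1 (show j < N + 1 from hj) with hj | rfl
    · exact ⟨j, hj.le, Or.inr ⟨hj, he.symm⟩⟩
    · exact ⟨0, Nat.zero_le _, Or.inl he.symm⟩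
  choose g hgN hg using hg
  have hnone : ∀ j < N, a N ≤ a j → ∃ η, node (a N) = some η ∧ node (a j) = some η := by
    intro j hj hle
    cases hη : node (a N) with
    | none => exact absurd (eq_of_le hle hη) (hdup j hj)
    | some η => exact ⟨η, rfl, by rw [← node_eq_of_le hle, hη]⟩
  by_cases habove : ∃ j < N, a N ≤ a j
  · have hfin : {z | ∃ j < N, a N ≤ a j ∧ z = a j}.Finite := by
      refine ((Set.finite_Iio N).image a).subset ?_
      rintro z ⟨j, hj, -, rfl⟩
      exact mem_seg hj
    obtain ⟨j₀, hj₀, hj₀'⟩ := habove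
    obtain ⟨_, ⟨p, hp, hpN, rfl⟩, hmin⟩ := hfin.exists_minimal ⟨a j₀, j₀, hj₀, hj₀', rfl⟩
    refine ⟨g, p, 1, hgN, hp.le, rfl, Or.inr ⟨by decide, hg, Or.inl ⟨rfl, hp,
      lt_of_le_of_ne hpN (hdup p hp), fun j hj hjN => ?_⟩⟩⟩
    obtain ⟨η, hη, hpη⟩ := hnone p hp hpN
    have hjη : node (a j) = some η := by rw [← node_eq_of_le hjN, hη]
    obtain ⟨k, hk, hk'⟩ := hc.1 _ (mem_seg hp) _ (mem_seg hj)
    have h1 : a p ≤ a k := hmin ⟨k, hk, by rw [hk']; exact le_meet hpN hjN, rfl⟩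
      (by rw [hk']; exact meet_le_left)
    rw [hk'] at h1
    exact h1.trans (meet_le_right hpη hjη)
  push Not at habove
  by_cases hbelow : ∃ j < N, a j ≤ a N
  · have hfin : {z | ∃ j < N, a j ≤ a N ∧ z = a j}.Finite := by
      refine ((Set.finite_Iio N).image a).subset ?_
      rintro z ⟨j, hj, -, rfl⟩
      exact mem_seg hj
    obtain ⟨j₀, hj₀, hj₀'⟩ := hbelow
    obtain ⟨_, ⟨p, hp, hpN, rfl⟩, hmax⟩ := hfin.exists_maximal ⟨a j₀, j₀, hj₀, hj₀', rfl⟩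
    refine ⟨g, p, 2, hgN, hp.le, rfl, Or.inr ⟨by decide, hg, Or.inr (Or.inl ⟨rfl, hp,
      lt_of_le_of_ne hpN (hdup p hp).symm, habove, fun j hj hjN => ?_⟩)⟩⟩
    rcases le_or_le hjN hpN with h | h
    · exact h
    · exact hmax ⟨j, hj, hjN, rfl⟩ h
  · push Not at hbelow
    exact ⟨g, 0, 3, hgN, Nat.zero_le _, rfl, Or.inr ⟨by decide, hg, Or.inr (Or.inr ⟨rfl,
      fun j hj => ⟨habove j hj, hbelow j hj⟩⟩)⟩⟩

/-- The code reduces comparisons with `a N` to comparisons with `a p`. In kind `1`, `a N ≤ a j`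
means `a p ≤ a j`, and `a j ≤ a N` means `a j < a p`. In kind `2`, `a j ≤ a N` means `a j ≤ a p` and
nothing old is above. In kind `3` nothing old is comparable. -/
theorem Iso.succ_of_hasCode {a : ℕ → M} {a' : ℕ → M'} {N : ℕ} (h : Iso N a a')
    (hc : Closed (seg a (N + 1))) (hc' : Closed (seg a' (N + 1)))
    {ν : Option (List Bool)} {g : Bool → ℕ} {p : ℕ} {t : Fin 4}
    (hcode : HasCode a N ν g p t) (hcode' : HasCode a' N ν g p t) : Iso (N + 1) a a' := by
  obtain ⟨h1, h2⟩ := hcode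
  obtain ⟨h1', h2'⟩ := hcode'
  have hnode : Forest.node (a N) = Forest.node (a' N) := h1.trans h1'.symm
  rcases h2 with ⟨ht, hp, he⟩ | ⟨ht, hg, h2⟩
  · rcases h2' with ⟨-, -, he'⟩ | ⟨ht', -⟩
    · refine h.succ hc hc' hnode ?_ ?_ ?_
      · intro j hj
        rw [he, he', h.le j hj p hp]
      · intro j hj
        rw [he, he', h.le p hp j hj]
      · intro b
        obtain ⟨k, hk, h3⟩ := h.conn p hp b
        rw [he, he']
        exact ⟨k, by omega, h3⟩
    · exact absurd ht ht'
  · rcases h2' with ⟨ht', -⟩ | ⟨-, hg', h2'⟩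
    · exact absurd ht' ht
    have hconn : ∀ b, ∃ k < N + 1, Forest.conn b (a N) = a k ∧ Forest.conn b (a' N) = a' k := by
      intro b
      have hiff := conn_eq_self_iff_of_node_eq (b := b) hnode
      by_cases hb : Forest.conn b (a N) = a N
      · exact ⟨N, by omega, hb, hiff.1 hb⟩
      · refine ⟨g b, ?_, ((hg b).resolve_left hb).2,
          ((hg' b).resolve_left fun h => hb (hiff.2 h)).2⟩
        have := ((hg b).resolve_left hb).1
        omega
    rcases h2 with ⟨ht1, hp, hlt, hleast⟩ | ⟨ht1, hp, hlt, habove, hgr⟩ | ⟨ht1, hfree⟩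
    · obtain ⟨-, -, hlt', hleast'⟩ : t = 1 ∧ p < N ∧ a' N < a' p ∧
          ∀ j < N, a' N ≤ a' j → a' p ≤ a' j := by
        rcases h2' with h | ⟨h, -⟩ | ⟨h, -⟩
        · exact h
        · rw [ht1] at h; exact absurd h (by decide)
        · rw [ht1] at h; exact absurd h (by decide)
      have hge : ∀ j < N, a N ≤ a j ↔ a p ≤ a j := fun j hj => ⟨hleast j hj, hlt.le.trans⟩
      have hge' : ∀ j < N, a' N ≤ a' j ↔ a' p ≤ a' j := fun j hj => ⟨hleast' j hj, hlt'.le.trans⟩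
      have hle : ∀ j < N, a j ≤ a N ↔ a j < a p := by
        refine fun j hj => ⟨fun h => h.trans_lt hlt, fun h => ?_⟩
        rcases le_or_le h.le hlt.le with h3 | h3
        · exact h3
        · exact absurd h (hleast j hj h3).not_gt
      have hle' : ∀ j < N, a' j ≤ a' N ↔ a' j < a' p := by
        refine fun j hj => ⟨fun h => h.trans_lt hlt', fun h => ?_⟩
        rcases le_or_le h.le hlt'.le with h3 | h3
        · exact h3
        · exact absurd h (hleast' j hj h3).not_gt
      refine h.succ hc hc' hnode ?_ ?_ hconn
      · intro j hj
        rw [hle j hj, hle' j hj, h.lt_iff hj hp]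
      · intro j hj
        rw [hge j hj, hge' j hj, h.le p hp j hj]
    · obtain ⟨-, -, hlt', habove', hgr'⟩ : t = 2 ∧ p < N ∧ a' p < a' N ∧
          (∀ j < N, ¬ a' N ≤ a' j) ∧ ∀ j < N, a' j ≤ a' N → a' j ≤ a' p := by
        rcases h2' with ⟨h, -⟩ | h | ⟨h, -⟩
        · rw [ht1] at h; exact absurd h (by decide)
        · exact h
        · rw [ht1] at h; exact absurd h (by decide)
      refine h.succ hc hc' hnode ?_ ?_ hconn
      · intro j hj
        have e1 : a j ≤ a N ↔ a j ≤ a p := ⟨hgr j hj, fun h => h.trans hlt.le⟩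
        have e2 : a' j ≤ a' N ↔ a' j ≤ a' p := ⟨hgr' j hj, fun h => h.trans hlt'.le⟩
        rw [e1, e2, h.le j hj p hp]
      · intro j hj
        exact iff_of_false (habove j hj) (habove' j hj)
    · obtain ⟨-, hfree'⟩ : t = 3 ∧ ∀ j < N, ¬ a' N ≤ a' j ∧ ¬ a' j ≤ a' N := by
        rcases h2' with ⟨h, -⟩ | ⟨h, -⟩ | h
        · rw [ht1] at h; exact absurd h (by decide)
        · rw [ht1] at h; exact absurd h (by decide)
        · exact h
      refine h.succ hc hc' hnode ?_ ?_ hconn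
      · intro j hj
        exact iff_of_false (hfree j hj).2 (hfree' j hj).2
      · intro j hj
        exact iff_of_false (hfree j hj).1 (hfree' j hj).1

/-- Towers with the same codes are isomorphic. -/
theorem iso_of_hasCode {a : ℕ → M} {a' : ℕ → M'} {N : ℕ} (ha : Tower a N) (ha' : Tower a' N)
    {N₀ : ℕ} (h₀ : Iso N₀ a a') (hN₀ : N₀ ≤ N)
    (hcode : ∀ k, N₀ ≤ k → k < N → ∃ ν g p t, HasCode a k ν g p t ∧ HasCode a' k ν g p t) :
    Iso N a a' := by
  have : ∀ k, N₀ ≤ k → k ≤ N → Iso k a a' := by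
    intro k hk
    induction k, hk using Nat.le_induction with
    | base => exact fun _ => h₀
    | succ k hk ih =>
      intro hkN
      obtain ⟨ν, g, p, t, h1, h2⟩ := hcode k hk hkN
      exact (ih (by omega)).succ_of_hasCode (ha _ hkN) (ha' _ hkN) h1 h2
  exact this N hN₀ le_rfl

variable (M' S) in
/-- Every possible position of a new element over a finite set is realized. -/
structure Rich : Prop where
  out : ∀ B : Set M', B.Finite → ∃ x ∉ B, node x = none
  free : ∀ η ∈ S, ∀ y : Bool → M', (∀ b, η ++ [b] ∈ S → node (y b) = some (η ++ [b])) →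
    ∃ x : M', node x = some η ∧ ∀ b, η ++ [b] ∈ S → conn b x = y b
  below : ∀ (η : List Bool) (p : M'), node p = some η → ∀ B : Set M', B.Finite → (∀ z ∈ B, z < p) →
    ∀ y : Bool → M', (∀ b, η ++ [b] ∈ S → node (y b) = some (η ++ [b])) →
    ∃ x < p, (∀ z ∈ B, z < x) ∧ ∀ b, η ++ [b] ∈ S → conn b x = y b
  above : ∀ (η : List Bool) (p : M'), node p = some η → ∀ B : Set M', B.Finite →
    ∀ y : Bool → M', (∀ b, η ++ [b] ∈ S → node (y b) = some (η ++ [b])) →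
    ∃ x > p, (∀ z ∈ B, node z = some η → meet x z ≤ p) ∧ ∀ b, η ++ [b] ∈ S → conn b x = y b

end Isos

/-! ### Back and forth between rich structures -/

section BackAndForth

variable {S : Set (List Bool)} {M' : Type*} [(treeLang S).Structure M']
  [Forest S M'] {M : Type*} [(treeLang S).Structure M] [Forest S M]

theorem Iso.tower {N : ℕ} {a : ℕ → M} {a' : ℕ → M'} (h : Iso N a a') (ha : Tower a N) :
    Tower a' N := by
  intro k hk
  constructor
  · rintro _ ⟨i, hi, rfl⟩ _ ⟨j, hj, rfl⟩
    have hi : i < k := hi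
    have hj : j < k := hj
    obtain ⟨l, hl, hl'⟩ := (ha k hk).1 _ (mem_seg hi) _ (mem_seg hj)
    have hl : l < k := hl
    obtain ⟨m, hm, h1, h2⟩ := h.meet i (by omega) j (by omega)
    rw [h2, (h.eq_iff hm (by omega)).1 (h1.symm.trans hl'.symm)]
    exact mem_seg hl
  · rintro _ ⟨i, hi, rfl⟩ b
    have hi : i < k := hi
    obtain ⟨l, hl, hl'⟩ := (ha k hk).2 _ (mem_seg hi) b
    have hl : l < k := hl
    obtain ⟨m, hm, h1, h2⟩ := h.conn i (by omega) b
    rw [h2, (h.eq_iff hm (by omega)).1 (h1.symm.trans hl'.symm)]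
    exact mem_seg hl

/-- Each kind of code is met by one clause of `Rich`. For kind `1` the new point goes under `a' p`
and above every old element strictly below `a' p`; for kind `2` it goes above `a' p` in a direction
leaving all old elements at `a' p`. In both cases its meets with old elements are meets of `a' p` or
the point itself, so closure is kept. -/
theorem Rich.exists_hasCode (hR : Rich S M') {N : ℕ} {a : ℕ → M} {a' : ℕ → M'} (h : Iso N a a')
    (ha : Closed (seg a (N + 1))) {ν : Option (List Bool)} {g : Bool → ℕ} {p : ℕ} {t : Fin 4}
    (hcode : HasCode a N ν g p t) :
    ∃ x', HasCode (Function.update a' N x') N ν g p t ∧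
      Closed (insert x' (seg a' N)) := by
  have hA' : Closed (seg a' N) := h.closed_right
  suffices H : ∃ x', node x' = ν ∧ ((t = 0 ∧ p < N ∧ x' = a' p) ∨
      (t ≠ 0 ∧ (∀ b, Forest.conn b x' = x' ∨ (g b < N ∧ Forest.conn b x' = a' (g b))) ∧
      ((t = 1 ∧ p < N ∧ x' < a' p ∧ ∀ j < N, x' ≤ a' j → a' p ≤ a' j) ∨
      (t = 2 ∧ p < N ∧ a' p < x' ∧ (∀ j < N, ¬ x' ≤ a' j) ∧ ∀ j < N, a' j ≤ x' → a' j ≤ a' p) ∨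
      (t = 3 ∧ ∀ j < N, ¬ x' ≤ a' j ∧ ¬ a' j ≤ x')))) ∧ Closed (insert x' (seg a' N)) by
    obtain ⟨x', h1, h2, h3⟩ := H
    have hu : ∀ i < N, Function.update a' N x' i = a' i := fun i hi =>
      Function.update_of_ne (by omega) _ _
    have hcode' : HasCode (fun i => if i = N then x' else a' i) N ν g p t := by
      have hi : ∀ i < N, (if i = N then x' else a' i) = a' i := fun i hi => if_neg (by omega)
      refine ⟨by simp [h1], ?_⟩
      simp only [if_true]
      refine h2.imp (fun ⟨e1, e2, e3⟩ => ⟨e1, e2, by rw [hi p e2, e3]⟩) ?_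
      rintro ⟨e1, e2, e3⟩
      refine ⟨e1, fun b => (e2 b).imp id fun ⟨e4, e5⟩ => ⟨e4, by rw [hi _ e4, e5]⟩, ?_⟩
      refine e3.imp ?_ (Or.imp ?_ ?_)
      · rintro ⟨e1, e2, e3, e4⟩
        exact ⟨e1, e2, by rwa [hi p e2], fun j hj => by rw [hi p e2, hi j hj]; exact e4 j hj⟩
      · rintro ⟨e1, e2, e3, e4, e5⟩
        exact ⟨e1, e2, by rwa [hi p e2], fun j hj => by rw [hi j hj]; exact e4 j hj,
          fun j hj => by rw [hi p e2, hi j hj]; exact e5 j hj⟩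
      · rintro ⟨e1, e2⟩
        exact ⟨e1, fun j hj => by rw [hi j hj]; exact e2 j hj⟩
    refine ⟨x', hcode'.congr fun i _ => ?_, h3⟩
    by_cases hi : i = N
    · subst hi; simp
    · simp [hi]
  obtain ⟨hν, hcode⟩ := hcode
  rcases hcode with ⟨ht, hp, he⟩ | ⟨ht, hg, hpos⟩
  · refine ⟨a' p, ?_, Or.inl ⟨ht, hp, rfl⟩, ?_⟩
    · rw [← hν, he, h.node p hp]
    · rwa [Set.insert_eq_of_mem (mem_seg hp)]
  have hfin : (seg a' N).Finite := (Set.finite_Iio N).image _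
  cases ν with
  | none =>
    obtain ⟨x', hx', hx'ν⟩ := hR.out _ hfin
    have ht3 : t = 3 := by
      rcases hpos with ⟨-, hp, hlt, -⟩ | ⟨-, hp, hlt, -⟩ | ⟨h3, -⟩
      · exact absurd (eq_of_le hlt.le hν) hlt.ne
      · exact absurd (eq_of_le hlt.le ((node_eq_of_le hlt.le).trans hν)) hlt.ne
      · exact h3
    have hconn : ∀ b, Forest.conn b x' = x' := fun b => conn_out (by
      intro η hη
      rw [hx'ν] at hη
      cases hη)
    refine ⟨x', hx'ν, Or.inr ⟨ht, fun b => Or.inl (hconn b), Or.inr (Or.inr ⟨ht3, ?_⟩)⟩, ?_⟩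
    · intro j hj
      refine ⟨fun hle => hx' ?_, fun hle => hx' ?_⟩
      · rw [eq_of_le hle hx'ν]
        exact mem_seg hj
      · rw [← eq_of_le hle ((node_eq_of_le hle).trans hx'ν)]
        exact mem_seg hj
    · refine hA'.adjoin ?_ fun b => Or.inr (hconn b)
      intro y _ η hη
      rw [hx'ν] at hη
      cases hη
  | some η =>
    have hηS : η ∈ S := node_mem hν
    have hg' : ∀ b, η ++ [b] ∈ S → g b < N ∧ Forest.conn b (a N) = a (g b) := fun b hb =>
      (hg b).resolve_left (conn_ne hν hb)
    have htarget : ∀ b, η ++ [b] ∈ S → Forest.node (a' (g b)) = some (η ++ [b]) := by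
      intro b hb
      rw [← h.node _ (hg' b hb).1, ← (hg' b hb).2]
      exact node_conn hν hb
    have hconn' : ∀ x', Forest.node x' = some η →
        (∀ b, η ++ [b] ∈ S → Forest.conn b x' = a' (g b)) →
        ∀ b, Forest.conn b x' = x' ∨ (g b < N ∧ Forest.conn b x' = a' (g b)) := by
      intro x' hx' hc b
      by_cases hb : η ++ [b] ∈ S
      · exact Or.inr ⟨(hg' b hb).1, hc b hb⟩
      · refine Or.inl (conn_out fun ν hν => ?_)
        rw [hx'] at hν
        cases hν
        exact hb
    have hclosed : ∀ x', Forest.node x' = some η →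
        (∀ b, η ++ [b] ∈ S → Forest.conn b x' = a' (g b)) →
        (∀ j < N, Forest.node (a' j) = some η → Forest.meet x' (a' j) ∈ seg a' N ∨
          Forest.meet x' (a' j) = x') → Closed (insert x' (seg a' N)) := by
      intro x' hx' hc hm
      refine hA'.adjoin ?_ fun b => ?_
      · rintro _ ⟨j, hj, rfl⟩ ν hν hjν
        rw [hx'] at hν
        cases hν
        exact hm j hj hjν
      · rcases hconn' x' hx' hc b with h | ⟨h1, h2⟩
        · exact Or.inr h
        · rw [h2]
          exact Or.inl (mem_seg h1)
    rcases hpos with ⟨ht1, hp, hlt, hleast⟩ | ⟨ht1, hp, hlt, habove, hgr⟩ | ⟨ht1, hfree⟩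
    · have hpη : Forest.node (a' p) = some η := by
        rw [← h.node p hp, ← node_eq_of_le hlt.le, hν]
      obtain ⟨x', hx'p, hB, hc⟩ := hR.below η (a' p) hpη (seg a' N ∩ {z | z < a' p})
        (hfin.inter_of_left _) (fun z hz => hz.2) (fun b => a' (g b)) htarget
      have hx'η : Forest.node x' = some η := (node_eq_of_le hx'p.le).trans hpη
      have hmeet : ∀ j < N, Forest.node (a' j) = some η → ¬ a' p ≤ a' j →
          Forest.meet (a' p) (a' j) < x' ∧ Forest.meet (a' p) (a' j) ∈ seg a' N := by
        intro j hj hjη hpj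
        have hmem := hA'.1 _ (mem_seg hp) _ (mem_seg hj)
        refine ⟨hB _ ⟨hmem, lt_of_le_of_ne meet_le_left fun he => hpj ?_⟩, hmem⟩
        rw [← he]
        exact meet_le_right hpη hjη
      have hleast' : ∀ j < N, x' ≤ a' j → a' p ≤ a' j := by
        intro j hj hle
        by_contra hpj
        have hjη : Forest.node (a' j) = some η := (node_eq_of_le hle).symm.trans hx'η
        exact absurd (le_meet hx'p.le hle) (hmeet j hj hjη hpj).1.not_ge
      refine ⟨x', hx'η, Or.inr ⟨ht, hconn' x' hx'η hc, Or.inl ⟨ht1, hp, hx'p, hleast'⟩⟩,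
        hclosed x' hx'η hc fun j hj hjη => ?_⟩
      by_cases hpj : a' p ≤ a' j
      · exact Or.inr (meet_eq_left (hx'p.le.trans hpj))
      · left
        obtain ⟨h1, h2⟩ := hmeet j hj hjη hpj
        have : Forest.meet x' (a' j) = Forest.meet (a' p) (a' j) :=
          le_antisymm (le_meet (meet_le_left.trans hx'p.le) (meet_le_right hx'η hjη))
            (le_meet h1.le (meet_le_right hpη hjη))
        rwa [this]
    · have hpη : Forest.node (a' p) = some η := by
        rw [← h.node p hp, node_eq_of_le hlt.le, hν]
      obtain ⟨x', hx'p, hB, hc⟩ := hR.above η (a' p) hpη (seg a' N) hfin (fun b => a' (g b)) htarget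
      have hx'η : Forest.node x' = some η := (node_eq_of_le hx'p.le).symm.trans hpη
      refine ⟨x', hx'η, Or.inr ⟨ht, hconn' x' hx'η hc, Or.inr (Or.inl ⟨ht1, hp, hx'p, ?_, ?_⟩)⟩,
        hclosed x' hx'η hc fun j hj hjη => ?_⟩
      · intro j hj hle
        have := hB _ (mem_seg hj) ((node_eq_of_le hle).symm.trans hx'η)
        rw [meet_eq_left hle] at this
        exact hx'p.not_ge this
      · intro j hj hle
        have := hB _ (mem_seg hj) ((node_eq_of_le hle).trans hx'η)
        rwa [meet_eq_right hle] at this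
      · left
        have : Forest.meet x' (a' j) = Forest.meet (a' p) (a' j) :=
          le_antisymm (le_meet (hB _ (mem_seg hj) hjη) (meet_le_right hx'η hjη))
            (le_meet (meet_le_left.trans hx'p.le) (meet_le_right hpη hjη))
        rw [this]
        exact hA'.1 _ (mem_seg hp) _ (mem_seg hj)
    -- Incomparable to all old elements means that the tree at `η` was still empty: a meet of `a N`
    -- with an old element of that tree would be old and below `a N`, or would be `a N` itself.
    · have hnone : ∀ j < N, Forest.node (a' j) ≠ some η := by
        intro j hj hjη
        rw [← h.node j hj] at hjη
        obtain ⟨l, hl, hl'⟩ := ha.1 _ (mem_seg (Nat.lt_succ_self N)) _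
          (mem_seg (show j < N + 1 by omega))
        rcases Nat.lt_succ_iff_lt_or_eq.1 (show l < N + 1 from hl) with hl | rfl
        · exact (hfree l hl).2 (hl' ▸ meet_le_left)
        · exact (hfree j hj).1 (hl'.le.trans (meet_le_right hν hjη))
      obtain ⟨x', hx'η, hc⟩ := hR.free η hηS (fun b => a' (g b)) htarget
      refine ⟨x', hx'η, Or.inr ⟨ht, hconn' x' hx'η hc, Or.inr (Or.inr ⟨ht1, fun j hj =>
        ⟨fun hle => hnone j hj ?_, fun hle => hnone j hj ?_⟩⟩)⟩,
        hclosed x' hx'η hc fun j hj hjη => absurd hjη (hnone j hj)⟩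
      · rw [← node_eq_of_le hle, hx'η]
      · rw [node_eq_of_le hle, hx'η]

theorem Rich.exists_iso_succ (hR : Rich S M') {N : ℕ} {a : ℕ → M} {a' : ℕ → M'} (h : Iso N a a')
    (ha : Closed (seg a (N + 1))) : ∃ x', Iso (N + 1) a (Function.update a' N x') := by
  obtain ⟨g, p, t, -, -, hcode⟩ := TreeOfTrees.exists_hasCode h.closed_left ha
  obtain ⟨x', h1, h2⟩ := hR.exists_hasCode h ha hcode
  have hu : ∀ i < N, Function.update a' N x' i = a' i := fun i hi =>
    Function.update_of_ne (by omega) _ _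
  refine ⟨x', (h.congr (fun _ _ => rfl) hu).succ_of_hasCode ha ?_ hcode h1⟩
  rwa [seg_succ, Function.update_self, seg_congr hu]

theorem Rich.exists_iso (hR : Rich S M') {N : ℕ} {a : ℕ → M} {a' : ℕ → M'} (h : Iso N a a')
    {a₁ : ℕ → M} (ha : ∀ i < N, a₁ i = a i) {N₁ : ℕ} (hN : N ≤ N₁) (hT : Tower a₁ N₁) :
    ∃ a₁', (∀ i < N, a₁' i = a' i) ∧ Iso N₁ a₁ a₁' := by
  induction N₁, hN using Nat.le_induction with
  | base => exact ⟨a', fun _ _ => rfl, h.congr ha fun _ _ => rfl⟩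
  | succ k hk ih =>
    obtain ⟨b, h1, h2⟩ := ih (fun j hj => hT j (by omega))
    obtain ⟨x', hx'⟩ := hR.exists_iso_succ h2 (hT _ le_rfl)
    exact ⟨_, fun i hi => (Function.update_of_ne (by omega) _ _).trans (h1 i hi), hx'⟩

/-- A quantified element is first caught in a longer tower; richness of the other side then extends
the isomorphism along that tower. -/
theorem Rich.realize_iff {n : ℕ} (hS : S ⊆ nodes n) (hR : Rich S M) (hR' : Rich S M') {α : Type*}
    {m : ℕ} (φ : (treeLang S).BoundedFormula α m) :
    ∀ {N : ℕ} {a : ℕ → M} {a' : ℕ → M'}, Tower a N → Iso N a a' →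
    ∀ (v : α → ℕ) (xs : Fin m → ℕ), (∀ i, v i < N) → (∀ i, xs i < N) →
    (φ.Realize (fun i => a (v i)) (fun i => a (xs i)) ↔
      φ.Realize (fun i => a' (v i)) (fun i => a' (xs i))) := by
  induction φ with
  | falsum => exact fun _ _ _ _ _ _ => Iff.rfl
  | equal t₁ t₂ =>
    exact fun _ h v xs hv hxs => h.realize_isAtomic (.equal t₁ t₂) v xs hv hxs
  | rel R ts =>
    exact fun _ h v xs hv hxs => h.realize_isAtomic (.rel R ts) v xs hv hxs
  | imp φ ψ ih₁ ih₂ =>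
    intro N a a' ha h v xs hv hxs
    rw [BoundedFormula.realize_imp, BoundedFormula.realize_imp, ih₁ ha h v xs hv hxs,
      ih₂ ha h v xs hv hxs]
  | all φ ih =>
    intro N a a' ha h v xs hv hxs
    rw [BoundedFormula.realize_all, BoundedFormula.realize_all]
    have key : ∀ {N₁ j : ℕ} {a₁ : ℕ → M} {a₁' : ℕ → M'}, N ≤ N₁ → Tower a₁ N₁ → Iso N₁ a₁ a₁' →
        (∀ i < N, a₁ i = a i) → (∀ i < N, a₁' i = a' i) → j < N₁ →
        (φ.Realize (fun i => a (v i)) (Fin.snoc (fun i => a (xs i)) (a₁ j)) ↔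
          φ.Realize (fun i => a' (v i)) (Fin.snoc (fun i => a' (xs i)) (a₁' j))) := by
      intro N₁ j a₁ a₁' hN hT h₁ e₁ e₂ hj
      have := ih hT h₁ v (Fin.snoc xs j) (fun i => (hv i).trans_le hN) (by
        intro i
        refine Fin.lastCases ?_ (fun i => ?_) i
        · simpa using hj
        · simpa using (hxs i).trans_le hN)
      have c1 : (fun i => a (v i)) = fun i => a₁ (v i) := funext fun i => (e₁ _ (hv i)).symm
      have c2 : (fun i => a' (v i)) = fun i => a₁' (v i) := funext fun i => (e₂ _ (hv i)).symm
      have c3 : (Fin.snoc (fun i => a (xs i)) (a₁ j) : Fin _ → M) =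
          fun i => a₁ ((Fin.snoc xs j : Fin _ → ℕ) i) := by
        funext i
        refine Fin.lastCases ?_ (fun i => ?_) i
        · simp
        · simpa using (e₁ _ (hxs i)).symm
      have c4 : (Fin.snoc (fun i => a' (xs i)) (a₁' j) : Fin _ → M') =
          fun i => a₁' ((Fin.snoc xs j : Fin _ → ℕ) i) := by
        funext i
        refine Fin.lastCases ?_ (fun i => ?_) i
        · simp
        · simpa using (e₂ _ (hxs i)).symm
      rw [c1, c2, c3, c4]
      exact this
    constructor
    · intro H x'
      obtain ⟨D, hD⟩ := exists_tower_extension n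
      obtain ⟨a₁', e₁, hT, -, j, hj, rfl⟩ := hD S hS M' Set.univ ⟨fun _ _ _ _ => trivial,
        fun _ _ _ => trivial⟩ a' N (h.tower ha) (Set.subset_univ _) x' trivial
      obtain ⟨a₁, e₂, h₁⟩ := hR.exists_iso h.symm e₁ (Nat.le_add_right N D) hT
      exact (key (Nat.le_add_right N D) (h₁.tower hT) h₁.symm e₂ e₁ hj).1 (H _)
    · intro H x
      obtain ⟨D, hD⟩ := exists_tower_extension n
      obtain ⟨a₁, e₁, hT, -, j, hj, rfl⟩ := hD S hS M Set.univ ⟨fun _ _ _ _ => trivial,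
        fun _ _ _ => trivial⟩ a N ha (Set.subset_univ _) x trivial
      obtain ⟨a₁', e₂, h₁⟩ := hR'.exists_iso h e₁ (Nat.le_add_right N D) hT
      exact (key (Nat.le_add_right N D) hT h₁ e₁ e₂ hj).2 (H _)

end BackAndForth

/-! ### Quantifier-free definability from finitely many types -/

section FiniteClasses

variable {L : Language} {M : Type*} [L.Structure M] {α : Type*}

theorem exists_isQF_exists {ι : Type*} (T : Finset ι) (P : ι → (α → M) → Prop)
    (h : ∀ i ∈ T, ∃ ψ : L.Formula α, ψ.IsQF ∧ ∀ v : α → M, ψ.Realize v ↔ P i v) :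
    ∃ ψ : L.Formula α, ψ.IsQF ∧ ∀ v : α → M, ψ.Realize v ↔ ∃ i ∈ T, P i v := by
  classical
  induction T using Finset.induction_on with
  | empty => exact ⟨⊥, BoundedFormula.isQF_bot, fun v => by simp⟩
  | insert i T hi ih =>
    obtain ⟨ψ₁, h1, h2⟩ := h i (Finset.mem_insert_self _ _)
    obtain ⟨ψ₂, h3, h4⟩ := ih fun j hj => h j (Finset.mem_insert_of_mem hj)
    exact ⟨ψ₁ ⊔ ψ₂, h1.sup h3, fun v => by
      rw [Formula.realize_sup, h2, h4, Finset.exists_mem_insert]⟩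

theorem exists_isQF_forall {ι : Type*} (T : Finset ι) (P : ι → (α → M) → Prop)
    (h : ∀ i ∈ T, ∃ ψ : L.Formula α, ψ.IsQF ∧ ∀ v : α → M, ψ.Realize v ↔ P i v) :
    ∃ ψ : L.Formula α, ψ.IsQF ∧ ∀ v : α → M, ψ.Realize v ↔ ∀ i ∈ T, P i v := by
  obtain ⟨ψ, h1, h2⟩ := exists_isQF_exists T (fun i v => ¬ P i v) fun i hi => by
    obtain ⟨ψ, h1, h2⟩ := h i hi
    exact ⟨ψ.not, h1.not, fun v => by rw [Formula.realize_not, h2]⟩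
  exact ⟨ψ.not, h1.not, fun v => by rw [Formula.realize_not, h2]; push Not; rfl⟩

/-- If there are finitely many quantifier-free types in `M`, then each property of tuples which
depends on the quantifier-free type only is quantifier-free definable. -/
theorem exists_isQF_of_finite {T : Type*} [Finite T] (cls : (α → M) → T) (P : (α → M) → Prop)
    (hcls : ∀ v w, cls v = cls w → ∀ ψ : L.Formula α, ψ.IsQF → (ψ.Realize v ↔ ψ.Realize w))
    (hP : ∀ v w, (∀ ψ : L.Formula α, ψ.IsQF → (ψ.Realize v ↔ ψ.Realize w)) → P v → P w) :
    ∃ ψ : L.Formula α, ψ.IsQF ∧ ∀ v : α → M, ψ.Realize v ↔ P v := by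
  classical
  have := Fintype.ofFinite T
  -- A class fixes the quantifier-free type, so a formula separating one pair of tuples separates
  -- their whole classes. The wanted formula is the disjunction over classes meeting `P` of
  -- conjunctions over classes meeting its complement.
  have hθ : ∀ τ σ : T, ∃ θ : L.Formula α, θ.IsQF ∧ ∀ v w, cls v = τ → cls w = σ → P v → ¬ P w →
      θ.Realize v ∧ ¬ θ.Realize w := by
    intro τ σ
    by_cases hex : ∃ v w, cls v = τ ∧ cls w = σ ∧ P v ∧ ¬ P w
    · obtain ⟨v, w, hv, hw, hPv, hPw⟩ := hex
      by_contra hno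
      refine hPw (hP v w (fun ψ hψ => ?_) hPv)
      by_contra hne
      apply hno
      have hsep : ∀ θ : L.Formula α, θ.IsQF → θ.Realize v → ¬ θ.Realize w →
          ∀ v' w', cls v' = τ → cls w' = σ → P v' → ¬ P w' → θ.Realize v' ∧ ¬ θ.Realize w' :=
        fun θ hθ h1 h2 v' w' hv' hw' _ _ =>
          ⟨(hcls v v' (hv.trans hv'.symm) θ hθ).1 h1, fun h => h2
            ((hcls w w' (hw.trans hw'.symm) θ hθ).2 h)⟩
      by_cases h : ψ.Realize v
      · exact ⟨ψ, hψ, hsep ψ hψ h fun h' => hne (iff_of_true h h')⟩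
      · refine ⟨ψ.not, hψ.not, hsep _ hψ.not (by rwa [Formula.realize_not]) ?_⟩
        rw [Formula.realize_not, not_not]
        by_contra h'
        exact hne (iff_of_false h h')
    · exact ⟨⊥, BoundedFormula.isQF_bot, fun v w h1 h2 h3 h4 => absurd ⟨v, w, h1, h2, h3, h4⟩ hex⟩
  choose θ hqf hθ using hθ
  obtain ⟨ψ, h1, h2⟩ := exists_isQF_exists (L := L) (M := M)
    (Finset.univ.filter fun τ : T => ∃ v, cls v = τ ∧ P v)
    (fun τ v => ∀ σ ∈ (Finset.univ.filter fun σ : T => ∃ w, cls w = σ ∧ ¬ P w), (θ τ σ).Realize v)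
    (fun τ _ => exists_isQF_forall _ _ fun σ _ => ⟨θ τ σ, hqf τ σ, fun _ => Iff.rfl⟩)
  refine ⟨ψ, h1, fun v => ?_⟩
  rw [h2]
  simp only [Finset.mem_filter, Finset.mem_univ, true_and]
  constructor
  · rintro ⟨τ, ⟨u, hu, hPu⟩, hτ⟩
    by_contra hPv
    exact (hθ τ (cls v) u v hu rfl hPu hPv).2 (hτ _ ⟨v, rfl, hPv⟩)
  · intro hPv
    refine ⟨cls v, ⟨v, rfl, hPv⟩, ?_⟩
    rintro σ ⟨w, hw, hPw⟩
    exact (hθ _ σ v w rfl hw hPv hPw).1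

end FiniteClasses

instance (n : ℕ) : Finite (nodes n) :=
  (List.finite_length_le Bool n).to_subtype

/-- The possible codes of elements of a tower of length at most `N`. -/
abbrev Code (n N : ℕ) : Type :=
  Option (nodes n) × (Bool → Fin (N + 1)) × Fin (N + 1) × Fin 4

/-! ### Quantifier elimination and counting of types -/

section Definability

variable {S : Set (List Bool)} {M' : Type*} [(treeLang S).Structure M']
  [Forest S M'] {M : Type*} [(treeLang S).Structure M] [Forest S M]

/-- `a k` has the code `c` over the previous elements. -/
def Coded {n N : ℕ} (a : ℕ → M) (k : ℕ) (c : Code n N) : Prop :=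
  HasCode a k (c.1.map Subtype.val) (fun b => c.2.1 b) c.2.2.1 c.2.2.2

theorem exists_coded {n : ℕ} (hS : S ⊆ nodes n) {N : ℕ} {a : ℕ → M} (ha : Tower a N) {k : ℕ}
    (hk : k < N) : ∃ c : Code n N, Coded a k c := by
  obtain ⟨g, p, t, hg, hp, h⟩ := exists_hasCode (ha k hk.le) (ha (k + 1) hk)
  have : ∃ ν : Option (nodes n), ν.map Subtype.val = node (a k) := by
    cases hν : node (a k) with
    | none => exact ⟨none, rfl⟩
    | some η => exact ⟨some ⟨η, hS (node_mem hν)⟩, rfl⟩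
  obtain ⟨ν, hν⟩ := this
  refine ⟨(ν, fun b => ⟨g b, by have := hg b; omega⟩, ⟨p, by omega⟩, t), ?_⟩
  simp only [Coded, hν]
  exact h

theorem iso_of_coded {n N K : ℕ} {a : ℕ → M} {a' : ℕ → M'} (ha : Tower a N) (ha' : Tower a' N)
    {N₀ : ℕ} (h₀ : Iso N₀ a a') (hN₀ : N₀ ≤ N)
    (hcode : ∀ k, N₀ ≤ k → k < N → ∃ c : Code n K, Coded a k c ∧ Coded a' k c) : Iso N a a' := by
  refine iso_of_hasCode ha ha' h₀ hN₀ fun k h1 h2 => ?_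
  obtain ⟨c, h3, h4⟩ := hcode k h1 h2
  exact ⟨_, _, _, _, h3, h4⟩

theorem closed_univ : Closed (Set.univ : Set M) :=
  ⟨fun _ _ _ _ => trivial, fun _ _ _ => trivial⟩

theorem closed_range_realize {k : ℕ} (v : Fin k → M) :
    Closed (Set.range fun t : (treeLang S).Term (Fin k) => t.realize v) := by
  constructor
  · rintro _ ⟨t, rfl⟩ _ ⟨s, rfl⟩
    by_cases h : ∃ η, node (t.realize v) = some η ∧ node (s.realize v) = some η
    · obtain ⟨η, h1, h2⟩ := h
      refine ⟨Functions.apply₂ (L := treeLang S) (TreeFunc.meet η (node_mem h1)) t s, ?_⟩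
      rw [← sMeet_eq (node_mem h1) h1 h2]
      exact Term.realize_functions_apply₂
    · exact ⟨t, (meet_out fun η h1 h2 => h ⟨η, h1, h2⟩).symm⟩
  · rintro _ ⟨t, rfl⟩ b
    by_cases h : ∃ η, node (t.realize v) = some η ∧ η ++ [b] ∈ S
    · obtain ⟨η, h1, h2⟩ := h
      refine ⟨Functions.apply₁ (L := treeLang S) (TreeFunc.conn η b (node_mem h1) h2) t, ?_⟩
      rw [← sConn_eq (node_mem h1) h2 h1]
      exact Term.realize_functions_apply₁
    · exact ⟨t, (conn_out fun η h1 h2 => h ⟨η, h1, h2⟩).symm⟩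

/-- Tuples with the same quantifier-free type generate isomorphic substructures. -/
theorem exists_iso_of_qf [Nonempty M] [Nonempty M'] {n : ℕ} (hS : S ⊆ nodes n) {k : ℕ}
    (v : Fin k → M) (v' : Fin k → M')
    (h : ∀ ψ : (treeLang S).Formula (Fin k), ψ.IsQF → (ψ.Realize v ↔ ψ.Realize v')) :
    ∃ (N : ℕ) (a : ℕ → M) (a' : ℕ → M') (p : Fin k → ℕ), Tower a N ∧ Iso N a a' ∧
      (∀ i, p i < N) ∧ (∀ i, a (p i) = v i) ∧ ∀ i, a' (p i) = v' i := by
  classical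
  obtain ⟨D, hD⟩ := exists_tower_extension_list n
  obtain ⟨a, -, hT, hC, hv⟩ := hD S hS M _ (closed_range_realize v)
    (fun _ => Classical.arbitrary M) 0 (tower_zero _) (by simp [seg]) k v
    (fun i => ⟨Term.var i, rfl⟩)
  set N := 0 + k * D
  choose p hp hpv using hv
  -- The tower stays in the substructure generated by `v`, so `a i` is the value of a term at `v`;
  -- `a' i` is the value of that term at `v'`.
  have hterm : ∀ i, ∃ x' : M', i < N → ∃ t : (treeLang S).Term (Fin k), t.realize v = a i ∧
      t.realize v' = x' := by
    intro i
    by_cases hi : i < N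
    · obtain ⟨t, ht⟩ := hC (mem_seg hi)
      exact ⟨t.realize v', fun _ => ⟨t, ht, rfl⟩⟩
    · exact ⟨Classical.arbitrary M', fun h => absurd h hi⟩
  choose a' ha' using hterm
  have hequal : ∀ t s : (treeLang S).Term (Fin k),
      t.realize v = s.realize v ↔ t.realize v' = s.realize v' := by
    intro t s
    have := h (t.equal s) (BoundedFormula.IsAtomic.equal _ _).isQF
    rwa [Formula.realize_equal, Formula.realize_equal] at this
  have hnode' : ∀ (t : (treeLang S).Term (Fin k)) η,
      node (t.realize v) = some η ↔ node (t.realize v') = some η := by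
    intro t η
    by_cases hη : η ∈ S
    · have := h (Relations.formula₁ (L := treeLang S) (TreeRel.pred η hη) t)
        (BoundedFormula.IsAtomic.rel _ _).isQF
      rwa [realize_formula₁_pred, realize_formula₁_pred, sP_iff, sP_iff] at this
    · exact iff_of_false (fun h => hη (node_mem h)) fun h => hη (node_mem h)
  have hnode : ∀ t : (treeLang S).Term (Fin k), node (t.realize v) = node (t.realize v') :=
    fun t => Option.ext (hnode' t)
  have hlt : ∀ t s : (treeLang S).Term (Fin k),
      t.realize v < s.realize v ↔ t.realize v' < s.realize v' := by
    intro t s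
    cases hη : node (t.realize v) with
    | none =>
      exact iff_of_false (fun h => h.ne (eq_of_le h.le hη))
        (fun h => h.ne (eq_of_le h.le ((hnode t).symm.trans hη)))
    | some η =>
      have := h (Relations.formula₂ (L := treeLang S) (TreeRel.lt η (node_mem hη)) t s)
        (BoundedFormula.IsAtomic.rel _ _).isQF
      rwa [realize_formula₂_lt, realize_formula₂_lt, sLt_iff, sLt_iff, and_iff_left hη,
        and_iff_left ((hnode t).symm.trans hη)] at this
  refine ⟨N, a, a', p, hT, ⟨?_, ?_, ?_, ?_⟩, hp, hpv, ?_⟩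
  · intro i hi
    obtain ⟨t, ht, ht'⟩ := ha' i hi
    rw [← ht, ← ht', hnode]
  · intro i hi j hj
    obtain ⟨t, ht, ht'⟩ := ha' i hi
    obtain ⟨s, hs, hs'⟩ := ha' j hj
    rw [← ht, ← ht', ← hs, ← hs', le_iff_lt_or_eq, le_iff_lt_or_eq, hlt, hequal]
  · intro i hi j hj
    by_cases hη : ∃ η, node (a i) = some η ∧ node (a j) = some η
    · obtain ⟨η, h1, h2⟩ := hη
      have hηS : η ∈ S := node_mem h1
      obtain ⟨l, hl, hl'⟩ := (hT N le_rfl).1 _ (mem_seg hi) _ (mem_seg hj)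
      obtain ⟨t, ht, ht'⟩ := ha' i hi
      obtain ⟨s, hs, hs'⟩ := ha' j hj
      obtain ⟨r, hr, hr'⟩ := ha' l hl
      refine ⟨l, hl, hl'.symm, ?_⟩
      have := (hequal (Functions.apply₂ (L := treeLang S) (TreeFunc.meet η hηS) t s)
        r).1 (by
          rw [hr, hl', ← sMeet_eq hηS h1 h2, ← ht, ← hs]
          exact Term.realize_functions_apply₂)
      rw [← hr', ← this, ← sMeet_eq hηS (by rw [← ht', ← hnode, ht, h1])
        (by rw [← hs', ← hnode, hs, h2]), ← ht', ← hs']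
      exact Term.realize_functions_apply₂.symm
    · obtain ⟨t, ht, ht'⟩ := ha' i hi
      obtain ⟨s, hs, hs'⟩ := ha' j hj
      refine ⟨i, hi, meet_out fun η h1 h2 => hη ⟨η, h1, h2⟩, meet_out fun η h1 h2 => hη ⟨η, ?_, ?_⟩⟩
      · rw [← ht, hnode, ht', h1]
      · rw [← hs, hnode, hs', h2]
  · intro i hi b
    obtain ⟨t, ht, ht'⟩ := ha' i hi
    by_cases hη : ∃ η, node (a i) = some η ∧ η ++ [b] ∈ S
    · obtain ⟨η, h1, h2⟩ := hη
      have hηS : η ∈ S := node_mem h1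
      obtain ⟨l, hl, hl'⟩ := (hT N le_rfl).2 _ (mem_seg hi) b
      obtain ⟨r, hr, hr'⟩ := ha' l hl
      refine ⟨l, hl, hl'.symm, ?_⟩
      have := (hequal (Functions.apply₁ (L := treeLang S) (TreeFunc.conn η b hηS h2) t)
        r).1 (by
          rw [hr, hl', ← sConn_eq hηS h2 h1, ← ht]
          exact Term.realize_functions_apply₁)
      rw [← hr', ← this, ← sConn_eq hηS h2 (by rw [← ht', ← hnode, ht, h1]), ← ht']
      exact Term.realize_functions_apply₁.symm
    · refine ⟨i, hi, conn_out fun η h1 h2 => hη ⟨η, h1, h2⟩, conn_out fun η h1 h2 => hη ⟨η, ?_, h2⟩⟩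
      rw [← ht, hnode, ht', h1]
  · intro i
    obtain ⟨t, ht, ht'⟩ := ha' (p i) (hp i)
    rw [← ht']
    refine ((hequal (Term.var i) t).1 ?_).symm
    rw [ht, hpv]
    rfl

/-- A tuple is classified by its positions in a tower of fixed length and by the codes of that
tower: finitely many classes, each fixing the quantifier-free type. Conversely, equal
quantifier-free types give isomorphic towers, which agree on `φ` by `Rich.realize_iff`. -/
theorem Rich.exists_isQF [Nonempty M] {n : ℕ} (hS : S ⊆ nodes n) (hR : Rich S M) {k : ℕ}
    (φ : (treeLang S).Formula (Fin k)) :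
    ∃ ψ : (treeLang S).Formula (Fin k), ψ.IsQF ∧ ∀ v : Fin k → M, ψ.Realize v ↔ φ.Realize v := by
  obtain ⟨D, hD⟩ := exists_tower_extension_list n
  set N := 0 + k * D with hN
  have htower : ∀ v : Fin k → M, ∃ (a : ℕ → M) (p : Fin k → Fin N) (c : Fin N → Code n N),
      Tower a N ∧ (∀ i, a (p i) = v i) ∧ ∀ j : Fin N, Coded a j (c j) := by
    intro v
    obtain ⟨a, -, hT, -, hv⟩ := hD S hS M _ closed_univ
      (fun _ => Classical.arbitrary M) 0 (tower_zero _) (Set.subset_univ _) k v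
      (fun i => trivial)
    choose p hp hpv using hv
    choose c hc using fun j : Fin N => exists_coded hS hT j.2
    exact ⟨a, fun i => ⟨p i, hp i⟩, c, hT, hpv, hc⟩
  choose a p c hT hp hc using htower
  have hdefault : ∀ v : Fin k → M, (fun i => a v (p v i)) = v := fun v => funext (hp v)
  refine exists_isQF_of_finite (fun v => (p v, c v)) _ ?_ ?_
  · intro v w hvw ψ hψ
    obtain ⟨h1, h2⟩ := Prod.mk.inj hvw
    have hiso : Iso N (a v) (a w) := iso_of_coded (n := n) (K := N) (hT v) (hT w) (Iso.zero _ _)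
      (Nat.zero_le _) fun j _ hj => ⟨c v ⟨j, hj⟩, hc v ⟨j, hj⟩, h2 ▸ hc w ⟨j, hj⟩⟩
    have := hiso.realize_isQF hψ (fun i => p v i) Fin.elim0 (fun i => (p v i).2) fun i => i.elim0
    rw [hdefault v, h1, hdefault w] at this
    rwa [Subsingleton.elim (fun i => a v (Fin.elim0 i)) default,
      Subsingleton.elim (fun i => a w (Fin.elim0 i)) default] at this
  · intro v w hvw
    obtain ⟨N, a, a', p, hT, hiso, hpN, hpv, hpw⟩ := exists_iso_of_qf hS v w hvw
    have := hR.realize_iff hS hR φ hT hiso p Fin.elim0 hpN fun i => i.elim0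
    rw [funext hpv, funext hpw] at this
    rw [Subsingleton.elim (fun i => a (Fin.elim0 i)) default,
      Subsingleton.elim (fun i => a' (Fin.elim0 i)) default] at this
    exact this.1

theorem iso_refl {N : ℕ} {a : ℕ → M} (ha : Closed (seg a N)) : Iso N a a where
  node _ _ := rfl
  le _ _ _ _ := Iff.rfl
  meet i hi j hj := by
    obtain ⟨k, hk, h⟩ := ha.1 _ (mem_seg hi) _ (mem_seg hj)
    exact ⟨k, hk, h.symm, h.symm⟩
  conn i hi b := by
    obtain ⟨k, hk, h⟩ := ha.2 _ (mem_seg hi) b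
    exact ⟨k, hk, h.symm, h.symm⟩

theorem exists_mul_pow_lt_two_pow (C p : ℕ) : ∃ R : ℕ, C * (R + 1) ^ p < 2 ^ R := by
  have h := (tendsto_pow_const_div_const_pow_of_one_lt p (r := (2 : ℝ)) (by norm_num)).comp
    (Filter.tendsto_add_atTop_nat 1)
  -- The factor `2` pays for the shift from `2 ^ (R + 1)` to `2 ^ R`; the `1` keeps the denominator
  -- positive when `C = 0`.
  have hC : (0 : ℝ) < 1 / (2 * C + 1) := by positivity
  obtain ⟨R, hR⟩ := (h.eventually (gt_mem_nhds hC)).exists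
  refine ⟨R, ?_⟩
  simp only [Function.comp_apply] at hR
  rw [div_lt_div_iff₀ (by positivity) (by positivity), one_mul] at hR
  have h2 : ((R + 1 : ℕ) : ℝ) ^ p * (2 * C + 1) < 2 * 2 ^ R := by
    rw [← pow_succ']
    exact hR
  have h3 : (R + 1) ^ p * (2 * C + 1) < 2 * 2 ^ R := by exact_mod_cast h2
  have : 0 ≤ (R + 1) ^ p := Nat.zero_le _
  nlinarith

/-- Quantifier-free formulas do not have the independence property. -/
theorem not_hasIndependenceProperty_of_isQF [Nonempty M] {n : ℕ} (hS : S ⊆ nodes n) {k m : ℕ}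
    {ψ : (treeLang S).Formula (Fin k ⊕ Fin m)} (hψ : ψ.IsQF) :
    ¬ HasIndependenceProperty ψ M := by
  classical
  rintro ⟨a, b, hab⟩
  obtain ⟨D, hD⟩ := exists_tower_extension_list n
  have := Fintype.ofFinite (nodes n)
  set c := Fintype.card (Option (nodes n)) with hc
  -- The exponent is the degree in `R` of the number of descriptions of `b s`: each of `m * D` codes
  -- has three indices in `Fin (N + 1)`, and `m` positions in `Fin N` are added. Here `N + 1` is at
  -- most `(k * D + m * D + 1) * (R + 1)`.
  obtain ⟨R, hR⟩ := exists_mul_pow_lt_two_pow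
    (((c * 4) * (k * D + m * D + 1) ^ 3) ^ (m * D) * (k * D + m * D + 1) ^ m) (3 * (m * D) + m)
  set N₀ := 0 + (R * k) * D with hN₀
  set N := N₀ + m * D with hN
  obtain ⟨A, -, hT₀, -, hA⟩ := hD S hS M _ closed_univ (fun _ => Classical.arbitrary M) 0
    (tower_zero _) (Set.subset_univ _) (R * k)
    (fun i => a (finProdFinEquiv.symm i).1 (finProdFinEquiv.symm i).2) (fun _ => trivial)
  choose q hq hqA using hA
  have htower : ∀ s : Finset (Fin R), ∃ (A' : ℕ → M) (p : Fin m → Fin N)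
      (d : Fin (m * D) → Code n N), (∀ i < N₀, A' i = A i) ∧ Tower A' N ∧
      (∀ i, A' (p i) = b {j | ∃ l ∈ s, (l : ℕ) = j} i) ∧
      ∀ j : Fin (m * D), Coded A' (N₀ + j) (d j) := by
    intro s
    obtain ⟨A', h1, hT, -, h2⟩ := hD S hS M _ closed_univ A N₀ hT₀ (Set.subset_univ _) m
      (b {j | ∃ l ∈ s, (l : ℕ) = j}) (fun _ => trivial)
    choose p hp hpA using h2
    choose d hd using fun j : Fin (m * D) => exists_coded hS hT (k := N₀ + j) (by omega)
    exact ⟨A', fun i => ⟨p i, hp i⟩, d, h1, hT, hpA, hd⟩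
  choose A' p d h1 hT hp hd using htower
  -- Equal positions and codes give an isomorphism over `A`, so `b s` and `b s'` satisfy `ψ` with
  -- the same `a i`, and `s = s'`.
  have hinj : Function.Injective fun s => (p s, d s) := by
    intro s s' hss
    obtain ⟨e1, e2⟩ := Prod.mk.inj hss
    have hiso : Iso N (A' s) (A' s') := by
      refine iso_of_coded (n := n) (K := N) (hT s) (hT s')
        ((iso_refl (hT₀ N₀ le_rfl)).congr (h1 s) (h1 s')) (Nat.le_add_right _ _) fun j hj hjN => ?_
      obtain ⟨l, rfl⟩ := Nat.exists_eq_add_of_le hj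
      exact ⟨d s ⟨l, by omega⟩, hd s ⟨l, by omega⟩, e2 ▸ hd s' ⟨l, by omega⟩⟩
    have hqN : ∀ i, q i < N := fun i => lt_of_lt_of_le (hq i) (Nat.le_add_right _ _)
    have hval : ∀ (t : Finset (Fin R)) (i : Fin R), (fun j => A' t (Sum.elim
        (fun l => q (finProdFinEquiv (i, l))) (fun l => (p t l : ℕ)) j)) =
        Sum.elim (a i) (b {j | ∃ l ∈ t, (l : ℕ) = j}) := by
      intro t i
      funext j
      rcases j with j | j
      · simp only [Sum.elim_inl]
        rw [h1 t _ (hq _), hqA]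
        simp
      · simp only [Sum.elim_inr]
        exact hp t j
    have hmem : ∀ (t : Finset (Fin R)) (i : Fin R), i ∈ t ↔
        ψ.Realize (Sum.elim (a i) (b {j | ∃ l ∈ t, (l : ℕ) = j})) := by
      intro t i
      rw [hab]
      constructor
      · exact fun hi => ⟨i, hi, rfl⟩
      · rintro ⟨l, hl, hli⟩
        rwa [← Fin.ext hli]
    ext i
    rw [hmem, hmem, ← hval s, ← hval s', ← e1]
    have := hiso.realize_isQF hψ (Sum.elim (fun l => q (finProdFinEquiv (i, l)))
      (fun l => (p s l : ℕ))) Fin.elim0 (by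
        rintro (j | j)
        · exact hqN _
        · exact (p s j).2) fun i => i.elim0
    rwa [Subsingleton.elim (fun i => A' s (Fin.elim0 i)) default,
      Subsingleton.elim (fun i => A' s' (Fin.elim0 i)) default] at this
  have hcard := Fintype.card_le_of_injective _ hinj
  simp only [Fintype.card_finset, Fintype.card_fin, Fintype.card_prod, Fintype.card_fun,
    Fintype.card_bool, ← hc] at hcard
  refine absurd (hR.trans_le hcard) (not_lt.2 ?_)
  have hNR : N + 1 ≤ (k * D + m * D + 1) * (R + 1) := by
    rw [hN, hN₀]
    have : R * k * D = k * D * R := by ring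
    nlinarith [Nat.zero_le (m * D * R), Nat.zero_le (k * D)]
  calc N ^ m * (c * ((N + 1) ^ 2 * ((N + 1) * 4))) ^ (m * D)
      ≤ ((k * D + m * D + 1) * (R + 1)) ^ m *
        (c * (((k * D + m * D + 1) * (R + 1)) ^ 2 * (((k * D + m * D + 1) * (R + 1)) * 4))) ^
          (m * D) := by
        gcongr
        omega
    _ = _ := by
        generalize k * D + m * D + 1 = W
        generalize R + 1 = Z
        generalize m * D = e
        rw [show c * ((W * Z) ^ 2 * (W * Z * 4)) = c * 4 * W ^ 3 * Z ^ 3 by ring, mul_pow W Z,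
          mul_pow (c * 4 * W ^ 3), pow_add, pow_mul]
        ring

end Definability

/-- A family of trees with meets, indexed by the nodes, with arbitrary connecting maps. -/
structure TreeSystem where
  X : List Bool → Type w
  [inf : ∀ η, SemilatticeInf (X η)]
  le_or_le : ∀ {η} {x y z : X η}, x ≤ z → y ≤ z → x ≤ y ∨ y ≤ x
  g : ∀ (η : List Bool) (b : Bool), X η → X (η ++ [b])

attribute [instance] TreeSystem.inf

/-! ### Structures built from families of trees -/

namespace TreeSystem

variable (X : TreeSystem.{w})

/-- The universe of the structure given by a tree system: the trees are put side by side and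
countably many elements outside of them are added. -/
def Carrier : Type w := (Σ η, X.X η) ⊕ ℕ

variable {X}

/-- The element `x` of the tree at `η`. -/
def pt (η : List Bool) (x : X.X η) : X.Carrier := Sum.inl ⟨η, x⟩

instance : Nonempty X.Carrier := ⟨Sum.inr 0⟩

theorem pt_inj {η : List Bool} {x y : X.X η} : pt η x = pt η y ↔ x = y :=
  ⟨fun h => eq_of_heq (Sigma.mk.inj (Sum.inl.inj h)).2, fun h => h ▸ rfl⟩

open Classical in
/-- The meet of two elements of the same tree, and the first of two other elements. -/
noncomputable def meet : X.Carrier → X.Carrier → X.Carrier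
  | Sum.inl ⟨η, x⟩, Sum.inl ⟨ν, y⟩ => if h : η = ν then pt ν ((h ▸ x) ⊓ y) else pt η x
  | x, _ => x

/-- The connecting maps as maps on all elements. -/
def conn (b : Bool) : X.Carrier → X.Carrier
  | Sum.inl ⟨η, x⟩ => pt (η ++ [b]) (X.g η b x)
  | x => x

theorem meet_pt {η : List Bool} {x y : X.X η} : meet (pt η x) (pt η y) = pt η (x ⊓ y) := by
  exact dif_pos rfl

open Classical in
noncomputable instance str (S : Set (List Bool)) : (treeLang S).Structure X.Carrier where
  funMap := fun f v => match f with
    | .meet η _ =>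
      if (∃ x, v 0 = pt η x) ∧ ∃ y, v 1 = pt η y then meet (v 0) (v 1) else v 0
    | .conn η b _ _ => if ∃ x, v 0 = pt η x then conn b (v 0) else v 0
  RelMap := fun r v => match r with
    | .pred η _ => ∃ x, v 0 = pt η x
    | .lt η _ => ∃ x y, v 0 = pt η x ∧ v 1 = pt η y ∧ x < y

variable {S : Set (List Bool)}

theorem sLt_iff {η : List Bool} (h : η ∈ S) {x y : X.Carrier} :
    sLt η h x y ↔ ∃ u v, x = pt η u ∧ y = pt η v ∧ u < v :=
  Iff.rfl

theorem sLt_pt {η : List Bool} (h : η ∈ S) {x y : X.X η} :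
    sLt η h (pt η x) (pt η y) ↔ x < y := by
  rw [sLt_iff]
  constructor
  · rintro ⟨u, v, h1, h2, h3⟩
    rw [pt_inj] at h1 h2
    rwa [h1, h2]
  · exact fun h => ⟨x, y, rfl, rfl, h⟩

theorem sMeet_pt {η : List Bool} (h : η ∈ S) {x y : X.X η} :
    sMeet η h (pt η x) (pt η y) = pt η (x ⊓ y) :=
  (if_pos ⟨⟨x, rfl⟩, ⟨y, rfl⟩⟩).trans meet_pt

theorem sMeet_out {η : List Bool} (h : η ∈ S) {x y : X.Carrier} (hn : ¬ (sP η h x ∧ sP η h y)) :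
    sMeet η h x y = x :=
  if_neg hn

theorem sConn_pt {η : List Bool} {b : Bool} (h : η ∈ S) (h' : η ++ [b] ∈ S) {x : X.X η} :
    sConn η b h h' (pt η x) = pt (η ++ [b]) (X.g η b x) :=
  if_pos ⟨x, rfl⟩

theorem sConn_out {η : List Bool} {b : Bool} (h : η ∈ S) (h' : η ++ [b] ∈ S) {x : X.Carrier}
    (hn : ¬ sP η h x) : sConn η b h h' x = x :=
  if_neg hn

theorem sLt_or_eq_iff {η : List Bool} (h : η ∈ S) {x y : X.X η} :
    (sLt η h (pt η x) (pt η y) ∨ pt η x = pt η y) ↔ x ≤ y := by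
  rw [sLt_pt, pt_inj, le_iff_lt_or_eq]

theorem isTreeModel (X : TreeSystem.{w}) (S : Set (List Bool)) : IsTreeModel S X.Carrier where
  disjoint := by
    rintro η ν h h' hne x ⟨⟨u, rfl⟩, ⟨v, hv⟩⟩
    exact hne (Sigma.mk.inj (Sum.inl.inj hv)).1
  lt_dom := by
    rintro η h _ _ ⟨u, v, rfl, rfl, -⟩
    exact ⟨⟨u, rfl⟩, ⟨v, rfl⟩⟩
  irrefl := by
    rintro η h _ ⟨u, v, rfl, h1, h2⟩
    exact h2.ne (pt_inj.1 h1)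
  trans := by
    rintro η h _ _ _ ⟨u, v, rfl, rfl, h1⟩ ⟨u', v', h2, rfl, h3⟩
    rw [pt_inj.1 h2] at h1
    exact ⟨u, v', rfl, rfl, h1.trans h3⟩
  tree := by
    rintro η h _ _ _ ⟨u, v, rfl, rfl, h1⟩ ⟨u', v', rfl, h2, h3⟩
    rw [← pt_inj.1 h2] at h3
    rw [sLt_or_eq_iff, sLt_pt]
    rcases X.le_or_le h1.le h3.le with h4 | h4
    · exact Or.inl h4
    · rcases h4.lt_or_eq with h4 | h4
      · exact Or.inr h4
      · exact Or.inl h4.ge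
  meet_le := by
    rintro η h _ _ ⟨x, rfl⟩ ⟨y, rfl⟩
    refine ⟨⟨x ⊓ y, ?_⟩, ?_, ?_⟩
    · exact sMeet_pt h
    · rw [sMeet_pt, sLt_or_eq_iff]
      exact inf_le_left
    · rw [sMeet_pt, sLt_or_eq_iff]
      exact inf_le_right
  le_meet := by
    rintro η h _ _ z ⟨x, rfl⟩ ⟨y, rfl⟩ h1 h2
    have hz : ∃ u, z = pt η u := by
      rcases h1 with ⟨u, v, rfl, -⟩ | rfl
      · exact ⟨u, rfl⟩
      · exact ⟨x, rfl⟩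
    obtain ⟨z, rfl⟩ := hz
    rw [sLt_or_eq_iff] at h1 h2
    rw [sMeet_pt, sLt_or_eq_iff]
    exact le_inf h1 h2
  meet_out := fun η h x y hn => sMeet_out h hn
  conn_mem := by
    rintro η b h h' _ ⟨x, rfl⟩
    exact ⟨X.g η b x, sConn_pt h h'⟩
  conn_out := fun η b h h' x hn => sConn_out h h' hn

instance model (X : TreeSystem.{w}) (S : Set (List Bool)) : X.Carrier ⊨ univTheory S :=
  (model_univTheory_iff S _).2 (X.isTreeModel S)

/-- The interpretations do not depend on `S`, so the same carrier serves all the languages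
coherently. -/
instance isExpansionOn {S S' : Set (List Bool)} (h : S ⊆ S') :
    (treeLang.incl h).IsExpansionOn X.Carrier where
  map_onFunction := by
    rintro n (_ | _) v <;> rfl
  map_onRelation := by
    rintro n (_ | _) v <;> rfl

end TreeSystem

/-- The tree of partial functions `f : {t : Λ | t < q} → K` with support in the class `C` of sets,
ordered by extension. A partial function is extended by `0`. -/
@[ext] structure Trunc (Λ : Type w) [LinearOrder Λ] (K : Type) [Zero K] (C : Set Λ → Prop) where
  q : Λ
  f : Λ → K
  eq_zero : ∀ t, q ≤ t → f t = 0
  mem : C {t | f t ≠ 0}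

/-- The class `C` of subsets of a linear order is suited to be the class of supports. -/
class SupportClass {Λ : Type w} [LinearOrder Λ] (C : Set Λ → Prop) : Prop where
  mono : ∀ s t, C t → s ⊆ t → C s
  exists_least : ∀ s t, C s → C t → ∀ u ⊆ s ∪ t, u.Nonempty → ∃ m ∈ u, ∀ x ∈ u, m ≤ x

/-! ### Trees of partial functions -/

namespace Trunc

variable {Λ : Type w} [LinearOrder Λ] {K : Type} [Zero K] {C : Set Λ → Prop}

instance : PartialOrder (Trunc Λ K C) where
  le x y := x.q ≤ y.q ∧ ∀ t < x.q, x.f t = y.f t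
  le_refl x := ⟨le_rfl, fun _ _ => rfl⟩
  le_trans x y z h h' := ⟨h.1.trans h'.1, fun t ht => (h.2 t ht).trans (h'.2 t (ht.trans_le h.1))⟩
  le_antisymm x y h h' := by
    have hq := le_antisymm h.1 h'.1
    refine Trunc.ext hq (funext fun t => ?_)
    rcases lt_or_ge t x.q with ht | ht
    · exact h.2 t ht
    · rw [x.eq_zero t ht, y.eq_zero t (hq ▸ ht)]

theorem le_def {x y : Trunc Λ K C} : x ≤ y ↔ x.q ≤ y.q ∧ ∀ t < x.q, x.f t = y.f t := Iff.rfl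

theorem le_or_le {x y z : Trunc Λ K C} (h : x ≤ z) (h' : y ≤ z) : x ≤ y ∨ y ≤ x := by
  rcases le_total x.q y.q with hq | hq
  · exact Or.inl ⟨hq, fun t ht => (h.2 t ht).trans (h'.2 t (ht.trans_le hq)).symm⟩
  · exact Or.inr ⟨hq, fun t ht => (h'.2 t ht).trans (h.2 t (ht.trans_le hq)).symm⟩

theorem q_lt_of_lt {x y : Trunc Λ K C} (h : x < y) : x.q < y.q := by
  refine lt_of_le_of_ne h.le.1 fun he => h.ne (le_antisymm h.le ⟨he.ge, fun t ht => ?_⟩)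
  exact (h.le.2 t (he ▸ ht)).symm

variable [SupportClass C]

open Classical in
/-- The restriction of a partial function. -/
noncomputable def restrict (x : Trunc Λ K C) (q : Λ) : Trunc Λ K C where
  q := q
  f t := if t < q then x.f t else 0
  eq_zero t ht := if_neg ht.not_gt
  mem := SupportClass.mono _ _ x.mem fun t ht => by
    simp only [Set.mem_ofPred_eq] at ht ⊢
    by_cases h : t < q
    · rwa [if_pos h] at ht
    · rw [if_neg h] at ht
      exact absurd rfl ht

theorem restrict_le {x : Trunc Λ K C} {q : Λ} (h : q ≤ x.q) : x.restrict q ≤ x :=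
  ⟨h, fun _ ht => if_pos ht⟩

theorem le_restrict {x y : Trunc Λ K C} {q : Λ} (h : y ≤ x) (hq : y.q ≤ q) : y ≤ x.restrict q :=
  ⟨hq, fun t ht => (h.2 t ht).trans (if_pos (ht.trans_le hq)).symm⟩

/-- The places where `x` and `y` differ lie in the union of the supports, so there is a first one
inside both domains unless one function extends the other. This is what makes meets exist over a
dense order. -/
theorem exists_split (x y : Trunc Λ K C) : ∃ m, m ≤ x.q ∧ m ≤ y.q ∧ (∀ t < m, x.f t = y.f t) ∧
    ((m = x.q ∨ m = y.q) ∨ x.f m ≠ y.f m) := by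
  by_cases h : {t | (t < x.q ∧ t < y.q) ∧ x.f t ≠ y.f t}.Nonempty
  · obtain ⟨m, ⟨⟨h1, h2⟩, h3⟩, hm⟩ := SupportClass.exists_least _ _ x.mem y.mem
      {t | (t < x.q ∧ t < y.q) ∧ x.f t ≠ y.f t} (by
        rintro t ⟨-, ht⟩
        by_contra hn
        simp only [Set.mem_union, Set.mem_ofPred_eq, not_or, not_not] at hn
        exact ht (hn.1.trans hn.2.symm)) h
    refine ⟨m, h1.le, h2.le, fun t ht => ?_, Or.inr h3⟩
    by_contra hn
    exact (hm t ⟨⟨ht.trans h1, ht.trans h2⟩, hn⟩).not_gt ht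
  · refine ⟨min x.q y.q, min_le_left _ _, min_le_right _ _, fun t ht => ?_,
      Or.inl (min_choice _ _)⟩
    by_contra hn
    exact h ⟨t, ⟨lt_min_iff.1 ht, hn⟩⟩

/-- The length of the common part of two partial functions. -/
noncomputable def split (x y : Trunc Λ K C) : Λ := (exists_split x y).choose

theorem le_split {x y z : Trunc Λ K C} (hx : z ≤ x) (hy : z ≤ y) : z.q ≤ split x y := by
  obtain ⟨-, -, -, h⟩ := (exists_split x y).choose_spec
  by_contra hlt
  rw [not_le] at hlt
  rcases h with (h | h) | h
  · exact (hx.1.trans_eq h.symm).not_gt hlt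
  · exact (hy.1.trans_eq h.symm).not_gt hlt
  · exact h ((hx.2 _ hlt).symm.trans (hy.2 _ hlt))

noncomputable instance : SemilatticeInf (Trunc Λ K C) where
  inf x y := x.restrict (split x y)
  inf_le_left x y := restrict_le (exists_split x y).choose_spec.1
  inf_le_right x y := ⟨(exists_split x y).choose_spec.2.1, fun t ht =>
    (if_pos ht).trans ((exists_split x y).choose_spec.2.2.1 t ht)⟩
  le_inf _ _ _ h h' := le_restrict h (le_split h h')

theorem restrict_lt {x : Trunc Λ K C} {q : Λ} (h : q < x.q) : x.restrict q < x :=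
  lt_of_le_of_ne (restrict_le h.le) fun he => h.ne (congrArg Trunc.q he)

end Trunc

/-! ### The generic model -/

section Generic

instance : SupportClass (Λ := ℚ) Set.Finite where
  mono _ _ h hst := h.subset hst
  exists_least s t hs ht u hu hne := by
    obtain ⟨m, hm, h⟩ := Set.exists_min_image u id ((hs.union ht).subset hu) hne
    exact ⟨m, hm, h⟩

/-- The countable dense meet tree with infinite branching everywhere. -/
abbrev GenTree : Type := Trunc ℚ ℕ Set.Finite

instance : Countable GenTree := by
  have : Function.Injective fun x : GenTree => (x.q, Finsupp.ofSupportFinite x.f x.mem) := by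
    intro x y h
    obtain ⟨h1, h2⟩ := Prod.mk.inj h
    exact Trunc.ext h1 (congrArg (fun f : ℚ →₀ ℕ => (f : ℚ → ℕ)) h2)
  exact this.countable

instance : Nonempty GenTree := ⟨⟨0, 0, fun _ _ => rfl, by simp⟩⟩

/-- The colour is the 2-adic valuation: the numbers `2 ^ k * (2 * m + 1) / (2 * d + 1)` have
valuation `k`, and for large `d` the choice of `m` as a rounded quotient puts one of them between
`a` and `b`. -/
theorem exists_dense_coloring : ∃ h : ℚ → ℕ, ∀ (k : ℕ) (a b : ℚ), a < b →
    ∃ q, a < q ∧ q < b ∧ h q = k := by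
  refine ⟨fun q => (padicValRat 2 q).toNat, fun k a b hab => ?_⟩
  obtain ⟨d, hd⟩ := exists_nat_gt (2 ^ (k + 2) / (b - a))
  have hba : 0 < b - a := sub_pos.2 hab
  have h2 : (0 : ℚ) < 2 ^ k := by positivity
  rw [div_lt_iff₀ hba] at hd
  have hd0 : (0 : ℚ) < 2 * d + 1 := by positivity
  set m : ℤ := ⌊a * (2 * d + 1) / 2 ^ (k + 1)⌋ + 1 with hm
  have hm1 : a * (2 * d + 1) / 2 ^ (k + 1) < m := by
    rw [hm]; push_cast; exact Int.lt_floor_add_one _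
  have hm2 : (m : ℚ) ≤ a * (2 * d + 1) / 2 ^ (k + 1) + 1 := by
    rw [hm]; push_cast
    have := Int.floor_le (a * (2 * d + 1) / 2 ^ (k + 1))
    linarith
  have h2' : (0 : ℚ) < 2 ^ (k + 1) := by positivity
  rw [div_lt_iff₀ h2'] at hm1
  rw [← sub_le_iff_le_add, le_div_iff₀ h2'] at hm2
  have e1 : (2 : ℚ) ^ (k + 1) = 2 * 2 ^ k := by ring
  have e2 : (2 : ℚ) ^ (k + 2) = 4 * 2 ^ k := by ring
  rw [e1] at hm1 hm2
  rw [e2] at hd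
  have hodd : ∀ z : ℤ, padicValRat 2 ((2 * z + 1 : ℤ) : ℚ) = 0 := by
    intro z
    rw [padicValRat.of_int, Nat.cast_eq_zero]
    exact padicValInt.eq_zero_of_not_dvd (by omega)
  refine ⟨2 ^ k * ((2 * m + 1 : ℤ) : ℚ) / ((2 * (d : ℤ) + 1 : ℤ) : ℚ), ?_, ?_, ?_⟩
  · push_cast
    rw [lt_div_iff₀ hd0]
    nlinarith
  · push_cast
    rw [div_lt_iff₀ hd0]
    nlinarith
  · have hne : ((2 * m + 1 : ℤ) : ℚ) ≠ 0 := by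
      rw [Int.cast_ne_zero]; omega
    have hne' : ((2 * (d : ℤ) + 1 : ℤ) : ℚ) ≠ 0 := by
      rw [Int.cast_ne_zero]; omega
    have : Fact (Nat.Prime 2) := ⟨Nat.prime_two⟩
    have h22 : padicValRat 2 (2 : ℚ) = 1 := by
      exact_mod_cast padicValRat.self (p := 2) (by norm_num)
    simp only
    rw [padicValRat.div (mul_ne_zero h2.ne' hne) hne', padicValRat.mul h2.ne' hne,
      padicValRat.pow 2, hodd, hodd, h22]
    simp

theorem exists_dense_targets : ∃ h : ℚ → Bool → GenTree, ∀ (y : Bool → GenTree) (a b : ℚ), a < b →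
    ∃ q, a < q ∧ q < b ∧ h q = y := by
  obtain ⟨e, he⟩ := exists_surjective_nat (Bool → GenTree)
  obtain ⟨h, hh⟩ := exists_dense_coloring
  refine ⟨fun q => e (h q), fun y a b hab => ?_⟩
  obtain ⟨k, rfl⟩ := he y
  obtain ⟨q, h1, h2, h3⟩ := hh k a b hab
  exact ⟨q, h1, h2, by simp only [h3]⟩

/-- The generic tree system. -/
noncomputable def genSystem : TreeSystem.{0} where
  X _ := GenTree
  le_or_le := Trunc.le_or_le
  g _ b x := exists_dense_targets.choose x.q b

/-- The generic tree of trees. -/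
abbrev GenModel : Type := genSystem.Carrier

open TreeSystem

/-- Restrictions of `p` are the points below it. Any length between those of `B` and that of `p`
will do, and by density one of them has the targets `y`. -/
theorem exists_genTree_below (p : GenTree) (B : Set GenTree) (hB : B.Finite) (hlt : ∀ z ∈ B, z < p)
    (y : Bool → GenTree) :
    ∃ x < p, (∀ z ∈ B, z < x) ∧ exists_dense_targets.choose x.q = y := by
  obtain ⟨r, hr, hrB⟩ : ∃ r < p.q, ∀ z ∈ B, z.q ≤ r := by
    rcases B.eq_empty_or_nonempty with rfl | hne
    · exact ⟨p.q - 1, by linarith, fun z hz => absurd hz id⟩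
    · obtain ⟨m, hm, h⟩ := Set.exists_max_image B Trunc.q hB hne
      exact ⟨m.q, Trunc.q_lt_of_lt (hlt m hm), h⟩
  obtain ⟨q, h1, h2, h3⟩ := exists_dense_targets.choose_spec y r p.q hr
  refine ⟨p.restrict q, Trunc.restrict_lt h2, fun z hz => ?_, h3⟩
  have hzq : z.q < q := (hrB z hz).trans_lt h1
  exact lt_of_le_of_ne (Trunc.le_restrict (hlt z hz).le hzq.le)
    fun he => hzq.ne (congrArg Trunc.q he)

/-- Extend `p` by a value `k` at `p.q` which no element of `B` takes there; an element of `B`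
sharing more than `p` with `x` would have to take it. The length remains free for the targets. -/
theorem exists_genTree_above (p : GenTree) (B : Set GenTree) (hB : B.Finite)
    (y : Bool → GenTree) :
    ∃ x > p, (∀ z ∈ B, x ⊓ z ≤ p) ∧ exists_dense_targets.choose x.q = y := by
  obtain ⟨q, h1, -, h3⟩ := exists_dense_targets.choose_spec y p.q (p.q + 1) (by linarith)
  obtain ⟨k, hk0, hk⟩ : ∃ k : ℕ, k ≠ 0 ∧ ∀ z ∈ B, z.f p.q ≠ k := by
    obtain ⟨k, hk⟩ := ((hB.image fun z => z.f p.q).union (Set.finite_singleton 0)).exists_notMem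
    simp only [Set.mem_union, Set.mem_image, Set.mem_singleton_iff, not_or, not_exists,
      not_and] at hk
    exact ⟨k, hk.2, hk.1⟩
  let x : GenTree := ⟨q, Function.update p.f p.q k, fun t ht => by
      rw [Function.update_of_ne (by linarith), p.eq_zero t (by linarith)], by
      refine (p.mem.union (Set.finite_singleton p.q)).subset fun t ht => ?_
      by_cases h : t = p.q
      · exact Or.inr h
      · left
        simpa [Function.update_of_ne h] using ht⟩
  have hpx : p ≤ x := ⟨h1.le, fun t ht => (Function.update_of_ne ht.ne _ _).symm⟩
  refine ⟨x, lt_of_le_of_ne hpx fun he => h1.ne (congrArg Trunc.q he), fun z hz => ?_, h3⟩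
  rcases Trunc.le_or_le (inf_le_left : x ⊓ z ≤ x) hpx with h | h
  · exact h
  · rcases h.lt_or_eq with h | h
    · exfalso
      have h4 := Trunc.q_lt_of_lt h
      have h5 : (x ⊓ z).f p.q = k :=
        ((inf_le_left : x ⊓ z ≤ x).2 _ h4).trans (Function.update_self _ _ _)
      have h6 : (x ⊓ z).f p.q = z.f p.q := (inf_le_right : x ⊓ z ≤ z).2 _ h4
      exact hk z hz (h6.symm.trans h5)
    · exact h.ge

theorem genModel_rich (S : Set (List Bool)) [Forest S GenModel] : Rich S GenModel := by
  have hpt : ∀ {η : List Bool} {x : GenModel}, node x = some η → ∃ u : GenTree,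
      x = pt (X := genSystem) η u := fun {η x} h => (Forest.sP_iff (node_mem h)).2 h
  have hnode : ∀ {η : List Bool} (_ : η ∈ S) (u : GenTree),
      node (pt (X := genSystem) η u : GenModel) = some η := fun h u =>
    (Forest.sP_iff h).1 ⟨u, rfl⟩
  have hlt : ∀ {η : List Bool} (_ : η ∈ S) (u v : GenTree),
      (pt (X := genSystem) η u : GenModel) < pt (X := genSystem) η v ↔ u < v := by
    intro η h u v
    have := Forest.sLt_iff h (x := pt (X := genSystem) η u) (y := pt (X := genSystem) η v)
    rw [and_iff_left (hnode h u)] at this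
    exact this.symm.trans (sLt_pt (X := genSystem) h)
  have hle : ∀ {η : List Bool} (_ : η ∈ S) (u v : GenTree),
      (pt (X := genSystem) η u : GenModel) ≤ pt (X := genSystem) η v ↔ u ≤ v := by
    intro η h u v
    rw [le_iff_lt_or_eq, hlt h, le_iff_lt_or_eq]
    exact or_congr Iff.rfl pt_inj
  have hmeet : ∀ {η : List Bool} (_ : η ∈ S) (u v : GenTree),
      Forest.meet (pt (X := genSystem) η u : GenModel) (pt (X := genSystem) η v) =
        pt (X := genSystem) η (u ⊓ v) := by
    intro η h u v
    rw [← Forest.sMeet_eq h (hnode h u) (hnode h v)]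
    exact sMeet_pt (X := genSystem) h
  have hconn : ∀ {η : List Bool} (_ : η ∈ S) (u : GenTree) (y : Bool → GenModel),
      (∀ b, η ++ [b] ∈ S → ∃ z : GenTree, y b = pt (X := genSystem) (η ++ [b]) z ∧
        exists_dense_targets.choose u.q b = z) →
      ∀ b, η ++ [b] ∈ S → Forest.conn b (pt (X := genSystem) η u : GenModel) = y b := by
    intro η h u y hy b hb
    obtain ⟨z, h1, h2⟩ := hy b hb
    rw [← Forest.sConn_eq h hb (hnode h u), h1, ← h2]
    exact sConn_pt (X := genSystem) h hb
  have htarget : ∀ {η : List Bool} (y : Bool → GenModel),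
      (∀ b, η ++ [b] ∈ S → node (y b) = some (η ++ [b])) → ∃ z : Bool → GenTree,
        ∀ b, η ++ [b] ∈ S → y b = pt (X := genSystem) (η ++ [b]) (z b) := by
    intro η y hy
    have : ∀ b, ∃ z : GenTree, η ++ [b] ∈ S → y b = pt (X := genSystem) (η ++ [b]) z := by
      intro b
      by_cases hb : η ++ [b] ∈ S
      · obtain ⟨z, hz⟩ := hpt (hy b hb)
        exact ⟨z, fun _ => hz⟩
      · exact ⟨Classical.arbitrary _, fun h => absurd h hb⟩
    choose z hz using this
    exact ⟨z, hz⟩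
  constructor
  · intro B hB
    obtain ⟨k, hk⟩ := (hB.preimage (f := fun k : ℕ => (Sum.inr k : GenModel))
      fun _ _ _ _ h => Sum.inr.inj h).exists_notMem
    have key : ∀ x : GenModel, x = Sum.inr k → node x = none := by
      intro x hx
      cases hη : node x with
      | none => rfl
      | some η =>
        obtain ⟨u, rfl⟩ := hpt hη
        cases hx
    exact ⟨_, hk, key _ rfl⟩
  · intro η hη y hy
    obtain ⟨z, hz⟩ := htarget y hy
    obtain ⟨x, -, -, hx⟩ := exists_genTree_above (Classical.arbitrary _) ∅ Set.finite_empty z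
    exact ⟨pt (X := genSystem) η x, hnode hη x, hconn hη x y fun b hb =>
      ⟨z b, hz b hb, congrFun hx b⟩⟩
  · intro η p hp B hB hlt' y hy
    have hη := node_mem hp
    obtain ⟨p, rfl⟩ := hpt hp
    obtain ⟨z, hz⟩ := htarget y hy
    obtain ⟨x, h1, h2, h3⟩ := exists_genTree_below p ((pt (X := genSystem) η) ⁻¹' B)
      (hB.preimage fun _ _ _ _ h => pt_inj.1 h) (fun u hu => (hlt hη _ _).1 (hlt' _ hu)) z
    refine ⟨pt (X := genSystem) η x, (hlt hη _ _).2 h1, fun u hu => ?_, hconn hη x y fun b hb =>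
      ⟨z b, hz b hb, congrFun h3 b⟩⟩
    obtain ⟨u, rfl⟩ := hpt ((node_eq_of_le (hlt' u hu).le).trans hp)
    exact (hlt hη _ _).2 (h2 u hu)
  · intro η p hp B hB y hy
    have hη := node_mem hp
    obtain ⟨p, rfl⟩ := hpt hp
    obtain ⟨z, hz⟩ := htarget y hy
    obtain ⟨x, h1, h2, h3⟩ := exists_genTree_above p ((pt (X := genSystem) η) ⁻¹' B)
      (hB.preimage fun _ _ _ _ h => pt_inj.1 h) z
    refine ⟨pt (X := genSystem) η x, (hlt hη _ _).2 h1, fun u hu huη => ?_,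
      hconn hη x y fun b hb => ⟨z b, hz b hb, congrFun h3 b⟩⟩
    obtain ⟨u, rfl⟩ := hpt huη
    rw [hmeet hη]
    exact (hle hη (x ⊓ u) p).2 (h2 u hu)

end Generic

/-! ### Uniqueness of model completions -/

section Uniqueness

universe u v

variable {L : FirstOrder.Language.{u, v}} {U T T' : L.Theory}

theorem IsModelCompletion.model (h : IsModelCompletion U T) (M : Type*) [L.Structure M]
    [Nonempty M] [M ⊨ T] : M ⊨ U :=
  ⟨fun φ hφ => (h.extends_base φ hφ).realize_sentence M⟩

/-- A model completion is model complete. -/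
theorem IsModelCompletion.realize_embedding (h : IsModelCompletion U T)
    {M N : Type max u v} [L.Structure M] [L.Structure N] [Nonempty M] [Nonempty N] [M ⊨ T] [N ⊨ T]
    (f : M ↪[L] N) {α : Type*} {n : ℕ} (φ : L.BoundedFormula α n) (x : α → M) (xs : Fin n → M) :
    φ.Realize x xs ↔ φ.Realize (f ∘ x) (f ∘ xs) := by
  have : M ⊨ U := h.model M
  have key := h.complete_over (.of U M) (.of T M) (.of T N) (Embedding.refl L M) f
    (φ.toFormula.relabel (Sum.elim x xs))
  have e : ∀ (P : Type max u v) [L.Structure P] (g : M → P),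
      (φ.toFormula.relabel (Sum.elim x xs)).Realize g ↔ φ.Realize (g ∘ x) (g ∘ xs) := by
    intro P _ g
    rw [Formula.realize_relabel, BoundedFormula.realize_toFormula]
    rfl
  exact ((e M id).symm.trans key).trans (e N f)

/-- This replaces the alternating chain of models by an induction on formulas, for both orders of
the two theories at once. -/
theorem IsModelCompletion.realize_iff {α : Type*} {n : ℕ} (φ : L.BoundedFormula α n) :
    ∀ {T T' : L.Theory} (_ : IsModelCompletion U T) (_ : IsModelCompletion U T')
    {M N : Type max u v} [L.Structure M] [L.Structure N] [Nonempty M] [Nonempty N] [M ⊨ T] [N ⊨ T']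
    (f : M ↪[L] N) (x : α → M) (xs : Fin n → M),
    φ.Realize x xs ↔ φ.Realize (f ∘ x) (f ∘ xs) := by
  induction φ with
  | falsum => exact fun _ _ _ _ _ _ _ _ _ _ _ _ _ => Iff.rfl
  | equal t₁ t₂ => 
    intro T T' h h' M N _ _ _ _ _ _ f x xs
    exact ((BoundedFormula.IsAtomic.equal t₁ t₂).isQF.realize_embedding f).symm
  | rel R ts =>
    intro T T' h h' M N _ _ _ _ _ _ f x xs
    exact ((BoundedFormula.IsAtomic.rel R ts).isQF.realize_embedding f).symm
  | imp φ ψ ih₁ ih₂ =>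
    intro T T' h h' M N _ _ _ _ _ _ f x xs
    rw [BoundedFormula.realize_imp, BoundedFormula.realize_imp, ih₁ h h' f, ih₂ h h' f]
  | all φ ih =>
    intro T T' h h' M N _ _ _ _ _ _ f x xs
    constructor
    · intro hM y
      -- A witness in `N` is pushed on to a model `M₁` of `T`. The composite from `M` is elementary
      -- by model completeness of `T`, and the induction hypothesis with `T` and `T'` exchanged
      -- comes back along `g`.
      obtain ⟨M₁, ⟨g⟩⟩ : ∃ M₁ : Theory.ModelType.{u, v, max u v} T, Nonempty (N ↪[L] M₁) :=
        h.embeds (@Theory.ModelType.of _ U N _ (h'.model N) _)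
      have h1 := (h.realize_embedding (g.comp f) φ.all x xs).1 hM (g y)
      rw [ih h' h g, Fin.comp_snoc]
      exact h1
    · intro hN y
      rw [ih h h' f, Fin.comp_snoc]
      exact hN (f y)

/-- Any two model completions of a theory are equivalent. -/
theorem IsModelCompletion.models (h : IsModelCompletion U T) (h' : IsModelCompletion U T')
    {σ : L.Sentence} (hσ : σ ∈ T') : T ⊨ᵇ σ := by
  rw [Theory.models_sentence_iff]
  intro M
  obtain ⟨N, ⟨f⟩⟩ : ∃ N : Theory.ModelType.{u, v, max u v} T', Nonempty (M ↪[L] N) :=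
    h'.embeds (@Theory.ModelType.of _ U M _ (h.model M) _)
  have h1 : N ⊨ σ := Theory.realize_sentence_of_mem T' hσ
  have h2 := IsModelCompletion.realize_iff σ h h' f default default
  rw [Subsingleton.elim (f ∘ default) default, Subsingleton.elim (f ∘ default) default] at h2
  exact h2.2 h1

end Uniqueness

/-! ### Reducts to fewer nodes -/

section Reducts

variable {S S' : Set (List Bool)}

/-- A symbol mentions nodes of bounded length. Asking this for all larger `n` lets the bounds for
the parts of a formula be combined by maxima. -/
theorem treeLang.exists_functions_incl {l : ℕ} (f : (treeLang S').Functions l) :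
    ∃ n₀, ∀ n ≥ n₀, ∀ {S} (h : S ⊆ S'), S' ∩ nodes n ⊆ S → ∃ f' : (treeLang S).Functions l,
      (treeLang.incl h).onFunction f' = f := by
  cases f with
  | meet η h => exact ⟨η.length, fun n hn _ _ hS => ⟨TreeFunc.meet η (hS ⟨h, hn⟩), rfl⟩⟩
  | conn η b h h' => exact ⟨(η ++ [b]).length, fun n hn _ _ hS => ⟨TreeFunc.conn η b
      (hS ⟨h, (List.length_append.symm.le.trans' (Nat.le_add_right _ _)).trans hn⟩) (hS ⟨h', hn⟩),
      rfl⟩⟩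

theorem treeLang.exists_relations_incl {l : ℕ} (r : (treeLang S').Relations l) :
    ∃ n₀, ∀ n ≥ n₀, ∀ {S} (h : S ⊆ S'), S' ∩ nodes n ⊆ S → ∃ r' : (treeLang S).Relations l,
      (treeLang.incl h).onRelation r' = r := by
  cases r with
  | pred η h => exact ⟨η.length, fun n hn _ _ hS => ⟨TreeRel.pred η (hS ⟨h, hn⟩), rfl⟩⟩
  | lt η h => exact ⟨η.length, fun n hn _ _ hS => ⟨TreeRel.lt η (hS ⟨h, hn⟩), rfl⟩⟩

variable {M : Type*} [(treeLang S).Structure M] [(treeLang S').Structure M]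

theorem IsTreeModel.of_isExpansionOn (h : S ⊆ S') [(treeLang.incl h).IsExpansionOn M]
    (hM : IsTreeModel S' M) : IsTreeModel S M := by
  have hP : ∀ (η) (hη : η ∈ S) (x : M), sP η (h hη) x ↔ sP η hη x := fun η hη x =>
    iff_of_eq ((treeLang.incl h).map_onRelation (M := M) (TreeRel.pred η hη) ![x])
  have hL : ∀ (η) (hη : η ∈ S) (x y : M), sLt η (h hη) x y ↔ sLt η hη x y := fun η hη x y =>
    iff_of_eq ((treeLang.incl h).map_onRelation (M := M) (TreeRel.lt η hη) ![x, y])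
  have hm : ∀ (η) (hη : η ∈ S) (x y : M), sMeet η (h hη) x y = sMeet η hη x y := fun η hη x y =>
    (treeLang.incl h).map_onFunction (M := M) (TreeFunc.meet η hη) ![x, y]
  have hc : ∀ (η b) (hη : η ∈ S) (hη' : η ++ [b] ∈ S) (x : M),
      sConn η b (h hη) (h hη') x = sConn η b hη hη' x := fun η b hη hη' x =>
    (treeLang.incl h).map_onFunction (M := M) (TreeFunc.conn η b hη hη') ![x]
  constructor
  · intro η ν h1 h2
    simpa only [← hP] using hM.disjoint η ν (h h1) (h h2)
  · intro η h1
    simpa only [← hP, ← hL] using hM.lt_dom η (h h1)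
  · intro η h1
    simpa only [← hL] using hM.irrefl η (h h1)
  · intro η h1
    simpa only [← hL] using hM.trans η (h h1)
  · intro η h1
    simpa only [← hL] using hM.tree η (h h1)
  · intro η h1
    simpa only [← hP, ← hL, ← hm] using hM.meet_le η (h h1)
  · intro η h1
    simpa only [← hP, ← hL, ← hm] using hM.le_meet η (h h1)
  · intro η h1
    simpa only [← hP, ← hL, ← hm] using hM.meet_out η (h h1)
  · intro η b h1 h2
    simpa only [← hP, ← hc] using hM.conn_mem η b (h h1) (h h2)
  · intro η b h1 h2
    simpa only [← hP, ← hc] using hM.conn_out η b (h h1) (h h2)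

end Reducts

/-- On a finite set, a model of the universal theory looks like a part of the generic tree of
trees. -/
theorem exists_local_embedding {S : Set (List Bool)} {n : ℕ} (hS : S ⊆ nodes n) {A : Type*}
    [Nonempty A] [(treeLang S).Structure A] (hA : IsTreeModel S A) (F : Finset A) :
    ∃ h : A → GenModel, (∀ x ∈ F, ∀ y ∈ F, h x = h y → x = y) ∧
      (∀ {l : ℕ} (f : (treeLang S).Functions l) (v : Fin l → A), (∀ i, v i ∈ F) →
        h (Structure.funMap f v) = Structure.funMap f (h ∘ v)) ∧
      ∀ {l : ℕ} (r : (treeLang S).Relations l) (v : Fin l → A), (∀ i, v i ∈ F) →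
        (Structure.RelMap r (h ∘ v) ↔ Structure.RelMap r v) := by
  classical
  let := hA.forest
  let := (genSystem.isTreeModel S).forest
  obtain ⟨D, hD⟩ := exists_tower_extension_list n
  obtain ⟨a, -, hT, -, ha⟩ := hD S hS A _ closed_univ (fun _ => Classical.arbitrary A) 0
    (tower_zero _) (by simp [seg]) _ (fun i => (F.equivFin.symm i : A)) fun _ => trivial
  set N := 0 + F.card * D
  obtain ⟨a', -, hiso⟩ := (genModel_rich S).exists_iso
    (Iso.zero a fun _ => Classical.arbitrary GenModel)
    (fun _ _ => rfl) (Nat.zero_le _) hT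
  have hF : ∀ x ∈ F, ∃ i < N, a i = x := by
    intro x hx
    have := ha (F.equivFin ⟨x, hx⟩)
    simp only [Equiv.symm_apply_apply] at this
    exact this
  let h : A → GenModel := fun x =>
    if hx : ∃ i < N, a i = x then a' hx.choose else Classical.arbitrary _
  have hh : ∀ i < N, h (a i) = a' i := by
    intro i hi
    have hx : ∃ j < N, a j = a i := ⟨i, hi, rfl⟩
    simp only [h, dif_pos hx]
    exact (hiso.eq_iff hx.choose_spec.1 hi).1 hx.choose_spec.2
  have hv : ∀ {l : ℕ} (v : Fin l → A), (∀ i, v i ∈ F) → ∃ p : Fin l → ℕ, (∀ i, p i < N) ∧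
      v = (fun i => a (p i)) ∧ h ∘ v = fun i => a' (p i) := by
    intro l v hv
    choose p hp hpv using fun i => hF _ (hv i)
    exact ⟨p, hp, funext fun i => (hpv i).symm, funext fun i => by
      rw [Function.comp_apply, ← hpv i, hh _ (hp i)]⟩
  refine ⟨h, ?_, ?_, ?_⟩
  · intro x hx y hy hxy
    obtain ⟨i, hi, rfl⟩ := hF x hx
    obtain ⟨j, hj, rfl⟩ := hF y hy
    rw [hh i hi, hh j hj] at hxy
    exact (hiso.eq_iff hi hj).2 hxy
  · intro l f v hvF
    obtain ⟨p, hp, h1, h2⟩ := hv v hvF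
    obtain ⟨k, hk, h3, h4⟩ := hiso.realize_term (Term.func f Term.var) p hp
    rw [h2, h1]
    exact (congrArg h h3).trans ((hh k hk).trans h4.symm)
  · intro l r v hvF
    obtain ⟨p, hp, h1, h2⟩ := hv v hvF
    rw [h2, h1]
    exact (hiso.relMap_iff r p hp).symm

/-- Each model of the universal theory embeds in a structure satisfying the same sentences as the
generic tree of trees. -/
theorem exists_embedding (S : Set (List Bool)) (A : Type w) [Nonempty A] [(treeLang S).Structure A]
    (hA : IsTreeModel S A) : ∃ (N : Type w) (_ : (treeLang S).Structure N) (_ : Nonempty N),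
      (∀ σ : (treeLang S).Sentence, N ⊨ σ ↔ GenModel ⊨ σ) ∧ Nonempty (A ↪[treeLang S] N) := by
  classical
  have hloc : ∀ i : Finset A × ℕ, ∃ h : A → GenModel, (∀ x ∈ i.1, ∀ y ∈ i.1, h x = h y → x = y) ∧
      (∀ {l : ℕ} (f : (treeLang (S ∩ nodes i.2)).Functions l) (v : Fin l → A), (∀ j, v j ∈ i.1) →
        h (Structure.funMap (L := treeLang S)
          ((treeLang.incl Set.inter_subset_left).onFunction f) v) =
        Structure.funMap (L := treeLang S)
          ((treeLang.incl Set.inter_subset_left).onFunction f) (h ∘ v)) ∧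
      ∀ {l : ℕ} (r : (treeLang (S ∩ nodes i.2)).Relations l) (v : Fin l → A), (∀ j, v j ∈ i.1) →
        (Structure.RelMap (L := treeLang S)
          ((treeLang.incl Set.inter_subset_left).onRelation r) (h ∘ v) ↔
        Structure.RelMap (L := treeLang S)
          ((treeLang.incl Set.inter_subset_left).onRelation r) v) := by
    rintro ⟨F, n⟩
    let := (treeLang.incl (Set.inter_subset_left : S ∩ nodes n ⊆ S)).reduct A
    obtain ⟨h, h1, h2, h3⟩ := exists_local_embedding (S := S ∩ nodes n) Set.inter_subset_right
      (hA.of_isExpansionOn Set.inter_subset_left) F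
    refine ⟨h, h1, fun f v hv => ?_, fun r v hv => ?_⟩
    · rw [LHom.map_onFunction, LHom.map_onFunction]
      exact h2 f v hv
    · rw [LHom.map_onRelation, LHom.map_onRelation]
      exact h3 r v hv
  choose h hinj hfun hrel using hloc
  -- The local maps respect only finitely many elements and nodes of bounded length. An ultrafilter
  -- finer than `atTop` makes each instance eventually valid, so together they embed `A` in the
  -- ultrapower.
  let U : Ultrafilter (Finset A × ℕ) := Ultrafilter.of Filter.atTop
  have hU : ∀ P : Finset A × ℕ → Prop, (∃ i₀, ∀ i ≥ i₀, P i) → ∀ᶠ i in (U : Filter _), P i :=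
    fun P hP => (Filter.eventually_atTop.2 hP).filter_mono (Ultrafilter.of_le _)
  refine ⟨(U : Filter (Finset A × ℕ)).Product fun _ => GenModel, inferInstance, inferInstance,
    fun σ => ?_, ⟨?_⟩⟩
  · rw [Ultraproduct.sentence_realize]
    exact Filter.eventually_const
  · refine ⟨⟨fun x => Quotient.mk _ fun i => h i x, ?_⟩, ?_, ?_⟩
    · intro x y hxy
      have h1 : ∀ᶠ i in (U : Filter _), h i x = h i y := Quotient.exact hxy
      obtain ⟨i, h2, h3⟩ := (h1.and (hU (fun i => x ∈ i.1 ∧ y ∈ i.1) ⟨({x, y}, 0), fun i hi =>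
        ⟨hi.1 (by simp), hi.1 (by simp)⟩⟩)).exists
      exact hinj i x h3.1 y h3.2 h2
    · intro l f v
      refine Eq.trans ?_ (Ultraproduct.funMap_cast f fun j i => h i (v j)).symm
      refine Quotient.sound ?_
      obtain ⟨n₀, hn₀⟩ := treeLang.exists_functions_incl f
      refine hU _ ⟨(Finset.univ.image v, n₀), fun i hi => ?_⟩
      obtain ⟨f', rfl⟩ := hn₀ i.2 hi.2 Set.inter_subset_left subset_rfl
      exact hfun i f' v fun j => hi.1 (Finset.mem_image_of_mem v (Finset.mem_univ j))
    · intro l r v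
      refine Iff.trans (Ultraproduct.boundedFormula_realize_cast (u := U) (M := fun _ => GenModel)
        (Relations.boundedFormula r fun i => Term.var (Sum.inl i)) (fun j i => h i (v j)) ![]) ?_
      obtain ⟨n₀, hn₀⟩ := treeLang.exists_relations_incl r
      have h1 := hU (fun i => Structure.RelMap r (fun j => h i (v j)) ↔ Structure.RelMap r v)
        ⟨(Finset.univ.image v, n₀), fun i hi => by
          obtain ⟨r', rfl⟩ := hn₀ i.2 hi.2 Set.inter_subset_left subset_rfl
          exact hrel i r' v fun j => hi.1 (Finset.mem_image_of_mem v (Finset.mem_univ j))⟩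
      exact (Filter.eventually_congr h1).trans Filter.eventually_const

/-! ### Formulas live over finitely many nodes -/

section Descent

variable {S' : Set (List Bool)} {α : Type*}

theorem treeLang.exists_term_incl (t : (treeLang S').Term α) :
    ∃ n₀, ∀ n ≥ n₀, ∀ {S} (h : S ⊆ S'), S' ∩ nodes n ⊆ S → ∃ t' : (treeLang S).Term α,
      (treeLang.incl h).onTerm t' = t := by
  induction t with
  | var i => exact ⟨0, fun _ _ _ _ _ => ⟨Term.var i, rfl⟩⟩
  | @func l f ts ih =>
    choose m hm using ih
    obtain ⟨m₀, hm₀⟩ := treeLang.exists_functions_incl f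
    refine ⟨max m₀ (Finset.univ.sup m), fun n hn S h hS => ?_⟩
    obtain ⟨f', rfl⟩ := hm₀ n (le_of_max_le_left hn) h hS
    choose ts' hts' using fun i => hm i n
      ((Finset.le_sup (Finset.mem_univ i)).trans (le_of_max_le_right hn)) h hS
    exact ⟨Term.func f' ts', congrArg (Term.func _) (funext hts')⟩

theorem treeLang.exists_boundedFormula_incl {k : ℕ} (φ : (treeLang S').BoundedFormula α k) :
    ∃ n₀, ∀ n ≥ n₀, ∀ {S} (h : S ⊆ S'), S' ∩ nodes n ⊆ S →
      ∃ φ' : (treeLang S).BoundedFormula α k, (treeLang.incl h).onBoundedFormula φ' = φ := by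
  induction φ with
  | falsum => exact ⟨0, fun _ _ _ _ _ => ⟨⊥, rfl⟩⟩
  | equal t₁ t₂ =>
    obtain ⟨m₁, h₁⟩ := treeLang.exists_term_incl t₁
    obtain ⟨m₂, h₂⟩ := treeLang.exists_term_incl t₂
    refine ⟨max m₁ m₂, fun n hn S h hS => ?_⟩
    obtain ⟨t₁', rfl⟩ := h₁ n (le_of_max_le_left hn) h hS
    obtain ⟨t₂', rfl⟩ := h₂ n (le_of_max_le_right hn) h hS
    exact ⟨.equal t₁' t₂', rfl⟩
  | rel R ts =>
    choose m hm using fun i => treeLang.exists_term_incl (ts i)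
    obtain ⟨m₀, hm₀⟩ := treeLang.exists_relations_incl R
    refine ⟨max m₀ (Finset.univ.sup m), fun n hn S h hS => ?_⟩
    obtain ⟨R', rfl⟩ := hm₀ n (le_of_max_le_left hn) h hS
    choose ts' hts' using fun i => hm i n
      ((Finset.le_sup (Finset.mem_univ i)).trans (le_of_max_le_right hn)) h hS
    exact ⟨.rel R' ts', congrArg (BoundedFormula.rel _) (funext hts')⟩
  | imp φ ψ ih₁ ih₂ =>
    obtain ⟨m₁, h₁⟩ := ih₁
    obtain ⟨m₂, h₂⟩ := ih₂
    refine ⟨max m₁ m₂, fun n hn S h hS => ?_⟩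
    obtain ⟨φ', rfl⟩ := h₁ n (le_of_max_le_left hn) h hS
    obtain ⟨ψ', rfl⟩ := h₂ n (le_of_max_le_right hn) h hS
    exact ⟨φ'.imp ψ', rfl⟩
  | all φ ih =>
    obtain ⟨m, hm⟩ := ih
    refine ⟨m, fun n hn S h hS => ?_⟩
    obtain ⟨φ', rfl⟩ := hm n hn h hS
    exact ⟨φ'.all, rfl⟩

theorem treeLang.exists_nodes_incl {k : ℕ} (φ : (treeLang Set.univ).BoundedFormula α k) :
    ∃ n, ∃ φ' : (treeLang (nodes n)).BoundedFormula α k,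
      (treeLang.incl (Set.subset_univ (nodes n))).onBoundedFormula φ' = φ := by
  obtain ⟨n, hn⟩ := treeLang.exists_boundedFormula_incl φ
  exact ⟨n, hn n le_rfl (Set.subset_univ _) Set.inter_subset_right⟩

end Descent

section General

variable {L L' : Language}

theorem IsQF.onBoundedFormula (e : L →ᴸ L') {α : Type*} {k : ℕ} {φ : L.BoundedFormula α k}
    (hφ : φ.IsQF) : (e.onBoundedFormula φ).IsQF := by
  induction hφ with
  | falsum => exact .falsum
  | of_isAtomic h =>
    cases h with
    | equal t₁ t₂ => exact (BoundedFormula.IsAtomic.equal _ _).isQF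
    | rel R ts => exact (BoundedFormula.IsAtomic.rel _ _).isQF
  | imp _ _ h₁ h₂ => exact .imp h₁ h₂

/-- The universal closure of a formula. -/
noncomputable def closeAll {k : ℕ} (φ : L.Formula (Fin k)) : L.Sentence :=
  Formula.iAlls (Fin k) (φ.relabel (Sum.inr : Fin k → Empty ⊕ Fin k))

theorem realize_closeAll {k : ℕ} {φ : L.Formula (Fin k)} {M : Type*} [L.Structure M] :
    M ⊨ closeAll φ ↔ ∀ v : Fin k → M, φ.Realize v := by
  refine Formula.realize_iAlls.trans (forall_congr' fun v => ?_)
  rw [Formula.realize_relabel]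
  rfl

end General

/-- Embedding comes from the ultrapower. For completeness over `A`, a formula is equivalent in
`GenModel` to a quantifier-free one; this equivalence is a sentence of the theory, and embeddings of
`A` preserve quantifier-free formulas in both directions. -/
theorem isModelCompletion_completeTheory (n : ℕ) :
    IsModelCompletion (univTheory (nodes n)) ((treeLang (nodes n)).completeTheory GenModel) where
  extends_base φ hφ := Theory.models_sentence_of_mem
    (Theory.realize_sentence_of_mem (univTheory (nodes n)) hφ)
  embeds A := by
    obtain ⟨N, _, _, h1, h2⟩ := exists_embedding (nodes n) A
      ((model_univTheory_iff _ _).1 A.is_model)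
    have : N ⊨ (treeLang (nodes n)).completeTheory GenModel := ⟨fun σ hσ => (h1 σ).2 hσ⟩
    exact ⟨.of _ N, h2⟩
  complete_over := by
    classical
    intro A M N f g φ
    let := (genSystem.isTreeModel (nodes n)).forest
    let e := φ.freeVarFinset.equivFin
    obtain ⟨ψ, hψ, h⟩ := (genModel_rich (nodes n)).exists_isQF subset_rfl
      (φ.restrictFreeVar e : (treeLang (nodes n)).Formula _)
    have key : ∀ (P : Theory.ModelType.{0, 0, 0} ((treeLang (nodes n)).completeTheory GenModel))
        (j : A ↪[treeLang (nodes n)] P), φ.Realize (j : A → P) ↔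
          ψ.Realize fun i => (e.symm i : A) := by
      intro P j
      have h1 : (P : Type) ⊨ closeAll (ψ.iff (φ.restrictFreeVar e :
          (treeLang (nodes n)).Formula _)) := by
        refine Theory.realize_sentence_of_mem ((treeLang (nodes n)).completeTheory GenModel) ?_
        refine realize_closeAll.2 fun v => ?_
        rw [Formula.realize_iff]
        exact h v
      have h2 := realize_closeAll.1 h1 (j ∘ fun i => (e.symm i : A))
      rw [Formula.realize_iff] at h2
      have h3 := hψ.realize_embedding j (v := fun i => (e.symm i : A)) (xs := default)
      rw [Subsingleton.elim (j ∘ default) default] at h3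
      refine Iff.trans ?_ (h2.symm.trans h3)
      exact (BoundedFormula.realize_restrictFreeVar (φ := φ) (f := e) (j : A → P)
        (fun a => by simp)).symm
    rw [key M f, key N g]

/-! ### The union theory -/

section Union

variable {Tn : ∀ n, (treeLang (nodes n)).Theory}

theorem model_of_model_unionTheory (n : ℕ) {M : Type*} [(treeLang Set.univ).Structure M]
    [(treeLang (nodes n)).Structure M] [(treeLang.incl (Set.subset_univ (nodes n))).IsExpansionOn M]
    [M ⊨ unionTheory Tn] : M ⊨ Tn n := by
  rw [← LHom.onTheory_model (treeLang.incl (Set.subset_univ (nodes n)))]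
  exact Theory.Model.mono (T' := unionTheory Tn) inferInstance (Set.subset_iUnion
    (fun n => (treeLang.incl (Set.subset_univ (nodes n))).onTheory (Tn n)) n)

/-- A sentence true in `GenModel` belongs to some `treeLang (nodes n)`, where `Tn n` is equivalent
to the theory of `GenModel` by uniqueness of model completions. -/
theorem realize_of_model_unionTheory
    (hTn : ∀ n, IsModelCompletion (univTheory (nodes n)) (Tn n))
    (M : Type*) [(treeLang Set.univ).Structure M] [Nonempty M]
    [M ⊨ unionTheory Tn] {σ : (treeLang Set.univ).Sentence} (hσ : GenModel ⊨ σ) : M ⊨ σ := by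
  obtain ⟨n, σ', rfl⟩ := treeLang.exists_nodes_incl σ
  let := (treeLang.incl (Set.subset_univ (nodes n))).reduct M
  have := model_of_model_unionTheory (Tn := Tn) n (M := M)
  refine (LHom.realize_onSentence _ (treeLang.incl (Set.subset_univ (nodes n))) σ').2 ?_
  refine ((hTn n).models (isModelCompletion_completeTheory n) ?_).realize_sentence M
  exact (LHom.realize_onSentence _ (treeLang.incl (Set.subset_univ (nodes n))) σ').1 hσ

theorem genModel_unionTheory
    (hTn : ∀ n, IsModelCompletion (univTheory (nodes n)) (Tn n)) : GenModel ⊨ unionTheory Tn := by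
  refine ⟨fun σ hσ => ?_⟩
  obtain ⟨n, hn⟩ := Set.mem_iUnion.1 hσ
  obtain ⟨σ', hσ', rfl⟩ := hn
  rw [LHom.realize_onSentence]
  exact ((isModelCompletion_completeTheory n).models (hTn n) hσ').realize_sentence GenModel

theorem exists_embedding_unionTheory
    (hTn : ∀ n, IsModelCompletion (univTheory (nodes n)) (Tn n))
    (A : Type w) [Nonempty A] [(treeLang Set.univ).Structure A]
    (hA : IsTreeModel Set.univ A) :
    ∃ M : Theory.ModelType.{0, 0, w} (unionTheory Tn), Nonempty (A ↪[treeLang Set.univ] M) := by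
  obtain ⟨N, _, _, h1, h2⟩ := exists_embedding Set.univ A hA
  have := genModel_unionTheory hTn
  have : N ⊨ unionTheory Tn :=
    ⟨fun σ hσ => (h1 σ).2 (Theory.realize_sentence_of_mem (unionTheory Tn) hσ)⟩
  exact ⟨.of _ N, h2⟩

theorem isComplete_unionTheory
    (hTn : ∀ n, IsModelCompletion (univTheory (nodes n)) (Tn n)) : (unionTheory Tn).IsComplete := by
  have := genModel_unionTheory hTn
  refine ⟨Theory.Model.isSatisfiable GenModel, fun σ => ?_⟩
  by_cases h : GenModel ⊨ σ
  · exact Or.inl (Theory.models_sentence_iff.2 fun M => realize_of_model_unionTheory hTn M h)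
  · exact Or.inr (Theory.models_sentence_iff.2 fun M => realize_of_model_unionTheory hTn M
      ((Formula.realize_not).2 h))

theorem exists_isQF_unionTheory
    (hTn : ∀ n, IsModelCompletion (univTheory (nodes n)) (Tn n))
    {k : ℕ} (φ : (treeLang Set.univ).Formula (Fin k)) :
    ∃ n, ∃ ψ : (treeLang (nodes n)).Formula (Fin k), ψ.IsQF ∧
      ∀ (M : Type*) [(treeLang Set.univ).Structure M] [Nonempty M] [M ⊨ unionTheory Tn]
        (v : Fin k → M),
        ((treeLang.incl (Set.subset_univ (nodes n))).onFormula ψ).Realize v ↔ φ.Realize v := by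
  obtain ⟨n, φ', rfl⟩ := treeLang.exists_nodes_incl φ
  let := (genSystem.isTreeModel (nodes n)).forest
  obtain ⟨ψ, hψ, h⟩ := (genModel_rich (nodes n)).exists_isQF subset_rfl φ'
  refine ⟨n, ψ, hψ, fun M _ _ _ v => ?_⟩
  have h1 : M ⊨ closeAll (((treeLang.incl (Set.subset_univ (nodes n))).onFormula ψ).iff
      ((treeLang.incl (Set.subset_univ (nodes n))).onFormula φ')) := by
    refine realize_of_model_unionTheory hTn M (realize_closeAll.2 fun v => ?_)
    rw [Formula.realize_iff, LHom.realize_onFormula, LHom.realize_onFormula]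
    exact h v
  exact Formula.realize_iff.1 (realize_closeAll.1 h1 v)

theorem eliminatesQuantifiers_unionTheory
    (hTn : ∀ n, IsModelCompletion (univTheory (nodes n)) (Tn n)) :
    EliminatesQuantifiers (unionTheory Tn) := by
  intro k φ
  obtain ⟨n, ψ, hψ, h⟩ := exists_isQF_unionTheory hTn φ
  refine ⟨_, IsQF.onBoundedFormula (treeLang.incl (Set.subset_univ (nodes n))) hψ,
    Theory.models_formula_iff.2 fun M v => ?_⟩
  rw [Formula.realize_iff]
  exact (h M v).symm

theorem isDependent_unionTheory
    (hTn : ∀ n, IsModelCompletion (univTheory (nodes n)) (Tn n)) :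
    IsDependent.{w, 0, 0} (unionTheory Tn) := by
  rintro k m φ M ⟨a, b, hab⟩
  obtain ⟨n, ψ, hψ, h⟩ := exists_isQF_unionTheory hTn (φ.relabel finSumFinEquiv)
  let := (treeLang.incl (Set.subset_univ (nodes n))).reduct M
  have := model_of_model_unionTheory (Tn := Tn) n (M := M)
  have := (hTn n).model M
  let := ((model_univTheory_iff (nodes n) M).1 this).forest
  refine not_hasIndependenceProperty_of_isQF (M := M) subset_rfl
    (ψ := ψ.relabel finSumFinEquiv.symm) (hψ.relabel _) ⟨a, b, fun i s => ?_⟩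
  rw [← hab, Formula.realize_relabel,
    ← LHom.realize_onFormula (treeLang.incl (Set.subset_univ (nodes n)))]
  rw [h, Formula.realize_relabel, Function.comp_assoc, Equiv.symm_comp_self, Function.comp_id]

theorem countable_symbols (S : Set (List Bool)) : Countable (treeLang S).Symbols := by
  have h1 : Countable (Σ l, (treeLang S).Functions l) := by
    refine Function.Injective.countable (β := List Bool × Option Bool) (f := fun x => match x with
      | ⟨_, .meet η _⟩ => (η, none)
      | ⟨_, .conn η b _ _⟩ => (η, some b)) ?_
    rintro ⟨_, _ | _⟩ ⟨_, _ | _⟩ h <;> simp_all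
  have h2 : Countable (Σ l, (treeLang S).Relations l) := by
    refine Function.Injective.countable (β := List Bool × Bool) (f := fun x => match x with
      | ⟨_, .pred η _⟩ => (η, false)
      | ⟨_, .lt η _⟩ => (η, true)) ?_
    rintro ⟨_, _ | _⟩ ⟨_, _ | _⟩ h <;> simp_all
  exact inferInstanceAs (Countable (_ ⊕ _))

theorem countable_unionTheory : (unionTheory Tn).Countable := by
  have := countable_symbols Set.univ
  exact Set.to_countable _

end Union

open TreeSystem

/-- A reason for which a sequence in the tree at `η` is not indiscernible. -/
inductive Bad (X : TreeSystem.{w}) {I : Type*} [LinearOrder I] :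
    ∀ η : List Bool, (I → X.X η) → Prop
  | order {η : List Bool} {a : I → X.X η} (s t : Fin 3 → I) (hs : StrictMono s) (ht : StrictMono t)
      (p q r u : Fin 3) (h : a (s p) ⊓ a (s q) ≤ a (s r) ⊓ a (s u))
      (h' : ¬ a (t p) ⊓ a (t q) ≤ a (t r) ⊓ a (t u)) : Bad X η a
  | conn {η : List Bool} {a : I → X.X η} (b : Bool) (h : Bad X (η ++ [b]) fun i => X.g η b (a i)) :
      Bad X η a
  | meet {η : List Bool} {a c : I → X.X η} (hc : ∀ i j, i < j → c i = a i ⊓ a j)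
      (h : Bad X η c) : Bad X η a

/-! ### Bad sequences are not indiscernible -/

section Indiscernible

variable {L : Language} {I : Type*} [LinearOrder I] [NoMaxOrder I] {ι : Type*} {M : Type*}
  [L.Structure M]

/-- A sequence obtained by applying a term to consecutive elements of an indiscernible sequence. -/
theorem IsIndiscernible.term {a c : I → ι → M} (ha : IsIndiscernible L a)
    (τ : ι → L.Term (Fin 2 × ι))
    (hc : ∀ i j, i < j → ∀ z, c i z = (τ z).realize fun p => ![a i, a j] p.1 p.2) :
    IsIndiscernible L c := by
  rintro (_ | k) s t hs ht φ
  · rw [Subsingleton.elim s t]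
  -- One larger index is appended, so that the last `c (s l)` also has a next element with which to
  -- be computed.
  have hext : ∀ s : Fin (k + 1) → I, StrictMono s → ∃ s' : Fin (k + 2) → I, StrictMono s' ∧
      ∀ l, c (s l) = fun z => (τ z).realize fun p =>
        ![a (s' l.castSucc), a (s' l.succ)] p.1 p.2 := by
    intro s hs
    obtain ⟨m, hm⟩ := exists_gt (s (Fin.last k))
    have hmono : StrictMono (Fin.snoc (α := fun _ => I) s m) := by
      rw [Fin.strictMono_iff_lt_succ]
      intro i
      rw [Fin.snoc_castSucc]
      rcases Fin.eq_castSucc_or_eq_last i with ⟨j, rfl⟩ | rfl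
      · rw [Fin.succ_castSucc, Fin.snoc_castSucc]
        exact hs (Fin.castSucc_lt_succ)
      · rw [Fin.succ_last, Fin.snoc_last]
        exact hm
    refine ⟨_, hmono, fun l => funext fun z => ?_⟩
    have := hc _ _ (hmono (Fin.castSucc_lt_succ (i := l))) z
    rwa [Fin.snoc_castSucc] at this ⊢
  obtain ⟨s', hs', h1⟩ := hext s hs
  obtain ⟨t', ht', h2⟩ := hext t ht
  have key := ha (k + 2) s' t' hs' ht' (BoundedFormula.subst φ fun p : Fin (k + 1) × ι =>
    (τ p.2).relabel fun q : Fin 2 × ι => (![p.1.castSucc, p.1.succ] q.1, q.2))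
  have e : ∀ s' : Fin (k + 2) → I, ∀ s : Fin (k + 1) → I,
      (∀ l, c (s l) = fun z => (τ z).realize fun p => ![a (s' l.castSucc), a (s' l.succ)] p.1 p.2) →
      (Formula.Realize (BoundedFormula.subst φ fun p : Fin (k + 1) × ι =>
        (τ p.2).relabel fun q : Fin 2 × ι => (![p.1.castSucc, p.1.succ] q.1, q.2) : L.Formula _)
        (fun p => a (s' p.1) p.2) ↔ φ.Realize fun p => c (s p.1) p.2) := by
    intro s' s h
    refine BoundedFormula.realize_subst.trans (iff_of_eq (congrArg
      (fun v => BoundedFormula.Realize φ v _)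
      (funext fun p => ?_)))
    rw [h, Term.realize_relabel]
    congr 1
    funext q
    obtain ⟨q, z⟩ := q
    fin_cases q <;> rfl
  exact (e s' s h1).symm.trans (key.trans (e t' t h2))

end Indiscernible

section Embedding

variable {X : TreeSystem.{w}} {M : Type*} [(treeLang Set.univ).Structure M]
  (f : X.Carrier ↪[treeLang Set.univ] M)

theorem map_sMeet (η : List Bool) (x y : X.X η) :
    sMeet η (Set.mem_univ η) (f (pt η x)) (f (pt η y)) = f (pt η (x ⊓ y)) := by
  rw [← sMeet_pt (Set.mem_univ η)]
  refine Eq.trans ?_ (f.map_fun _ _).symm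
  exact (funMap_meet η (Set.mem_univ η) (f ∘ ![pt η x, pt η y])).symm

theorem map_sConn (η : List Bool) (b : Bool) (x : X.X η) :
    sConn η b (Set.mem_univ η) (Set.mem_univ (η ++ [b])) (f (pt η x)) =
      f (pt (η ++ [b]) (X.g η b x)) := by
  rw [← sConn_pt (Set.mem_univ η) (Set.mem_univ (η ++ [b]))]
  refine Eq.trans ?_ (f.map_fun _ _).symm
  exact (funMap_conn η b (Set.mem_univ η) (Set.mem_univ (η ++ [b])) (f ∘ ![pt η x])).symm

theorem sLt_map (η : List Bool) (x y : X.X η) :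
    sLt η (Set.mem_univ η) (f (pt η x)) (f (pt η y)) ↔ x < y := by
  rw [← sLt_pt (Set.mem_univ η)]
  exact (iff_of_eq (relMap_lt η (Set.mem_univ η) (f ∘ ![pt η x, pt η y])).symm).trans
    (f.map_rel _ _)

/-- Each constructor of `Bad` is a failure visible to formulas: an inequality between meets that
changes with the triple, or a sequence obtained by a term whose badness descends by
`IsIndiscernible.term`. Constant tuples reduce any `ι` to one variable. -/
theorem Bad.not_isIndiscernible {I : Type*} [LinearOrder I] [NoMaxOrder I] {ι : Type*} [Nonempty ι]
    {η : List Bool} {a : I → X.X η} (h : Bad X η a) :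
    ¬ IsIndiscernible (treeLang Set.univ) fun i (_ : ι) => f (pt η (a i)) := by
  induction h with
  | @order η a s t hs ht p q r u h h' =>
    intro hi
    let z : ι := Classical.arbitrary ι
    let m : Fin 3 → Fin 3 → (treeLang Set.univ).Term (Fin 3 × ι) := fun p q =>
      Functions.apply₂ (L := treeLang Set.univ) (TreeFunc.meet η (Set.mem_univ η))
        (Term.var (p, z)) (Term.var (q, z))
    have hm : ∀ (s : Fin 3 → I) p q, (m p q).realize (fun p => f (pt η (a (s p.1)))) =
        f (pt η (a (s p) ⊓ a (s q))) := fun s p q =>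
      Term.realize_functions_apply₂.trans (map_sMeet f η (a (s p)) (a (s q)))
    have e : ∀ s : Fin 3 → I, ((Relations.formula₂ (L := treeLang Set.univ)
        (TreeRel.lt η (Set.mem_univ η)) (m p q) (m r u)) ⊔ Term.equal (m p q) (m r u) :
          (treeLang Set.univ).Formula (Fin 3 × ι)).Realize (fun p => f (pt η (a (s p.1)))) ↔
        a (s p) ⊓ a (s q) ≤ a (s r) ⊓ a (s u) := by
      intro s
      rw [Formula.realize_sup, realize_formula₂_lt, Formula.realize_equal, hm, hm, sLt_map,
        f.injective.eq_iff, pt_inj, le_iff_lt_or_eq]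
    exact h' ((e t).1 ((hi 3 s t hs ht _).1 ((e s).2 h)))
  | @conn η a b h ih =>
    refine fun hi => ih (hi.term (fun z => Functions.apply₁ (L := treeLang Set.univ)
      (TreeFunc.conn η b (Set.mem_univ η) (Set.mem_univ _)) (Term.var (0, z))) fun i j _ z => ?_)
    exact ((Term.realize_functions_apply₁).trans (map_sConn f η b (a i))).symm
  | @meet η a c hc h ih =>
    refine fun hi => ih (hi.term (fun z => Functions.apply₂ (L := treeLang Set.univ)
      (TreeFunc.meet η (Set.mem_univ η)) (Term.var (0, z)) (Term.var (1, z))) fun i j hij z => ?_)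
    rw [hc i j hij]
    exact ((Term.realize_functions_apply₂).trans (map_sMeet f η (a i) (a j))).symm

end Embedding

/-! ### Combining tree systems -/

namespace TreeSystem

/-- Put a tree with meets below two tree systems. -/
def cons (X₀ : Type w) [inst : SemilatticeInf X₀]
    (h₀ : ∀ {x y z : X₀}, x ≤ z → y ≤ z → x ≤ y ∨ y ≤ x) (Y : Bool → TreeSystem.{w})
    (g₀ : ∀ b, X₀ → (Y b).X []) : TreeSystem.{w} where
  X η := match η with
    | [] => X₀
    | b :: η => (Y b).X η
  inf η := match η with
    | [] => inst
    | b :: η => (Y b).inf η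
  le_or_le {η} := match η with
    | [] => h₀
    | b :: _ => (Y b).le_or_le
  g η b := match η with
    | [] => g₀ b
    | c :: η => (Y c).g η b

/-- The system all of whose trees are the same linear order. -/
def const (X₀ : Type w) [LinearOrder X₀] (g : List Bool → X₀ → X₀) : TreeSystem.{w} where
  X _ := X₀
  le_or_le {_ x y _} _ _ := le_total x y
  g η _ := g η

/-- The disjoint union of systems, with a new root in each tree. -/
inductive SumTree {ι : Type w} (Y : ι → TreeSystem.{w}) (η : List Bool) : Type w
  | root : SumTree Y η
  | node (i : ι) (x : (Y i).X η) : SumTree Y η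

namespace SumTree

variable {ι : Type w} {Y : ι → TreeSystem.{w}} {η : List Bool}

instance : PartialOrder (SumTree Y η) where
  le x y := x = root ∨ ∃ i u v, x = node i u ∧ y = node i v ∧ u ≤ v
  le_refl x := by
    cases x with
    | root => exact Or.inl rfl
    | node i x => exact Or.inr ⟨i, x, x, rfl, rfl, le_rfl⟩
  le_trans := by
    rintro x y z (rfl | ⟨i, u, v, rfl, rfl, h⟩) h'
    · exact Or.inl rfl
    · rcases h' with h' | ⟨j, u', v', h1, rfl, h2⟩
      · cases h'
      · cases h1
        exact Or.inr ⟨i, u, v', rfl, rfl, h.trans h2⟩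
  le_antisymm := by
    rintro x y (rfl | ⟨i, u, v, rfl, rfl, h⟩) h'
    · rcases h' with h' | ⟨j, u', v', -, h1, -⟩
      · exact h'.symm
      · cases h1
    · rcases h' with h' | ⟨j, u', v', h1, h2, h3⟩
      · cases h'
      · cases h1
        cases h2
        rw [le_antisymm h h3]

theorem root_le (x : SumTree Y η) : root ≤ x := Or.inl rfl

theorem node_le_node {i : ι} {u v : (Y i).X η} : node i u ≤ node i v ↔ u ≤ v := by
  constructor
  · rintro (h | ⟨j, u', v', h1, h2, h3⟩)
    · cases h
    · cases h1
      cases h2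
      exact h3
  · exact fun h => Or.inr ⟨i, u, v, rfl, rfl, h⟩

open Classical in
/-- The meet. -/
noncomputable def meet : SumTree Y η → SumTree Y η → SumTree Y η
  | node i u, node j v => if h : i = j then node j ((h ▸ u) ⊓ v) else root
  | _, _ => root

theorem meet_node {i : ι} {u v : (Y i).X η} : meet (node i u) (node i v) = node i (u ⊓ v) :=
  dif_pos rfl

theorem meet_ne {i j : ι} {u : (Y i).X η} {v : (Y j).X η} (h : i ≠ j) :
    meet (node i u) (node j v) = root :=
  dif_neg h

noncomputable instance : SemilatticeInf (SumTree Y η) where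
  inf := meet
  inf_le_left := by
    rintro (_ | ⟨i, u⟩) (_ | ⟨j, v⟩)
    · exact root_le _
    · exact root_le _
    · exact root_le _
    · by_cases h : i = j
      · subst h
        exact (meet_node).le.trans (node_le_node.2 inf_le_left)
      · exact (meet_ne h).le.trans (root_le _)
  inf_le_right := by
    rintro (_ | ⟨i, u⟩) (_ | ⟨j, v⟩)
    · exact root_le _
    · exact root_le _
    · exact root_le _
    · by_cases h : i = j
      · subst h
        exact (meet_node).le.trans (node_le_node.2 inf_le_right)
      · exact (meet_ne h).le.trans (root_le _)
  le_inf := by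
    rintro x y z (rfl | ⟨i, u, v, rfl, rfl, h⟩) h'
    · exact root_le _
    · rcases h' with h' | ⟨j, u', v', h1, rfl, h2⟩
      · cases h'
      · cases h1
        exact (node_le_node.2 (le_inf h h2)).trans meet_node.ge

theorem node_inf_node {i : ι} {u v : (Y i).X η} : node i u ⊓ node i v = node i (u ⊓ v) :=
  meet_node

theorem le_or_le {x y z : SumTree Y η} (h : x ≤ z) (h' : y ≤ z) : x ≤ y ∨ y ≤ x := by
  rcases h with rfl | ⟨i, u, v, rfl, rfl, h⟩
  · exact Or.inl (root_le _)
  · rcases h' with rfl | ⟨j, u', v', rfl, h1, h2⟩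
    · exact Or.inr (root_le _)
    · cases h1
      simp only [node_le_node]
      exact (Y i).le_or_le h h2

end SumTree

/-- The disjoint union of systems, with a new root in each tree. -/
noncomputable def sum {ι : Type w} (Y : ι → TreeSystem.{w}) : TreeSystem.{w} where
  X η := SumTree Y η
  le_or_le := SumTree.le_or_le
  g η b
    | .root => .root
    | .node i x => .node i ((Y i).g η b x)

end TreeSystem

section Transfer

variable {I : Type*} [LinearOrder I]

theorem Bad.cons {X₀ : Type w} [SemilatticeInf X₀]
    (h₀ : ∀ {x y z : X₀}, x ≤ z → y ≤ z → x ≤ y ∨ y ≤ x) {Y : Bool → TreeSystem.{w}}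
    (g₀ : ∀ b, X₀ → (Y b).X []) {b : Bool} {η : List Bool} {a : I → (Y b).X η} (h : Bad (Y b) η a) :
    Bad (TreeSystem.cons X₀ h₀ Y g₀) (b :: η) a := by
  induction h with
  | order s t hs ht p q r u h h' => exact .order s t hs ht p q r u h h'
  | conn c h ih => exact .conn c ih
  | meet hc h ih => exact .meet hc ih

theorem Bad.sum {ι : Type w} {Y : ι → TreeSystem.{w}} {i : ι} {η : List Bool} {a : I → (Y i).X η}
    (h : Bad (Y i) η a) : Bad (TreeSystem.sum Y) η fun j => SumTree.node i (a j) := by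
  induction h with
  | @order η a s t hs ht p q r u h h' =>
    have e : ∀ (x y z w : (Y i).X η), SumTree.node i x ⊓ SumTree.node i y ≤
        SumTree.node (Y := Y) i z ⊓ SumTree.node i w ↔ x ⊓ y ≤ z ⊓ w := by
      intro x y z w
      rw [SumTree.node_inf_node, SumTree.node_inf_node, SumTree.node_le_node]
    exact .order s t hs ht p q r u ((e _ _ _ _).2 h) fun h'' => h' ((e _ _ _ _).1 h'')
  | conn c h ih => exact .conn c ih
  | @meet η a c hc h ih =>
    exact .meet (fun j k hjk => (congrArg (SumTree.node i) (hc j k hjk)).trans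
      SumTree.node_inf_node.symm) ih

variable [NoMaxOrder I] {X : TreeSystem.{w}} {η : List Bool} {a : I → X.X η}

theorem exists_strictMono_fin_three {i j : I} (h : i < j) :
    ∃ s : Fin 3 → I, StrictMono s ∧ s 0 = i ∧ s 1 = j := by
  obtain ⟨k, hk⟩ := exists_gt j
  refine ⟨![i, j, k], ?_, rfl, rfl⟩
  rw [Fin.strictMono_iff_lt_succ]
  intro l
  fin_cases l
  · exact h
  · exact hk

/-- One increasing pair of indices carries equal values and another distinct ones, so `≤` in one of
the two directions tells them apart. -/
theorem Bad.of_not_injective (h : ¬ Function.Injective a) (h' : ∃ i j, a i ≠ a j) : Bad X η a := by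
  obtain ⟨i, j, hij, hne⟩ : ∃ i j, a i = a j ∧ i < j := by
    simp only [Function.Injective, not_forall] at h
    obtain ⟨i, j, h1, h2⟩ := h
    rcases lt_or_gt_of_ne h2 with h2 | h2
    · exact ⟨i, j, h1, h2⟩
    · exact ⟨j, i, h1.symm, h2⟩
  obtain ⟨k, l, hkl, hne'⟩ : ∃ k l, a k ≠ a l ∧ k < l := by
    obtain ⟨k, l, h1⟩ := h'
    rcases lt_or_gt_of_ne (fun h => h1 (congrArg a h) : k ≠ l) with h2 | h2
    · exact ⟨k, l, h1, h2⟩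
    · exact ⟨l, k, h1.symm, h2⟩
  obtain ⟨s, hs, rfl, rfl⟩ := exists_strictMono_fin_three hne
  obtain ⟨t, ht, rfl, rfl⟩ := exists_strictMono_fin_three hne'
  by_cases hle : a (t 0) ≤ a (t 1)
  · refine .order s t hs ht 1 1 0 0 ?_ ?_
    · rw [hij]
    · rw [inf_idem, inf_idem]
      exact fun h => hkl (le_antisymm hle h)
  · refine .order s t hs ht 0 0 1 1 ?_ ?_
    · rw [hij]
    · rwa [inf_idem, inf_idem]

end Transfer

/-- The elements of `A` can be put in a tree system so that no sequence in `A` indexed by `I` is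
indiscernible. -/
def Spoiled (I : Type*) [LinearOrder I] (A : Type w) : Prop :=
  ∃ (X : TreeSystem.{w}) (e : A → X.X []), Function.Injective e ∧
    ∀ a : I → A, (∃ i j, a i ≠ a j) → Bad X [] fun i => e (a i)

/-! ### Spoiled sets: small, countable and singular cases -/

section Spoiled

variable {I : Type*} [LinearOrder I] {A B : Type w}

theorem Spoiled.of_injective (h : Spoiled I B) {f : A → B} (hf : Function.Injective f) :
    Spoiled I A := by
  obtain ⟨X, e, he, h⟩ := h
  exact ⟨X, e ∘ f, he.comp hf, fun a ⟨i, j, hij⟩ => h (f ∘ a) ⟨i, j, fun h => hij (hf h)⟩⟩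

theorem Spoiled.of_not_injective [NoMaxOrder I] (h : ∀ a : I → A, ¬ Function.Injective a) :
    Spoiled I A := by
  classical
  let := linearOrderOfSTO (WellOrderingRel (α := A))
  exact ⟨.const A fun _ => id, id, Function.injective_id, fun a ha => .of_not_injective (h a) ha⟩

/-- The step through a singular cardinal. -/
theorem Spoiled.of_fibers {ι : Type w} (hι : Spoiled I ι) (idx : A → ι)
    (h : ∀ i, Spoiled I {x // idx x = i}) : Spoiled I A := by
  classical
  obtain ⟨Y, e, he, hY⟩ := hι
  choose Z e' he' hZ using h
  let := linearOrderOfSTO (WellOrderingRel (α := A))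
  -- The `false` map sends a point to the index of its fiber, the `true` map to its place in the
  -- disjoint union of the systems for the fibers.
  let Y' : Bool → TreeSystem.{w} := fun b => match b with
    | false => Y
    | true => .sum Z
  let g₀ : ∀ b, A → (Y' b).X [] := fun b => match b with
    | false => fun x => e (idx x)
    | true => fun x => SumTree.node (idx x) (e' (idx x) ⟨x, rfl⟩)
  refine ⟨.cons A (fun {x y _} _ _ => le_total x y) Y' g₀, id, Function.injective_id,
    fun a ha => ?_⟩
  -- If the indices vary, the sequence of indices is bad; otherwise the whole sequence lies in one
  -- fiber and is bad there.
  by_cases hc : ∃ i j, idx (a i) ≠ idx (a j)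
  · exact .conn false (Bad.cons (b := false) _ g₀ (hY (fun i => idx (a i)) hc))
  · push Not at hc
    obtain ⟨i, j, hij⟩ := ha
    have hi : ∀ k, idx (a k) = idx (a i) := fun k => hc k i
    refine .conn true (Bad.cons (b := true) _ g₀ ?_)
    have h1 := (hZ (idx (a i)) (fun k => ⟨a k, hi k⟩)
      ⟨i, j, fun h => hij (congrArg Subtype.val h)⟩).sum
    have : ∀ (l : ι) (x : A) (hx : idx x = l), (SumTree.node (idx x) (e' (idx x) ⟨x, rfl⟩) :
        SumTree Z []) = SumTree.node l (e' l ⟨x, hx⟩) := by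
      rintro l x rfl
      rfl
    rwa [← funext fun k => this _ _ (hi k)] at h1

variable [NoMaxOrder I] [Nonempty I]

theorem exists_lt_lt_of_injective {α : Type*} [LinearOrder α] {a : I → α}
    (h : Function.Injective a) : ∃ i j k, a i < a j ∧ a j < a k := by
  obtain ⟨i, hi⟩ : ∃ i : I, True := ⟨Classical.arbitrary I, trivial⟩
  obtain ⟨j, hj⟩ := exists_gt i
  obtain ⟨k, hk⟩ := exists_gt j
  have h1 := h.ne hj.ne
  have h2 := h.ne hk.ne
  have h3 := h.ne (hj.trans hk).ne
  rcases lt_or_gt_of_ne h1 with h1 | h1 <;> rcases lt_or_gt_of_ne h2 with h2 | h2 <;>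
    rcases lt_or_gt_of_ne h3 with h3 | h3
  · exact ⟨_, _, _, h1, h2⟩
  · exact ⟨_, _, _, h1, h2⟩
  · exact ⟨_, _, _, h3, h2⟩
  · exact ⟨_, _, _, h3, h1⟩
  · exact ⟨_, _, _, h1, h3⟩
  · exact ⟨_, _, _, h2, h3⟩
  · exact ⟨_, _, _, h2, h1⟩
  · exact ⟨_, _, _, h2, h1⟩

/-- Nothing infinite and countable stays indiscernible if longer and longer initial segments of `ℕ`
are collapsed. -/
theorem spoiled_nat : Spoiled I (ULift.{w} ℕ) := by
  -- The values `a i < a j < a k` need not follow the order of the indices. Going down the tree one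
  -- node at a time, the level reaches `a j`.
  let X : TreeSystem.{w} := .const (ULift.{w} ℕ) fun η x => max x ⟨η.length + 1⟩
  have key : ∀ (d : ℕ) (η : List Bool) (a : I → ULift.{w} ℕ) (i j k : I), a i < a j → a j < a k →
      ⟨η.length⟩ < a j → (a j).down ≤ d + η.length → Bad X η a := by
    intro d
    induction d with
    | zero =>
      intro η a i j k _ _ h1 h2
      have h1 : η.length < (a j).down := h1
      omega
    | succ d ih =>
      intro η a i j k hij hjk h1 h2
      refine .conn false ?_
      have hg : ∀ i, X.g η false (a i) = max (a i) ⟨η.length + 1⟩ := fun _ => rfl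
      simp only [hg]
      have h1 : η.length + 1 ≤ (a j).down := h1
      have hjk' : (a j).down < (a k).down := hjk
      have hij' : (a i).down < (a j).down := hij
      have hk : max (a k) ⟨η.length + 1⟩ = a k :=
        max_eq_left (show η.length + 1 ≤ (a k).down by omega)
      have hj : max (a j) ⟨η.length + 1⟩ = a j := max_eq_left h1
      -- At this level the next map glues `a i` to `a j` and keeps `a k` apart: the image is neither
      -- injective nor constant.
      by_cases heq : (a j).down = η.length + 1
      · refine .of_not_injective (X := X) (fun h => ?_) ⟨j, k, ?_⟩
        · have hi : max (a i) ⟨η.length + 1⟩ = ⟨η.length + 1⟩ :=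
            max_eq_right (show (a i).down ≤ η.length + 1 by omega)
          have := @h i j (by
            simp only [hi, hj]
            exact ULift.ext _ _ heq.symm)
          rw [this] at hij
          exact lt_irrefl _ hij
        · simp only [hj, hk]
          exact hjk.ne
      · refine ih (η ++ [false]) _ i j k ?_ ?_ ?_ ?_
        · simp only [hj]
          exact max_lt hij (show η.length + 1 < (a j).down by omega)
        · simp only [hj, hk]
          exact hjk
        · simp only [hj]
          show (η ++ [false]).length < (a j).down
          rw [List.length_append, List.length_singleton]
          omega
        · simp only [hj]
          rw [List.length_append, List.length_singleton]
          omega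
  refine ⟨X, id, Function.injective_id, fun a ha => ?_⟩
  by_cases hinj : Function.Injective a
  · obtain ⟨i, j, k, h1, h2⟩ := exists_lt_lt_of_injective hinj
    have h1' : (a i).down < (a j).down := h1
    exact key (a j).down [] a i j k h1 h2 (show 0 < (a j).down by omega) (by simp)
  · exact .of_not_injective hinj ha

end Spoiled

instance {Λ : Type w} [LinearOrder Λ] [WellFoundedLT Λ] :
    SupportClass fun _ : Set Λ => True where
  mono _ _ _ _ := trivial
  exists_least _ _ _ _ u _ hu := ⟨WellFounded.min wellFounded_lt u hu,
    WellFounded.min_mem wellFounded_lt u hu, fun _ hx => WellFounded.min_le wellFounded_lt hx⟩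

theorem Trunc.f_inf_q_ne {Λ : Type w} [LinearOrder Λ] {K : Type} [Zero K] {C : Set Λ → Prop}
    [SupportClass C] {x y : Trunc Λ K C} (hq : x.q = y.q) (hne : x ≠ y) :
    x.f (x ⊓ y).q ≠ y.f (x ⊓ y).q := by
  obtain ⟨-, -, h1, h2⟩ := (exists_split x y).choose_spec
  rcases h2 with h2 | h2
  · refine absurd (le_antisymm (Trunc.le_def.2 ⟨hq.le, fun t ht => ?_⟩)
      (Trunc.le_def.2 ⟨hq.ge, fun t ht => ?_⟩)) hne
    · exact h1 t (ht.trans_le (h2.elim (fun h => h.ge) fun h => hq.le.trans h.ge))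
    · exact (h1 t (ht.trans_le (h2.elim (fun h => hq.ge.trans h.ge) fun h => h.ge))).symm
  · exact h2

/-- The full binary tree of the functions from initial segments of `Λ` to `{0, 1}`. -/
abbrev BinTree (Λ : Type w) [LinearOrder Λ] : Type w := Trunc Λ (Fin 2) fun _ => True

/-- At a common splitting place the three branches would take three distinct values in `Fin 2`. -/
theorem BinTree.not_ternary {Λ : Type w} [LinearOrder Λ] [WellFoundedLT Λ] {x y z : BinTree Λ}
    (hxy : x.q = y.q) (hxz : x.q = z.q) (h₁ : x ≠ y) (h₂ : x ≠ z) (h₃ : y ≠ z)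
    (h : x ⊓ y = x ⊓ z) : x ⊓ y ≠ y ⊓ z := by
  intro h'
  have e1 := Trunc.f_inf_q_ne hxy h₁
  have e2 := Trunc.f_inf_q_ne hxz h₂
  have e3 := Trunc.f_inf_q_ne (hxy.symm.trans hxz) h₃
  rw [← h] at e2
  rw [← h'] at e3
  omega

/-- Both `x ⊓ z` and `y ⊓ z` lie below `z`, hence are comparable. If `x ⊓ z ≤ y ⊓ z`, then `x ⊓ z`
would be below `x ⊓ y`. -/
theorem inf_eq_of_inf_lt_inf {T : Type*} [SemilatticeInf T]
    (hT : ∀ {x y z : T}, x ≤ z → y ≤ z → x ≤ y ∨ y ≤ x) {x y z : T} (h : x ⊓ y < x ⊓ z) :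
    y ⊓ z = x ⊓ y := by
  refine le_antisymm (le_inf ?_ inf_le_left) (le_inf inf_le_right (h.le.trans inf_le_right))
  rcases hT (inf_le_right : x ⊓ z ≤ z) (inf_le_right : y ⊓ z ≤ z) with h1 | h1
  · exact absurd (le_inf inf_le_left (h1.trans inf_le_left)) h.not_ge
  · exact h1.trans inf_le_left

/-! ### The power set case -/

section Power

variable {I : Type*} [LinearOrder I] [NoMaxOrder I] [Nonempty I]

/-- An injective homogeneous sequence of branches of a binary tree is a comb. -/
theorem BinTree.exists_comb {Λ : Type w} [LinearOrder Λ] [WellFoundedLT Λ] {a : I → BinTree Λ}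
    (ha : Function.Injective a) (hq : ∀ i j, (a i).q = (a j).q)
    (H : ∀ s t : Fin 3 → I, StrictMono s → StrictMono t → ∀ p q r u : Fin 3,
      a (s p) ⊓ a (s q) ≤ a (s r) ⊓ a (s u) → a (t p) ⊓ a (t q) ≤ a (t r) ⊓ a (t u)) :
    ∃ c : I → BinTree Λ, (∀ i j, i < j → c i = a i ⊓ a j) ∧ StrictMono c := by
  have hmono : ∀ {i j k : I}, i < j → j < k → StrictMono ![i, j, k] := by
    intro i j k hij hjk
    rw [Fin.strictMono_iff_lt_succ]
    intro l
    fin_cases l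
    · exact hij
    · exact hjk
  have H₁ : ∀ {i j k i' j' k' : I}, i < j → j < k → i' < j' → j' < k' →
      a i ⊓ a j ≤ a i ⊓ a k → a i' ⊓ a j' ≤ a i' ⊓ a k' := fun h1 h2 h3 h4 h =>
    H _ _ (hmono h1 h2) (hmono h3 h4) 0 1 0 2 h
  have H₂ : ∀ {i j k i' j' k' : I}, i < j → j < k → i' < j' → j' < k' →
      a i ⊓ a k ≤ a i ⊓ a j → a i' ⊓ a k' ≤ a i' ⊓ a j' := fun h1 h2 h3 h4 h =>
    H _ _ (hmono h1 h2) (hmono h3 h4) 0 2 0 1 h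
  obtain ⟨e, he⟩ := Nat.exists_strictMono I
  have he0 := fun n => he (Nat.lt_add_one n)
  by_cases h₁ : a (e 0) ⊓ a (e 1) ≤ a (e 0) ⊓ a (e 2)
  · by_cases h₂ : a (e 0) ⊓ a (e 2) ≤ a (e 0) ⊓ a (e 1)
    -- Here `a i ⊓ a j` depends on `i` only. These meets increase with `i`, strictly because the
    -- branching is binary.
    · have heq : ∀ {i j k : I}, i < j → j < k → a i ⊓ a j = a i ⊓ a k := fun hij hjk =>
        le_antisymm (H₁ (he0 0) (he0 1) hij hjk h₁) (H₂ (he0 0) (he0 1) hij hjk h₂)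
      choose next hnext using fun i : I => exists_gt i
      have hc : ∀ i j, i < j → a i ⊓ a (next i) = a i ⊓ a j := by
        intro i j hij
        rcases lt_trichotomy (next i) j with h | h | h
        · exact heq (hnext i) h
        · rw [h]
        · exact (heq hij h).symm
      refine ⟨fun i => a i ⊓ a (next i), hc, fun i j hij => ?_⟩
      have h3 := hij.trans (hnext j)
      refine lt_of_le_of_ne (le_inf ?_ ?_) ?_
      · exact (hc i j hij).le.trans inf_le_right
      · exact (hc i _ h3).le.trans inf_le_right
      · intro h
        refine BinTree.not_ternary (hq i j) (hq i (next j)) (ha.ne hij.ne) (ha.ne h3.ne)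
          (ha.ne (hnext j).ne) (heq hij (hnext j)) ?_
        rw [← hc i j hij]
        exact h
    -- Strictly growing meets are impossible in any tree: four indices would give `a 1 ⊓ a 2` and `a
    -- 1 ⊓ a 3` both equal to `a 0 ⊓ a 1`.
    · have hlt : ∀ {i j k : I}, i < j → j < k → a i ⊓ a j < a i ⊓ a k := fun hij hjk =>
        lt_of_le_not_ge (H₁ (he0 0) (he0 1) hij hjk h₁) fun h => h₂ (H₂ hij hjk (he0 0) (he0 1) h)
      have h3 := inf_eq_of_inf_lt_inf Trunc.le_or_le (hlt (he0 0) (he0 1))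
      have h4 := inf_eq_of_inf_lt_inf Trunc.le_or_le (hlt (he0 0) ((he0 1).trans (he0 2)))
      have h5 := hlt (he0 1) (he0 2)
      simp only [zero_add, Nat.reduceAdd] at h3 h4 h5
      rw [h3, h4] at h5
      exact absurd h5 (lt_irrefl _)
  -- In the remaining case consecutive meets decrease, and their lengths would descend forever in
  -- the well-order `Λ`.
  · have hlt : ∀ {i j k : I}, i < j → j < k → a j ⊓ a k < a i ⊓ a j := by
      intro i j k hij hjk
      have h2 : ¬ a i ⊓ a j ≤ a i ⊓ a k := fun h => h₁ (H₁ hij hjk (he0 0) (he0 1) h)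
      have h3 : a i ⊓ a k < a i ⊓ a j := by
        rcases Trunc.le_or_le (inf_le_left : a i ⊓ a j ≤ a i) (inf_le_left : a i ⊓ a k ≤ a i) with
          h | h
        · exact absurd h h2
        · exact lt_of_le_not_ge h h2
      have h4 := inf_eq_of_inf_lt_inf Trunc.le_or_le h3
      rw [inf_comm, h4]
      exact h3
    obtain ⟨n, hn⟩ := WellFounded.not_rel_apply_succ (r := fun x y : Λ => x < y)
      fun n => (a (e n) ⊓ a (e (n + 1))).q
    exact absurd (Trunc.q_lt_of_lt (hlt (he0 n) (he0 (n + 1)))) hn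

/-- The step through a power set. -/
theorem Spoiled.power {Λ : Type w} [LinearOrder Λ] [WellFoundedLT Λ]
    (hΛ : Spoiled I (WithTop Λ)) : Spoiled I (Λ → Fin 2) := by
  obtain ⟨Y, e, he, hY⟩ := hΛ
  -- A point of the binary tree is sent to its length. The top of `WithTop Λ` serves as the length
  -- of the full branches.
  let g₀ : ∀ _ : Bool, BinTree (WithTop Λ) → Y.X [] := fun _ x => e x.q
  let branch : (Λ → Fin 2) → BinTree (WithTop Λ) := fun x =>
    ⟨⊤, fun t => t.recTopCoe 0 x, fun t ht => by rw [top_le_iff.1 ht]; rfl, trivial⟩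
  have hinj : Function.Injective branch := fun x y h =>
    funext fun t => congrFun (congrArg Trunc.f h) (t : WithTop Λ)
  refine ⟨.cons (BinTree (WithTop Λ)) Trunc.le_or_le (fun _ => Y) g₀, branch, hinj, fun a ha => ?_⟩
  by_contra hbad
  have ha' : Function.Injective a := by
    by_contra hn
    exact hbad (.of_not_injective (fun h => hn fun i j hij => h (congrArg branch hij))
      (ha.imp fun i h => h.imp fun j hij => hinj.ne hij))
  obtain ⟨c, hc, hmono⟩ := BinTree.exists_comb (a := fun i => branch (a i)) (hinj.comp ha')
    (fun _ _ => rfl) fun s t hs ht p q r u h => by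
      by_contra h'
      exact hbad (.order s t hs ht p q r u h h')
  obtain ⟨i⟩ := ‹Nonempty I›
  obtain ⟨j, hij⟩ := exists_gt i
  -- Meets along the comb, then their lengths: these are strictly increasing, so form a nonconstant
  -- sequence in the smaller spoiled set.
  exact hbad (.meet hc (.conn false (Bad.cons (b := false) _ g₀ (hY (fun i => (c i).q)
    ⟨i, j, (Trunc.q_lt_of_lt (hmono hij)).ne⟩))))

end Power

/-! ### Induction on the cardinal -/

open Cardinal in
-- Each ordinal below `κ` is sent to a member of a short cofinal set that lies above it; the fibers
-- are then bounded, hence small.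
theorem exists_fibers_lt {κ : Cardinal.{w}} (hκ : ℵ₀ ≤ κ) (h : ¬ κ.IsRegular) :
    ∃ (A ι : Type w) (idx : A → ι), #A = κ ∧ #ι < κ ∧ ∀ i, #{x // idx x = i} < κ := by
  have hcof : κ.ord.cof < κ := by
    by_contra hn
    exact h ⟨hκ, not_lt.1 hn⟩
  have := Cardinal.noMaxOrder hκ
  obtain ⟨s, hs, hs'⟩ := Order.exists_cof_eq κ.ord.ToType
  choose idx hidx hle using fun x => hs x
  refine ⟨κ.ord.ToType, s, fun x => ⟨idx x, hidx x⟩, mk_ord_toType κ, ?_, fun i => ?_⟩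
  · rw [hs', Ordinal.cof_toType]
    exact hcof
  · obtain ⟨j, hj⟩ := exists_gt (i : κ.ord.ToType)
    refine lt_of_le_of_lt (mk_le_mk_of_subset (s := {x | (⟨idx x, hidx x⟩ : s) = i}) fun x hx => ?_)
      ((mk_Iio_lt j (by simp)).trans_eq (mk_ord_toType κ))
    have hx : (⟨idx x, hidx x⟩ : s) = i := hx
    exact (hle x).trans_lt (lt_of_eq_of_lt (congrArg Subtype.val hx) hj)

open Cardinal in
theorem spoiled_of_not_inaccessible {μ : Cardinal.{w}} (hμ : ℵ₀ ≤ μ) (κ : Cardinal.{w})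
    (h : ∀ θ ∈ Set.Icc μ κ, ¬ θ.IsInaccessible) (A : Type w) (hA : #A = κ) :
    Spoiled (Set.Iio μ.ord) A := by
  have hlim := isSuccLimit_ord hμ
  have : Nonempty (Set.Iio μ.ord) := ⟨⟨0, hlim.bot_lt⟩⟩
  have : NoMaxOrder (Set.Iio μ.ord) :=
    ⟨fun i => ⟨⟨_, hlim.succ_lt i.2⟩, Order.lt_succ (i : Ordinal)⟩⟩
  induction κ using WellFoundedLT.induction generalizing A with
  | ind κ ih =>
    have ih' : ∀ B : Type w, #B < κ → Spoiled (Set.Iio μ.ord) B := fun B hB =>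
      ih _ hB (fun θ hθ => h θ ⟨hθ.1, hθ.2.trans hB.le⟩) B rfl
    have hle : ∀ B : Type w, #A ≤ #B → Spoiled (Set.Iio μ.ord) B → Spoiled (Set.Iio μ.ord) A :=
      fun B hB hs => hs.of_injective hB.some.injective
    rcases lt_or_ge κ μ with hκ | hκ
    -- Below `μ` there is no room for an injective sequence of length `μ.ord`.
    · refine .of_not_injective fun a ha => ?_
      have h1 := lift_mk_le_lift_mk_of_injective ha
      rw [mk_Iio_ordinal, card_ord, hA] at h1
      simp only [lift_lift, lift_le] at h1
      exact hκ.not_ge h1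
    rcases (hμ.trans hκ).eq_or_lt with hω | hω
    · refine hle (ULift.{w} ℕ) ?_ spoiled_nat
      rw [hA, ← hω]
      simp
    by_cases hr : κ.IsRegular
    · have hs : ¬ κ.IsStrongPrelimit := fun hs =>
        h κ ⟨hκ, le_rfl⟩ ⟨hω, hr.2, hs⟩
      obtain ⟨c, hc, hc'⟩ : ∃ c < κ, κ ≤ 2 ^ c := by
        simp only [IsStrongPrelimit, not_forall, not_lt] at hs
        obtain ⟨c, hc, hc'⟩ := hs
        exact ⟨c, hc, hc'⟩
      -- The exponent is made infinite so that adjoining a top element does not change its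
      -- cardinality and the induction hypothesis applies to `WithTop Λ`.
      have hm : max c ℵ₀ < κ := max_lt hc hω
      refine hle ((max c ℵ₀).ord.ToType → Fin 2) ?_ (Spoiled.power (ih' _ ?_))
      · rw [hA, mk_arrow, mk_ord_toType]
        simp only [mk_fintype, Fintype.card_fin, Nat.cast_ofNat, lift_ofNat, lift_uzero]
        exact hc'.trans (power_le_power_left two_ne_zero (le_max_left _ _))
      · refine lt_of_eq_of_lt ?_ hm
        refine (mk_option (α := (max c ℵ₀).ord.ToType)).trans ?_
        rw [mk_ord_toType]
        exact add_one_eq (le_max_right _ _)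
    · obtain ⟨B, ι, idx, hB, hι, hf⟩ := exists_fibers_lt hω.le hr
      exact hle B (hA.trans hB.symm).le (.of_fibers (ih' _ hι) idx fun i => ih' _ (hf i))

/-- The spoiled system is embedded in a model of `T`, and its points are turned into constant
`ι`-tuples. The case `κ < μ` is included. -/
theorem not_arrow {T : (treeLang Set.univ).Theory}
    (hT : ∀ (A : Type w) [Nonempty A] [(treeLang Set.univ).Structure A], IsTreeModel Set.univ A →
      ∃ M : Theory.ModelType.{0, 0, w} T, Nonempty (A ↪[treeLang Set.univ] M))
    {μ κ : Cardinal.{w}} (hμ : ℵ₀ ≤ μ) (h : ∀ θ ∈ Set.Icc μ κ, ¬ θ.IsInaccessible) (ι : Type)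
    [Nonempty ι] : ¬ Arrow T κ μ.ord ι := by
  intro hκ
  have hlim := Cardinal.isSuccLimit_ord hμ
  have : NoMaxOrder (Set.Iio μ.ord) :=
    ⟨fun i => ⟨⟨_, hlim.succ_lt i.2⟩, Order.lt_succ (i : Ordinal)⟩⟩
  obtain ⟨X, e, he, hX⟩ := spoiled_of_not_inaccessible hμ κ h κ.out (Cardinal.mk_out κ)
  obtain ⟨M, ⟨f⟩⟩ := hT X.Carrier (X.isTreeModel _)
  let d : κ.out → ι → M := fun x _ => f (pt [] (e x))
  have hd : Function.Injective d := fun x y hxy =>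
    he (pt_inj.1 (f.injective (congrFun hxy (Classical.arbitrary ι))))
  obtain ⟨a, ha, ⟨i, j, hij⟩, hind⟩ := hκ M (Set.range d)
    ((Cardinal.mk_range_eq d hd).trans (Cardinal.mk_out κ))
  choose b hb using ha
  obtain rfl : (fun i => d (b i)) = a := funext hb
  exact (hX b ⟨i, j, fun h => hij (congrArg d h)⟩).not_isIndiscernible f (ι := ι) hind

end TreeOfTrees

theorem theorem2 :
    (∀ n, ∃ T' : (TreeOfTrees.treeLang (TreeOfTrees.nodes n)).Theory,
      TreeOfTrees.IsModelCompletion (TreeOfTrees.univTheory (TreeOfTrees.nodes n)) T') ∧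
    ∀ Tn : ∀ n, (TreeOfTrees.treeLang (TreeOfTrees.nodes n)).Theory,
      (∀ n, TreeOfTrees.IsModelCompletion
        (TreeOfTrees.univTheory (TreeOfTrees.nodes n)) (Tn n)) →
      Countable (TreeOfTrees.treeLang Set.univ).Symbols ∧
      (TreeOfTrees.unionTheory Tn).Countable ∧
      (TreeOfTrees.unionTheory Tn).IsComplete ∧
      TreeOfTrees.EliminatesQuantifiers (TreeOfTrees.unionTheory Tn) ∧
      TreeOfTrees.IsDependent.{w, 0, 0} (TreeOfTrees.unionTheory Tn) ∧
      (∀ μ κ : Cardinal.{w}, ℵ₀ ≤ μ → μ ≤ κ →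
        (∀ θ ∈ Set.Icc μ κ, ¬ θ.IsInaccessible) →
        ¬ TreeOfTrees.Arrow (TreeOfTrees.unionTheory Tn) κ μ.ord (Fin 1)) ∧
      (∀ κ : Cardinal.{w}, (∀ θ ≤ κ, ¬ θ.IsInaccessible) →
        ∀ n : ℕ, 1 ≤ n →
          ¬ TreeOfTrees.Arrow (TreeOfTrees.unionTheory Tn) κ ω (Fin n)) := by
  refine ⟨fun n => ⟨_, TreeOfTrees.isModelCompletion_completeTheory n⟩, fun Tn hTn =>
    ⟨TreeOfTrees.countable_symbols _, TreeOfTrees.countable_unionTheory,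
      TreeOfTrees.isComplete_unionTheory hTn, TreeOfTrees.eliminatesQuantifiers_unionTheory hTn,
      TreeOfTrees.isDependent_unionTheory hTn, fun μ κ hμ _ h => ?_, fun κ h n hn => ?_⟩⟩
  · exact TreeOfTrees.not_arrow (TreeOfTrees.exists_embedding_unionTheory hTn) hμ h (Fin 1)
  · have : NeZero n := ⟨by omega⟩
    -- The second claim is the case `μ = ℵ₀`, finite `κ` included.
    rw [← Cardinal.ord_aleph0]
    exact TreeOfTrees.not_arrow (TreeOfTrees.exists_embedding_unionTheory hTn) le_rfl
      (fun θ hθ => h θ hθ.2) (Fin n)
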